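/- **Definitions.** A *rectilinear $n$-gon* $P$ is a polygon with $n$ vertices, possibly with holes, whose boundary curves are simple, pairwise disjoint, and consist of alternately horizontal and vertical edges. A *stabbing segment* of $P$ is an axis-aligned open line segment of positive length that lies in the interior of $P$. A *reflex segment* of $P$ is a stabbing segment of maximal length one of whose endpoints is a reflex vertex of $P$ (a vertex with interior angle $3\pi/2$). $P$ is *thin* if no two distinct reflex segments intersect, and it is in *general position* if no three of its vertices lie on one axis-aligned line. A *rectangular partition* of $P$ is a finite set of axis-aligned rectangles with pairwise disjoint interiors whose union is $P$ (Steiner points are allowed). Its stabbing number is the maximum, over all stabbing segments $s$ of $P$, of the number of rectangles of the partition whose interior is intersected by $s$. The *stabbing number* of $P$ is the minimum of the stabbing numbers of its rectangular partitions. **Theorem.** There is an algorithm (on a real RAM with unit-cost instructions, the input being $n$, the real coordinates of the vertices, and for each vertex its successor along its boundary component) that, for every rectilinear $n$-gon $P$ that is thin and in general position, computes the stabbing number of $P$ in $O(n)$ time. Moreover, for every such $P$, every stabbing segment of $P$ intersects at most two reflex segments, and the stabbing number of $P$ is $1$, $2$ or $3$. -/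

import Mathlib

/-! ### Rectilinear polygons, possibly with holes -/

/-- `n` points of the plane together with a permutation `next` that links them into closed
rectilinear curves: `i` is joined to `next i`, and each cycle of `next` is one boundary
component (the outer boundary or the boundary of a hole). -/
structure RectilinearBoundary (n : ℕ) where
  vtx : Fin n → ℝ × ℝ
  next : Equiv.Perm (Fin n)

namespace RectilinearBoundary

variable {n : ℕ} (B : RectilinearBoundary n)

/-- The closed edge from vertex `i` to its successor. -/
def edge (i : Fin n) : Set (ℝ × ℝ) := segment ℝ (B.vtx i) (B.vtx (B.next i))

/-- The union of all edges. -/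
def boundary : Set (ℝ × ℝ) := ⋃ i, B.edge i

/-- Edge `i` is vertical and is hit by the horizontal ray that leaves `z` to the right. The
`y`-range of the edge is taken half-open, so that a ray through a vertex is counted properly. -/
def RayHits (z : ℝ × ℝ) (i : Fin n) : Prop :=
  (B.vtx i).1 = (B.vtx (B.next i)).1 ∧ z.1 < (B.vtx i).1 ∧
    min (B.vtx i).2 (B.vtx (B.next i)).2 ≤ z.2 ∧ z.2 < max (B.vtx i).2 (B.vtx (B.next i)).2

/-- The points enclosed by the boundary curves (even-odd rule): the points off the boundary
whose rightward ray hits an odd number of edges. -/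
def inside : Set (ℝ × ℝ) := {z | z ∉ B.boundary ∧ Odd {i | B.RayHits z i}.ncard}

end RectilinearBoundary

/-- A rectilinear polygon with `n` vertices, possibly with holes. Its boundary consists of
pairwise disjoint simple closed curves whose edges are alternately horizontal and vertical
(so every vertex is a corner). Connectedness of the interior says that there is a single outer
boundary curve and that the other curves bound holes that are not nested. -/
structure RectilinearPolygon (n : ℕ) extends RectilinearBoundary n where
  vtx_injective : Function.Injective vtx
  next_ne : ∀ i, next i ≠ i
  alternating : ∀ i,
    ((vtx i).2 = (vtx (next i)).2 ∧ (vtx (next i)).1 = (vtx (next (next i))).1) ∨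
    ((vtx i).1 = (vtx (next i)).1 ∧ (vtx (next i)).2 = (vtx (next (next i))).2)
  /-- Two distinct edges meet at most in a vertex at which they are consecutive. -/
  simple : ∀ i j, i ≠ j → ∀ z ∈ toRectilinearBoundary.edge i ∩ toRectilinearBoundary.edge j,
    (next i = j ∧ z = vtx j) ∨ (next j = i ∧ z = vtx i)
  connected : IsConnected toRectilinearBoundary.inside

/-- A nondegenerate closed axis-aligned rectangle, given by two opposite corners. -/
structure AxisRect where
  lo : ℝ × ℝ
  hi : ℝ × ℝ
  fst_lt : lo.1 < hi.1
  snd_lt : lo.2 < hi.2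

namespace AxisRect

/-- The points of the closed rectangle. -/
def carrier (R : AxisRect) : Set (ℝ × ℝ) := Set.Icc R.lo.1 R.hi.1 ×ˢ Set.Icc R.lo.2 R.hi.2

/-- The points of the open rectangle. -/
def inner (R : AxisRect) : Set (ℝ × ℝ) := Set.Ioo R.lo.1 R.hi.1 ×ˢ Set.Ioo R.lo.2 R.hi.2

end AxisRect

namespace RectilinearPolygon

variable {n : ℕ} (P : RectilinearPolygon n)

/-- The closed region bounded by the polygon. -/
def region : Set (ℝ × ℝ) := P.inside ∪ P.boundary

/-- No three vertices lie on one axis-aligned line. -/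
def GeneralPosition : Prop :=
  ∀ i j k, i ≠ j → j ≠ k → i ≠ k →
    ¬ ((P.vtx i).1 = (P.vtx j).1 ∧ (P.vtx j).1 = (P.vtx k).1) ∧
    ¬ ((P.vtx i).2 = (P.vtx j).2 ∧ (P.vtx j).2 = (P.vtx k).2)

/-- Vertex `i` is reflex: its interior angle is `3π/2`, that is, the small right-angled wedge
spanned by the two edges at the vertex lies outside the polygon. -/
def IsReflex (i : Fin n) : Prop :=
  ∃ ε : ℝ, 0 < ε ∧ ∀ s ∈ Set.Ioo 0 ε, ∀ t ∈ Set.Ioo 0 ε,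
    P.vtx i + s • (P.vtx (P.next.symm i) - P.vtx i)
      + t • (P.vtx (P.next i) - P.vtx i) ∉ P.inside

/-- The open axis-aligned segment with ends `a` and `b` lies in the interior of the polygon. -/
def IsStab (a b : ℝ × ℝ) : Prop :=
  a ≠ b ∧ (a.1 = b.1 ∨ a.2 = b.2) ∧ openSegment ℝ a b ⊆ P.inside

/-- The stabbing segments: axis-aligned open segments in the interior of the polygon. -/
def stabbingSegments : Set (Set (ℝ × ℝ)) := {s | ∃ a b, P.IsStab a b ∧ s = openSegment ℝ a b}

/-- The reflex segments: axis-aligned open segments in the interior of the polygon that are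
maximal (both ends lie on the boundary) and have a reflex vertex as an end. -/
def reflexSegments : Set (Set (ℝ × ℝ)) :=
  {s | ∃ i b, P.IsReflex i ∧ P.IsStab (P.vtx i) b ∧ b ∈ P.boundary ∧
    s = openSegment ℝ (P.vtx i) b}

/-- No two (distinct) reflex segments intersect. -/
def Thin : Prop := P.reflexSegments.PairwiseDisjoint id

/-- A finite set of rectangles that tile the polygon; Steiner points are allowed. -/
def IsRectPartition (𝓡 : Finset AxisRect) : Prop :=
  (⋃ R ∈ 𝓡, R.carrier) = P.region ∧ (𝓡 : Set AxisRect).PairwiseDisjoint AxisRect.inner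

/-- The number of rectangles of `𝓡` whose interior is met by `s`. -/
noncomputable def stabCount (𝓡 : Finset AxisRect) (s : Set (ℝ × ℝ)) : ℕ :=
  {R | R ∈ 𝓡 ∧ (R.inner ∩ s).Nonempty}.ncard

/-- `k` is the stabbing number of the partition `𝓡`: the maximum over all stabbing segments of
the number of rectangles stabbed. -/
def IsPartitionStabbingNumber (𝓡 : Finset AxisRect) (k : ℕ) : Prop :=
  IsGreatest (stabCount 𝓡 '' P.stabbingSegments) k

/-- `k` is the stabbing number of the polygon: the minimum of the stabbing numbers of its
partitions into rectangles. -/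
def IsStabbingNumber (k : ℕ) : Prop :=
  IsLeast {k | ∃ 𝓡, P.IsRectPartition 𝓡 ∧ P.IsPartitionStabbingNumber 𝓡 k} k

end RectilinearPolygon

/-! ### A real random access machine

A load/store machine with natural-number registers `Z` and real registers `R`, a memory of
natural numbers and a memory of reals. A program addresses registers directly by their number,
and memory indirectly by the content of a natural-number register. Each instruction costs one
time unit. -/

namespace RealRAM

inductive Instr where
  /-- `Z[d] := k` -/
  | const (d k : ℕ)
  /-- `Z[d] := Z[a] + Z[b]` -/
  | add (d a b : ℕ)
  /-- `Z[d] := Z[a] - Z[b]`, and `0` if `Z[a] < Z[b]` -/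
  | sub (d a b : ℕ)
  /-- `Z[d] := mem[Z[a]]` -/
  | load (d a : ℕ)
  /-- `mem[Z[a]] := Z[b]` -/
  | store (a b : ℕ)
  /-- if `Z[a] < Z[b]` then continue at line `l` -/
  | jumpLT (a b l : ℕ)
  /-- `R[d] := q` -/
  | rconst (d : ℕ) (q : ℚ)
  /-- `R[d] := R[a] + R[b]` -/
  | radd (d a b : ℕ)
  /-- `R[d] := R[a] - R[b]` -/
  | rsub (d a b : ℕ)
  /-- `R[d] := R[a] * R[b]` -/
  | rmul (d a b : ℕ)
  /-- `R[d] := R[a] / R[b]`, and `0` if `R[b] = 0` -/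
  | rdiv (d a b : ℕ)
  /-- `R[d] := rmem[Z[a]]` -/
  | rload (d a : ℕ)
  /-- `rmem[Z[a]] := R[b]` -/
  | rstore (a b : ℕ)
  /-- if `R[a] < R[b]` then continue at line `l` -/
  | rjumpLT (a b l : ℕ)
  /-- stop -/
  | halt

/-- A program is a finite list of instructions, with lines numbered from `0`. -/
abbrev Program := List Instr

structure State where
  /-- the number of the line to be executed next -/
  pc : ℕ
  Z : ℕ → ℕ
  R : ℕ → ℝ
  mem : ℕ → ℕ
  rmem : ℕ → ℝ

/-- The effect of one instruction; `none` for `halt`. -/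
noncomputable def Instr.exec (s : State) : Instr → Option State
  | const d k => some { s with pc := s.pc + 1, Z := Function.update s.Z d k }
  | add d a b => some { s with pc := s.pc + 1, Z := Function.update s.Z d (s.Z a + s.Z b) }
  | sub d a b => some { s with pc := s.pc + 1, Z := Function.update s.Z d (s.Z a - s.Z b) }
  | load d a => some { s with pc := s.pc + 1, Z := Function.update s.Z d (s.mem (s.Z a)) }
  | store a b => some { s with pc := s.pc + 1, mem := Function.update s.mem (s.Z a) (s.Z b) }
  | jumpLT a b l => some { s with pc := if s.Z a < s.Z b then l else s.pc + 1 }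
  | rconst d q => some { s with pc := s.pc + 1, R := Function.update s.R d (q : ℝ) }
  | radd d a b => some { s with pc := s.pc + 1, R := Function.update s.R d (s.R a + s.R b) }
  | rsub d a b => some { s with pc := s.pc + 1, R := Function.update s.R d (s.R a - s.R b) }
  | rmul d a b => some { s with pc := s.pc + 1, R := Function.update s.R d (s.R a * s.R b) }
  | rdiv d a b => some { s with pc := s.pc + 1, R := Function.update s.R d (s.R a / s.R b) }
  | rload d a => some { s with pc := s.pc + 1, R := Function.update s.R d (s.rmem (s.Z a)) }
  | rstore a b => some { s with pc := s.pc + 1, rmem := Function.update s.rmem (s.Z a) (s.R b) }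
  | rjumpLT a b l => some { s with pc := if s.R a < s.R b then l else s.pc + 1 }
  | halt => none

/-- One step of the machine; `none` if it has halted (`halt`, or no line with this number). -/
noncomputable def step (p : Program) (s : State) : Option State := p[s.pc]?.bind (Instr.exec s)

/-- `Reaches p s t s'`: the machine executes exactly `t` instructions from `s` and is then
in state `s'`. -/
inductive Reaches (p : Program) : State → ℕ → State → Prop
  | refl (s : State) : Reaches p s 0 s
  | tail {s u v : State} {t : ℕ} : Reaches p s t u → step p u = some v → Reaches p s (t + 1) v

/-- Started in `s`, the program halts after at most `T` steps with output `out` in `Z[0]`. -/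
def HaltsWithin (p : Program) (s : State) (T out : ℕ) : Prop :=
  ∃ t ≤ T, ∃ u, Reaches p s t u ∧ step p u = none ∧ u.Z 0 = out

/-- The start state for the polygon `P` with vertices `0, …, n - 1`: `Z[0]` holds `n`, `mem[i]`
holds the successor of vertex `i` on its boundary component, and `rmem[2 i]`, `rmem[2 i + 1]`
hold the coordinates of vertex `i`. Everything else is `0`. -/
noncomputable def start {n : ℕ} (P : RectilinearPolygon n) : State where
  pc := 0
  Z := fun r => if r = 0 then n else 0
  R := fun _ => 0
  mem := fun i => if h : i < n then P.next ⟨i, h⟩ else 0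
  rmem := fun m => if h : m / 2 < n then
    (if m % 2 = 0 then (P.vtx ⟨m / 2, h⟩).1 else (P.vtx ⟨m / 2, h⟩).2) else 0

end RealRAM

/-! Each reflex vertex has two cuts, the maximal extensions of its two edges into the polygon, and
the reflex segments are exactly these cuts (`mem_reflexSegments`). In a thin polygon in general
position the stabbing number is 1 if there is no reflex vertex and 2 otherwise, so the value 3 does
not occur. A polygon without reflex vertices is a rectangle and has at most four vertices
(`le_four`); one with a reflex vertex has at least five (`GeneralPosition.five_le`). The algorithm
therefore only compares n with 5.

Upper bound 2. The main tool is the corner lemma `exists_reflex_corner`: if an L-shaped path is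
inside and the opposite corner of its box is on the boundary, then the box contains a reflex vertex
whose two cuts cross the two arms. Say that two distinct cuts conflict if one stabbing segment meets
both. In a thin polygon a horizontal segment that crosses the vertical cut of a vertex meets other
cuts only on the side of that vertex's horizontal edge (`Thin.turn`): on the other side, the corner
lemma would make two cuts cross. All conflicts of a cut thus lie on one side of it, and of two
supposed partners the nearer one would have conflicts on both of its own sides. So every cut has at
most one partner (`Thin.conflict_unique`), which also bounds the number of reflex segments met by a
stabbing segment.

The cuts fall into classes of at most two, and k reflex vertices own 2k distinct cuts, hence meet at
least k classes. Hall's theorem assigns distinct classes to the vertices, that is, one cut to each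
vertex without conflicts (`Thin.exists_selection`). One cut per reflex vertex suffices to split the
interior into open rectangles (`exists_isFace`), and a stabbing segment crosses at most one selected
cut, so it meets at most two of them.

Lower bound 2. Near a reflex vertex, if every stabbing segment met only one rectangle, then three of
the four quadrants would have points in a common rectangle, which would reach into the outer
quadrant (`IsReflex.exists_two_le`).

The topology rests on `par`: modulo 2, the number of edges hit by a ray is a number of vertices in a
quadrant. This makes the even-odd rule symmetric under reflections and easy to follow along
axis-parallel moves. -/

namespace RectilinearBoundary

/-! ### The even-odd rule as a parity of vertices in a quadrant. -/

variable {n : ℕ} (B : RectilinearBoundary n)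

/-- The edges are nondegenerate and alternately horizontal and vertical. -/
structure Alternates : Prop where
  ne : ∀ i, B.vtx i ≠ B.vtx (B.next i)
  alt : ∀ i,
    ((B.vtx i).2 = (B.vtx (B.next i)).2 ∧
      (B.vtx (B.next i)).1 = (B.vtx (B.next (B.next i))).1) ∨
    ((B.vtx i).1 = (B.vtx (B.next i)).1 ∧
      (B.vtx (B.next i)).2 = (B.vtx (B.next (B.next i))).2)

/-- Edge `i` is horizontal. -/
def IsHor (i : Fin n) : Prop := (B.vtx i).2 = (B.vtx (B.next i)).2

/-- The parity of the number of vertices strictly to the right of and weakly below `z`. -/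
noncomputable def par (z : ℝ × ℝ) : ZMod 2 :=
  ∑ i, if z.1 < (B.vtx i).1 ∧ (B.vtx i).2 ≤ z.2 then 1 else 0

variable {B}

theorem Alternates.vert_iff (h : B.Alternates) (i : Fin n) :
    (B.vtx i).1 = (B.vtx (B.next i)).1 ↔ ¬ B.IsHor i := by
  constructor
  · intro h1 h2
    exact h.ne i (Prod.ext h1 h2)
  · intro h1
    rcases h.alt i with h2 | h2
    · exact absurd h2.1 h1
    · exact h2.1

theorem Alternates.hor_next (h : B.Alternates) (i : Fin n) :
    B.IsHor (B.next i) ↔ ¬ B.IsHor i := by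
  rw [← h.vert_iff]
  rcases h.alt i with h2 | h2
  · have h3 := (h.vert_iff _).1 h2.2
    have h4 : B.IsHor i := h2.1
    have h5 := h.vert_iff i
    tauto
  · have h3 : B.IsHor (B.next i) := h2.2
    tauto

-- Every vertex is an end of exactly one vertical edge, because the edges alternate along `next`.
-- Summing over vertical edges therefore visits each vertex once.
open Classical in
theorem Alternates.sum_vert (h : B.Alternates) (g : Fin n → ZMod 2) :
    ∑ i, (if B.IsHor i then 0 else g i + g (B.next i)) = ∑ i, g i := by
  have h1 : ∑ i, (if B.IsHor i then 0 else g (B.next i)) = ∑ i, if B.IsHor i then g i else 0 := by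
    rw [← Equiv.sum_comp B.next (fun i => if B.IsHor i then g i else 0)]
    refine Finset.sum_congr rfl fun i _ => ?_
    by_cases hi : B.IsHor i <;> simp [h.hor_next, hi]
  calc _ = ∑ i, ((if B.IsHor i then 0 else g i) + (if B.IsHor i then 0 else g (B.next i))) := by
        refine Finset.sum_congr rfl fun i _ => ?_
        split_ifs <;> simp
    _ = _ := by
        rw [Finset.sum_add_distrib, h1, ← Finset.sum_add_distrib]
        refine Finset.sum_congr rfl fun i _ => ?_
        split_ifs <;> simp

open Classical in
theorem Alternates.sum_hor (h : B.Alternates) (g : Fin n → ZMod 2) :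
    ∑ i, (if B.IsHor i then g i + g (B.next i) else 0) = ∑ i, g i := by
  have h1 : ∑ i, (if B.IsHor i then g (B.next i) else 0) = ∑ i, if B.IsHor i then 0 else g i := by
    rw [← Equiv.sum_comp B.next (fun i => if B.IsHor i then 0 else g i)]
    refine Finset.sum_congr rfl fun i _ => ?_
    by_cases hi : B.IsHor i <;> simp [h.hor_next, hi]
  calc _ = ∑ i, ((if B.IsHor i then g i else 0) + (if B.IsHor i then g (B.next i) else 0)) := by
        refine Finset.sum_congr rfl fun i _ => ?_
        split_ifs <;> simp
    _ = _ := by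
        rw [Finset.sum_add_distrib, h1, ← Finset.sum_add_distrib]
        refine Finset.sum_congr rfl fun i _ => ?_
        split_ifs <;> simp

/-- The two ends of a vertical edge cancel modulo 2. Nearly all parity computations below reduce to
this pairing or to its horizontal analogue. -/
theorem Alternates.sum_eq_zero_of_vert (h : B.Alternates) (g : Fin n → ZMod 2)
    (hg : ∀ i, ¬ B.IsHor i → g i = g (B.next i)) : ∑ i, g i = 0 := by
  classical
  rw [← h.sum_vert g]
  refine Finset.sum_eq_zero fun i _ => ?_
  split_ifs with hi
  · rfl
  · rw [hg i hi, CharTwo.add_self_eq_zero]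

theorem Alternates.sum_eq_zero_of_hor (h : B.Alternates) (g : Fin n → ZMod 2)
    (hg : ∀ i, B.IsHor i → g i = g (B.next i)) : ∑ i, g i = 0 := by
  classical
  rw [← h.sum_hor g]
  refine Finset.sum_eq_zero fun i _ => ?_
  split_ifs with hi
  · rw [hg i hi, CharTwo.add_self_eq_zero]
  · rfl

/-- With the half-open range, a vertical edge to the right of `z` is hit exactly when one of its
ends is weakly below `z` and the other is not. Modulo 2 the hit can thus be counted at the ends. -/
theorem Alternates.ncard_rayHits (h : B.Alternates) (z : ℝ × ℝ) :
    (({i | B.RayHits z i}.ncard : ℕ) : ZMod 2) = B.par z := by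
  classical
  rw [par, ← h.sum_vert, Set.ncard_eq_toFinset_card', Finset.card_eq_sum_ones, Nat.cast_sum,
    Set.toFinset_ofPred, Finset.sum_filter]
  refine Finset.sum_congr rfl fun i _ => ?_
  by_cases hi : B.IsHor i
  · have := (h.vert_iff i).not_left.2 hi
    simp [RayHits, hi, this]
  · have hv := (h.vert_iff i).2 hi
    simp only [RayHits, hi, ← hv, if_false, true_and]
    by_cases hx : z.1 < (B.vtx i).1
    · simp only [hx, true_and]
      rcases le_total (B.vtx i).2 (B.vtx (B.next i)).2 with h1 | h1
      · simp only [min_eq_left h1, max_eq_right h1, ← not_le]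
        by_cases ha : (B.vtx i).2 ≤ z.2 <;> by_cases hb : (B.vtx (B.next i)).2 ≤ z.2 <;>
          simp [ha, hb, CharTwo.two_eq_zero, one_add_one_eq_two]
        exact ha (h1.trans hb)
      · simp only [min_eq_right h1, max_eq_left h1, ← not_le]
        by_cases ha : (B.vtx i).2 ≤ z.2 <;> by_cases hb : (B.vtx (B.next i)).2 ≤ z.2 <;>
          simp [ha, hb, CharTwo.two_eq_zero, one_add_one_eq_two]
        exact hb (h1.trans ha)
    · simp [hx]

theorem Alternates.mem_inside (h : B.Alternates) {z : ℝ × ℝ} :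
    z ∈ B.inside ↔ z ∉ B.boundary ∧ B.par z = 1 := by
  rw [inside, Set.mem_ofPred_eq, ← h.ncard_rayHits, ZMod.natCast_eq_one_iff_odd]

/-- Points on a vertical edge. -/
theorem Alternates.mem_edge_vert (h : B.Alternates) {i : Fin n} (hi : ¬ B.IsHor i) {z : ℝ × ℝ} :
    z ∈ B.edge i ↔ z.1 = (B.vtx i).1 ∧ z.2 ∈ Set.uIcc (B.vtx i).2 (B.vtx (B.next i)).2 := by
  have hv := (h.vert_iff i).2 hi
  have : B.edge i = (fun y => ((B.vtx i).1, y)) '' Set.uIcc (B.vtx i).2 (B.vtx (B.next i)).2 := by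
    rw [← segment_eq_uIcc, Prod.image_mk_segment_right]
    conv_lhs => rw [edge]
    rw [show B.vtx (B.next i) = ((B.vtx i).1, (B.vtx (B.next i)).2) from Prod.ext hv.symm rfl]
  rw [this]
  constructor
  · rintro ⟨y, hy, rfl⟩; exact ⟨rfl, hy⟩
  · rintro ⟨h1, h2⟩; exact ⟨z.2, h2, Prod.ext h1.symm rfl⟩

theorem mem_edge_hor {i : Fin n} (hi : B.IsHor i) {z : ℝ × ℝ} :
    z ∈ B.edge i ↔ z.2 = (B.vtx i).2 ∧ z.1 ∈ Set.uIcc (B.vtx i).1 (B.vtx (B.next i)).1 := by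
  have : B.edge i = (fun x => (x, (B.vtx i).2)) '' Set.uIcc (B.vtx i).1 (B.vtx (B.next i)).1 := by
    rw [← segment_eq_uIcc, Prod.image_mk_segment_left]
    conv_lhs => rw [edge]
    rw [show B.vtx (B.next i) = ((B.vtx (B.next i)).1, (B.vtx i).2) from Prod.ext rfl hi.symm]
  rw [this]
  constructor
  · rintro ⟨y, hy, rfl⟩; exact ⟨rfl, hy⟩
  · rintro ⟨h1, h2⟩; exact ⟨z.1, h2, Prod.ext rfl h1.symm⟩

theorem edge_subset_boundary (i : Fin n) : B.edge i ⊆ B.boundary := Set.subset_iUnion _ i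

theorem vtx_mem_boundary (i : Fin n) : B.vtx i ∈ B.boundary :=
  edge_subset_boundary i (left_mem_segment ℝ _ _)

theorem isClosed_edge (i : Fin n) : IsClosed (B.edge i) := by
  rw [edge, segment_eq_image_lineMap]
  exact (isCompact_Icc.image AffineMap.lineMap_continuous).isClosed

theorem isClosed_boundary : IsClosed B.boundary := isClosed_iUnion_of_finite isClosed_edge

/-- Moving to the right off the boundary keeps the parity. -/
theorem Alternates.par_horizontal (h : B.Alternates) {x x' y : ℝ} (hx : x ≤ x')
    (hf : ∀ t ∈ Set.Ioc x x', (t, y) ∉ B.boundary) : B.par (x, y) = B.par (x', y) := by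
  rw [← sub_eq_zero, par, par, ← Finset.sum_sub_distrib]
  -- Only vertical edges with abscissa in `(x, x']` matter. The path misses them, so both ends lie
  -- on the same side of height `y`.
  refine h.sum_eq_zero_of_vert _ fun i hi => ?_
  have hv := (h.vert_iff i).2 hi
  rw [← hv]
  by_cases h1 : x < (B.vtx i).1
  · by_cases h2 : x' < (B.vtx i).1
    · simp [h1, h2]
    · have h3 : ((B.vtx i).1, y) ∉ B.edge i := fun h4 =>
        hf _ ⟨h1, not_lt.1 h2⟩ (edge_subset_boundary i h4)
      rw [h.mem_edge_vert hi, Set.mem_uIcc] at h3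
      have : (B.vtx i).2 ≤ y ↔ (B.vtx (B.next i)).2 ≤ y := by
        constructor
        · intro h4
          by_contra h5
          exact h3 ⟨rfl, Or.inl ⟨h4, (not_le.1 h5).le⟩⟩
        · intro h4
          by_contra h5
          exact h3 ⟨rfl, Or.inr ⟨h4, (not_le.1 h5).le⟩⟩
      simp [h1, h2, this]
  · have h2 : ¬ x' < (B.vtx i).1 := fun h3 => h1 (hx.trans_lt h3)
    simp [h1, h2]

/-- Moving up off the boundary keeps the parity. -/
theorem Alternates.par_vertical (h : B.Alternates) {x y y' : ℝ} (hy : y ≤ y')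
    (hf : ∀ t ∈ Set.Ioc y y', (x, t) ∉ B.boundary) : B.par (x, y) = B.par (x, y') := by
  rw [← sub_eq_zero, par, par, ← Finset.sum_sub_distrib]
  refine h.sum_eq_zero_of_hor _ fun i hi => ?_
  have hv : (B.vtx i).2 = (B.vtx (B.next i)).2 := hi
  rw [← hv]
  by_cases h1 : (B.vtx i).2 ≤ y
  · have h2 : (B.vtx i).2 ≤ y' := h1.trans hy
    simp [h1, h2]
  · by_cases h2 : (B.vtx i).2 ≤ y'
    · have h3 : (x, (B.vtx i).2) ∉ B.edge i := fun h4 =>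
        hf _ ⟨not_le.1 h1, h2⟩ (edge_subset_boundary i h4)
      rw [mem_edge_hor hi, Set.mem_uIcc] at h3
      have : x < (B.vtx i).1 ↔ x < (B.vtx (B.next i)).1 := by
        constructor
        · intro h4
          by_contra h5
          exact h3 ⟨rfl, Or.inr ⟨(not_lt.1 h5), h4.le⟩⟩
        · intro h4
          by_contra h5
          exact h3 ⟨rfl, Or.inl ⟨(not_lt.1 h5), h4.le⟩⟩
      simp [h1, h2, this]
    · simp [h1, h2]

/-- The four corners of a box: the parities add up to the parity of the number of vertices. -/
theorem par_box (x x' y y' : ℝ) (hx : x ≤ x') (hy : y ≤ y') :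
    B.par (x, y) + B.par (x, y') + B.par (x', y) + B.par (x', y') =
      ∑ i, if (B.vtx i).1 ∈ Set.Ioc x x' ∧ (B.vtx i).2 ∈ Set.Ioc y y' then 1 else 0 := by
  simp only [par, ← Finset.sum_add_distrib]
  refine Finset.sum_congr rfl fun i _ => ?_
  simp only [Set.mem_Ioc]
  have e1 : (B.vtx i).1 ≤ x' ↔ ¬ x' < (B.vtx i).1 := not_lt.symm
  have e2 : y < (B.vtx i).2 ↔ ¬ (B.vtx i).2 ≤ y := not_le.symm
  simp only [e1, e2]
  -- Inclusion-exclusion for four quadrants, checked for one vertex at a time.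
  by_cases h1 : x < (B.vtx i).1 <;> by_cases h2 : x' < (B.vtx i).1 <;>
    by_cases h3 : (B.vtx i).2 ≤ y <;> by_cases h4 : (B.vtx i).2 ≤ y' <;>
    first
    | exact absurd (hx.trans_lt h2) h1
    | exact absurd (h3.trans hy) h4
    | (simp only [h1, h2, h3, h4, and_true, and_false, not_true, not_false_iff, if_true, if_false]
       decide)

/-- Reflection in the vertical axis: the parity of the vertices to the left. -/
theorem Alternates.par_left (h : B.Alternates) {z : ℝ × ℝ} (hz : z ∉ B.boundary) :
    (∑ i, if (B.vtx i).1 < z.1 ∧ (B.vtx i).2 ≤ z.2 then (1 : ZMod 2) else 0) = B.par z := by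
  have h1 : (∑ i, if (B.vtx i).2 ≤ z.2 then (1 : ZMod 2) else 0) = 0 :=
    h.sum_eq_zero_of_hor _ fun i hi => by rw [show (B.vtx i).2 = _ from hi]
  have h2 : (∑ i, if (B.vtx i).1 = z.1 ∧ (B.vtx i).2 ≤ z.2 then (1 : ZMod 2) else 0) = 0 := by
    refine h.sum_eq_zero_of_vert _ fun i hi => ?_
    rw [← (h.vert_iff i).2 hi]
    by_cases hx : (B.vtx i).1 = z.1
    · have h3 : z ∉ B.edge i := fun h4 => hz (edge_subset_boundary i h4)
      rw [h.mem_edge_vert hi, Set.mem_uIcc] at h3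
      have : (B.vtx i).2 ≤ z.2 ↔ (B.vtx (B.next i)).2 ≤ z.2 := by
        constructor
        · intro h4
          by_contra h5
          exact h3 ⟨hx.symm, Or.inl ⟨h4, (not_le.1 h5).le⟩⟩
        · intro h4
          by_contra h5
          exact h3 ⟨hx.symm, Or.inr ⟨h4, (not_le.1 h5).le⟩⟩
      simp [hx, this]
    · simp [hx]
  -- Modulo 2, the vertices to the left, all vertices, and those on the vertical line through `z`
  -- add up to those to the right. The last two counts on the left-hand side are even by pairing
  -- along edges.
  have key : (∑ i, if (B.vtx i).1 < z.1 ∧ (B.vtx i).2 ≤ z.2 then (1 : ZMod 2) else 0) +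
      (∑ i, if (B.vtx i).2 ≤ z.2 then (1 : ZMod 2) else 0) +
      (∑ i, if (B.vtx i).1 = z.1 ∧ (B.vtx i).2 ≤ z.2 then (1 : ZMod 2) else 0) = B.par z := by
    rw [par, ← Finset.sum_add_distrib, ← Finset.sum_add_distrib]
    refine Finset.sum_congr rfl fun i _ => ?_
    by_cases h4 : (B.vtx i).2 ≤ z.2
    · rcases lt_trichotomy (B.vtx i).1 z.1 with h3 | h3 | h3
      · simp [h3, h4, h3.ne, h3.le.not_gt, CharTwo.add_self_eq_zero]
      · simp [h3, h4, CharTwo.add_self_eq_zero]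
      · simp [h3, h4, h3.ne', h3.le.not_gt]
    · simp [h4]
  rwa [h1, h2, add_zero, add_zero] at key

/-- Reflection in the horizontal axis: the parity of the vertices above. -/
theorem Alternates.par_above (h : B.Alternates) {z : ℝ × ℝ} (hz : z ∉ B.boundary) :
    (∑ i, if z.1 < (B.vtx i).1 ∧ z.2 ≤ (B.vtx i).2 then (1 : ZMod 2) else 0) = B.par z := by
  have h1 : (∑ i, if z.1 < (B.vtx i).1 then (1 : ZMod 2) else 0) = 0 :=
    h.sum_eq_zero_of_vert _ fun i hi => by rw [(h.vert_iff i).2 hi]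
  have h2 : (∑ i, if z.1 < (B.vtx i).1 ∧ (B.vtx i).2 = z.2 then (1 : ZMod 2) else 0) = 0 := by
    refine h.sum_eq_zero_of_hor _ fun i hi => ?_
    rw [← show (B.vtx i).2 = _ from hi]
    by_cases hx : (B.vtx i).2 = z.2
    · have h3 : z ∉ B.edge i := fun h4 => hz (edge_subset_boundary i h4)
      rw [mem_edge_hor hi, Set.mem_uIcc] at h3
      have : z.1 < (B.vtx i).1 ↔ z.1 < (B.vtx (B.next i)).1 := by
        constructor
        · intro h4
          by_contra h5
          exact h3 ⟨hx.symm, Or.inr ⟨not_lt.1 h5, h4.le⟩⟩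
        · intro h4
          by_contra h5
          exact h3 ⟨hx.symm, Or.inl ⟨not_lt.1 h5, h4.le⟩⟩
      simp [hx, this]
    · simp [hx]
  have key : (∑ i, if z.1 < (B.vtx i).1 ∧ z.2 ≤ (B.vtx i).2 then (1 : ZMod 2) else 0) +
      (∑ i, if z.1 < (B.vtx i).1 then (1 : ZMod 2) else 0) +
      (∑ i, if z.1 < (B.vtx i).1 ∧ (B.vtx i).2 = z.2 then (1 : ZMod 2) else 0) = B.par z := by
    rw [par, ← Finset.sum_add_distrib, ← Finset.sum_add_distrib]
    refine Finset.sum_congr rfl fun i _ => ?_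
    by_cases h4 : z.1 < (B.vtx i).1
    · rcases lt_trichotomy (B.vtx i).2 z.2 with h3 | h3 | h3
      · simp [h4, h3.ne, h3.not_ge, h3.le]
      · simp [h3, h4, CharTwo.add_self_eq_zero]
      · simp [h4, h3.ne', h3.not_ge, h3.le, CharTwo.add_self_eq_zero]
    · simp [h4]
  rwa [h1, h2, add_zero, add_zero] at key

/-- Exchange of the axes. -/
theorem Alternates.par_swap (h : B.Alternates) (z : ℝ × ℝ) :
    (∑ i, if z.2 < (B.vtx i).2 ∧ (B.vtx i).1 ≤ z.1 then (1 : ZMod 2) else 0) = B.par z := by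
  have h1 : (∑ i, if (B.vtx i).2 ≤ z.2 then (1 : ZMod 2) else 0) = 0 :=
    h.sum_eq_zero_of_hor _ fun i hi => by rw [show (B.vtx i).2 = _ from hi]
  have h2 : (∑ i, if (B.vtx i).1 ≤ z.1 then (1 : ZMod 2) else 0) = 0 :=
    h.sum_eq_zero_of_vert _ fun i hi => by rw [(h.vert_iff i).2 hi]
  have key : (∑ i, if z.2 < (B.vtx i).2 ∧ (B.vtx i).1 ≤ z.1 then (1 : ZMod 2) else 0) +
      (∑ i, if (B.vtx i).2 ≤ z.2 then (1 : ZMod 2) else 0) +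
      (∑ i, if (B.vtx i).1 ≤ z.1 then (1 : ZMod 2) else 0) = B.par z := by
    rw [par, ← Finset.sum_add_distrib, ← Finset.sum_add_distrib]
    refine Finset.sum_congr rfl fun i _ => ?_
    by_cases h3 : (B.vtx i).1 ≤ z.1 <;> by_cases h4 : (B.vtx i).2 ≤ z.2
    · simp [h3, h4, h3.not_gt, h4.not_gt, CharTwo.add_self_eq_zero]
    · simp [h3, h4, h3.not_gt, not_le.1 h4, CharTwo.add_self_eq_zero]
    · simp [h3, h4, not_le.1 h3]
    · simp [h3, h4]
  rwa [h1, h2, add_zero, add_zero] at key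

end RectilinearBoundary

/-! ### Symmetries of the plane -/

/-- The reflections in the coordinate axes and the exchange of the axes. -/
def IsSym (σ : (ℝ × ℝ) ≃ₗ[ℝ] (ℝ × ℝ)) : Prop :=
  (∀ z, σ z = (-z.1, z.2)) ∨ (∀ z, σ z = (z.1, -z.2)) ∨ ∀ z, σ z = (z.2, z.1)

/-- Reflection in the vertical axis. -/
def flipX : (ℝ × ℝ) ≃ₗ[ℝ] (ℝ × ℝ) := (LinearEquiv.neg ℝ).prodCongr (LinearEquiv.refl ℝ ℝ)

/-- Reflection in the horizontal axis. -/
def flipY : (ℝ × ℝ) ≃ₗ[ℝ] (ℝ × ℝ) := (LinearEquiv.refl ℝ ℝ).prodCongr (LinearEquiv.neg ℝ)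

/-- Exchange of the axes. -/
def swapXY : (ℝ × ℝ) ≃ₗ[ℝ] (ℝ × ℝ) := LinearEquiv.prodComm ℝ ℝ ℝ

@[simp] theorem flipX_apply (z : ℝ × ℝ) : flipX z = (-z.1, z.2) := rfl
@[simp] theorem flipY_apply (z : ℝ × ℝ) : flipY z = (z.1, -z.2) := rfl
@[simp] theorem swapXY_apply (z : ℝ × ℝ) : swapXY z = (z.2, z.1) := rfl

theorem isSym_flipX : IsSym flipX := Or.inl flipX_apply
theorem isSym_flipY : IsSym flipY := Or.inr (Or.inl flipY_apply)
theorem isSym_swapXY : IsSym swapXY := Or.inr (Or.inr swapXY_apply)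

namespace IsSym

variable {σ : (ℝ × ℝ) ≃ₗ[ℝ] (ℝ × ℝ)}

/-- Since the symmetries are involutions, images and preimages coincide and each transfer lemma can
be used in both directions. -/
theorem invol (hσ : IsSym σ) (z : ℝ × ℝ) : σ (σ z) = z := by
  rcases hσ with h | h | h <;> simp [h]

theorem axis (hσ : IsSym σ) (a b : ℝ × ℝ) :
    ((σ a).1 = (σ b).1 ∨ (σ a).2 = (σ b).2) ↔ (a.1 = b.1 ∨ a.2 = b.2) := by
  rcases hσ with h | h | h <;> simp [h, or_comm]

theorem mem_image (hσ : IsSym σ) (S : Set (ℝ × ℝ)) (z : ℝ × ℝ) : z ∈ σ '' S ↔ σ z ∈ S := by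
  constructor
  · rintro ⟨w, hw, rfl⟩
    rwa [hσ.invol]
  · intro h
    exact ⟨σ z, h, hσ.invol z⟩

theorem image_image (hσ : IsSym σ) (S : Set (ℝ × ℝ)) : σ '' (σ '' S) = S := by
  ext z
  rw [hσ.mem_image, hσ.mem_image, hσ.invol]

theorem image_segment (σ : (ℝ × ℝ) ≃ₗ[ℝ] (ℝ × ℝ)) (a b : ℝ × ℝ) :
    σ '' segment ℝ a b = segment ℝ (σ a) (σ b) :=
  _root_.image_segment ℝ σ.toLinearMap.toAffineMap a b

theorem image_openSegment (σ : (ℝ × ℝ) ≃ₗ[ℝ] (ℝ × ℝ)) (a b : ℝ × ℝ) :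
    σ '' openSegment ℝ a b = openSegment ℝ (σ a) (σ b) :=
  _root_.image_openSegment ℝ σ.toLinearMap.toAffineMap a b

theorem mem_segment (hσ : IsSym σ) {a b z : ℝ × ℝ} :
    z ∈ segment ℝ (σ a) (σ b) ↔ σ z ∈ segment ℝ a b := by
  rw [← image_segment, hσ.mem_image]

end IsSym

namespace RectilinearBoundary

variable {n : ℕ} (B : RectilinearBoundary n) {σ : (ℝ × ℝ) ≃ₗ[ℝ] (ℝ × ℝ)}

/-- The image of the boundary curves under a linear map. -/
def map (σ : (ℝ × ℝ) ≃ₗ[ℝ] (ℝ × ℝ)) : RectilinearBoundary n where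
  vtx i := σ (B.vtx i)
  next := B.next

variable {B}

theorem mem_edge_map (hσ : IsSym σ) {i : Fin n} {z : ℝ × ℝ} :
    z ∈ (B.map σ).edge i ↔ σ z ∈ B.edge i := hσ.mem_segment

theorem mem_boundary_map (hσ : IsSym σ) {z : ℝ × ℝ} :
    z ∈ (B.map σ).boundary ↔ σ z ∈ B.boundary := by
  simp only [boundary, Set.mem_iUnion, mem_edge_map hσ]

theorem Alternates.map (h : B.Alternates) (hσ : IsSym σ) : (B.map σ).Alternates where
  ne i := fun h1 => h.ne i (σ.injective h1)
  alt i := by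
    have := h.alt i
    rcases hσ with h | h | h <;>
      simp only [RectilinearBoundary.map, h, neg_inj] <;> tauto

/-- The definition of `inside` prefers the rightward ray. A symmetry moves the counting quadrant,
and off the boundary all these quadrants have the same parity. -/
theorem Alternates.mem_inside_map (h : B.Alternates) (hσ : IsSym σ) {z : ℝ × ℝ} :
    z ∈ (B.map σ).inside ↔ σ z ∈ B.inside := by
  rw [h.mem_inside, (h.map hσ).mem_inside, mem_boundary_map hσ]
  refine and_congr_right fun hz => ?_
  suffices (B.map σ).par z = B.par (σ z) by rw [this]
  rcases hσ with h1 | h1 | h1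
  · rw [← h.par_left hz]
    simp only [par, RectilinearBoundary.map, h1]
    refine Finset.sum_congr rfl fun i _ => ?_
    congr 2
    rw [lt_neg]
  · rw [← h.par_above hz]
    simp only [par, RectilinearBoundary.map, h1]
    refine Finset.sum_congr rfl fun i _ => ?_
    congr 2
    rw [neg_le]
  · rw [← h.par_swap]
    simp only [par, RectilinearBoundary.map, h1]

end RectilinearBoundary

namespace RectilinearPolygon

variable {n : ℕ} (P : RectilinearPolygon n) {σ : (ℝ × ℝ) ≃ₗ[ℝ] (ℝ × ℝ)}

theorem alternates : P.Alternates where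
  ne i := fun h => P.next_ne i (P.vtx_injective h).symm
  alt := P.alternating

/-- The image of a polygon under a symmetry. -/
def map (σ : (ℝ × ℝ) ≃ₗ[ℝ] (ℝ × ℝ)) (hσ : IsSym σ) : RectilinearPolygon n where
  toRectilinearBoundary := P.toRectilinearBoundary.map σ
  vtx_injective := σ.injective.comp P.vtx_injective
  next_ne := P.next_ne
  alternating := (P.alternates.map hσ).alt
  simple i j hij z hz := by
    have h := P.simple i j hij (σ z)
      ⟨(RectilinearBoundary.mem_edge_map hσ).1 hz.1, (RectilinearBoundary.mem_edge_map hσ).1 hz.2⟩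
    refine h.imp (fun h1 => ⟨h1.1, ?_⟩) (fun h1 => ⟨h1.1, ?_⟩) <;>
      exact (σ.injective ((hσ.invol _).trans h1.2.symm)).symm ▸ rfl
  connected := by
    have h := P.connected.image σ
      (LinearMap.continuous_of_finiteDimensional σ.toLinearMap).continuousOn
    convert h using 1
    ext z
    rw [hσ.mem_image, P.alternates.mem_inside_map hσ]

variable {P} (hσ : IsSym σ)

theorem mem_inside_map {z : ℝ × ℝ} : z ∈ (P.map σ hσ).inside ↔ σ z ∈ P.inside :=
  P.alternates.mem_inside_map hσ

theorem mem_boundary_map {z : ℝ × ℝ} : z ∈ (P.map σ hσ).boundary ↔ σ z ∈ P.boundary :=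
  RectilinearBoundary.mem_boundary_map hσ

theorem vtx_map (i : Fin n) : (P.map σ hσ).vtx i = σ (P.vtx i) := rfl

theorem isStab_map {a b : ℝ × ℝ} : (P.map σ hσ).IsStab (σ a) (σ b) ↔ P.IsStab a b := by
  rw [IsStab, IsStab, hσ.axis, σ.injective.ne_iff, ← IsSym.image_openSegment, Set.image_subset_iff]
  refine and_congr_right fun _ => and_congr_right fun _ => ?_
  refine forall₂_congr fun z _ => ?_
  rw [Set.mem_preimage, mem_inside_map, hσ.invol]

theorem isReflex_map {i : Fin n} : (P.map σ hσ).IsReflex i ↔ P.IsReflex i := by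
  have key : ∀ s t : ℝ, (P.map σ hσ).vtx i
      + s • ((P.map σ hσ).vtx ((P.map σ hσ).next.symm i) - (P.map σ hσ).vtx i)
      + t • ((P.map σ hσ).vtx ((P.map σ hσ).next i) - (P.map σ hσ).vtx i) =
      σ (P.vtx i + s • (P.vtx (P.next.symm i) - P.vtx i) + t • (P.vtx (P.next i) - P.vtx i)) := by
    intro s t
    simp only [map_add, map_smul, map_sub]
    rfl
  simp only [IsReflex, key, mem_inside_map, hσ.invol]

theorem image_mem_reflexSegments {ρ : Set (ℝ × ℝ)} :
    σ '' ρ ∈ (P.map σ hσ).reflexSegments ↔ ρ ∈ P.reflexSegments := by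
  constructor
  · rintro ⟨i, b, h1, h2, h3, h4⟩
    refine ⟨i, σ b, (isReflex_map hσ).1 h1, (isStab_map hσ).1 ?_, (mem_boundary_map hσ).1 h3, ?_⟩
    · rwa [hσ.invol]
    · rw [← hσ.image_image ρ, h4, IsSym.image_openSegment, vtx_map, hσ.invol]
  · rintro ⟨i, b, h1, h2, h3, rfl⟩
    refine ⟨i, σ b, (isReflex_map hσ).2 h1, (isStab_map hσ).2 h2, (mem_boundary_map hσ).2 ?_, ?_⟩
    · rwa [hσ.invol]
    · rw [IsSym.image_openSegment, vtx_map]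

theorem image_mem_stabbingSegments {s : Set (ℝ × ℝ)} (hs : s ∈ P.stabbingSegments) :
    σ '' s ∈ (P.map σ hσ).stabbingSegments := by
  obtain ⟨a, b, h, rfl⟩ := hs
  exact ⟨σ a, σ b, (isStab_map hσ).2 h, IsSym.image_openSegment σ a b⟩

theorem Thin.map (h : P.Thin) : (P.map σ hσ).Thin := by
  intro ρ hρ ρ' hρ' hne
  rw [← hσ.image_image ρ] at hρ
  rw [← hσ.image_image ρ'] at hρ'
  rw [image_mem_reflexSegments] at hρ hρ'
  have := h hρ hρ' fun h1 => hne (by rw [← hσ.image_image ρ, h1, hσ.image_image])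
  simpa [Function.onFun, Set.disjoint_image_iff σ.injective] using this

theorem GeneralPosition.map (h : P.GeneralPosition) : (P.map σ hσ).GeneralPosition := by
  intro i j k h1 h2 h3
  have h4 := h i j k h1 h2 h3
  simp only [vtx_map]
  rcases hσ with h | h | h <;> simp only [h, neg_inj]
  · exact h4
  · exact h4
  · exact h4.symm

/-! ### Neighbours of a vertex -/

variable (P)

open Classical in
/-- The other end of the horizontal edge at vertex `i`. -/
noncomputable def hn (i : Fin n) : Fin n := if P.IsHor i then P.next i else P.next.symm i

open Classical in
/-- The other end of the vertical edge at vertex `i`. -/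
noncomputable def vn (i : Fin n) : Fin n := if P.IsHor i then P.next.symm i else P.next i

theorem isHor_symm (i : Fin n) : P.IsHor (P.next.symm i) ↔ ¬ P.IsHor i := by
  have := P.alternates.hor_next (P.next.symm i)
  rw [Equiv.apply_symm_apply] at this
  tauto

theorem vtx_hn_snd (i : Fin n) : (P.vtx (P.hn i)).2 = (P.vtx i).2 := by
  unfold hn
  split_ifs with h
  · exact Eq.symm h
  · have := (P.isHor_symm i).2 h
    simpa [RectilinearBoundary.IsHor] using this

theorem vtx_vn_fst (i : Fin n) : (P.vtx (P.vn i)).1 = (P.vtx i).1 := by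
  unfold vn
  split_ifs with h
  · have := (P.alternates.vert_iff (P.next.symm i)).2 (by rw [isHor_symm]; exact not_not.2 h)
    simpa using this
  · exact ((P.alternates.vert_iff i).2 h).symm

theorem hn_ne (i : Fin n) : P.hn i ≠ i := by
  unfold hn
  split_ifs
  · exact P.next_ne i
  · intro h
    exact P.next_ne i (by rw [Equiv.symm_apply_eq] at h; exact h.symm)

theorem vn_ne (i : Fin n) : P.vn i ≠ i := by
  unfold vn
  split_ifs
  · intro h
    exact P.next_ne i (by rw [Equiv.symm_apply_eq] at h; exact h.symm)
  · exact P.next_ne i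

theorem vtx_hn_fst_ne (i : Fin n) : (P.vtx (P.hn i)).1 ≠ (P.vtx i).1 := fun h =>
  P.hn_ne i (P.vtx_injective (Prod.ext h (P.vtx_hn_snd i)))

theorem vtx_vn_snd_ne (i : Fin n) : (P.vtx (P.vn i)).2 ≠ (P.vtx i).2 := fun h =>
  P.vn_ne i (P.vtx_injective (Prod.ext (P.vtx_vn_fst i) h))

theorem edge_symm (i : Fin n) : P.edge (P.next.symm i) = segment ℝ (P.vtx i) (P.vtx (P.next.symm i)) := by
  rw [RectilinearBoundary.edge, Equiv.apply_symm_apply, segment_symm]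

theorem segment_hn_subset (i : Fin n) : segment ℝ (P.vtx i) (P.vtx (P.hn i)) ⊆ P.boundary := by
  unfold hn
  split_ifs
  · exact RectilinearBoundary.edge_subset_boundary i
  · rw [← edge_symm]
    exact RectilinearBoundary.edge_subset_boundary _

theorem segment_vn_subset (i : Fin n) : segment ℝ (P.vtx i) (P.vtx (P.vn i)) ⊆ P.boundary := by
  unfold vn
  split_ifs
  · rw [← edge_symm]
    exact RectilinearBoundary.edge_subset_boundary _
  · exact RectilinearBoundary.edge_subset_boundary i

/-- By simplicity, only the two edges incident with a vertex contain it. -/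
theorem edge_subset_of_mem {i j : Fin n} (h : P.vtx i ∈ P.edge j) :
    P.edge j ⊆ segment ℝ (P.vtx i) (P.vtx (P.hn i)) ∪ segment ℝ (P.vtx i) (P.vtx (P.vn i)) := by
  have h1 : j = i ∨ j = P.next.symm i := by
    by_contra! hne
    rcases P.simple j i hne.1 (P.vtx i) ⟨h, left_mem_segment ℝ _ _⟩ with h1 | h1
    · exact hne.2 (by rw [← h1.1, Equiv.symm_apply_apply])
    · exact hne.1 (P.vtx_injective h1.2).symm
  have h2 : P.edge i = segment ℝ (P.vtx i) (P.vtx (P.next i)) := rfl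
  unfold hn vn
  rcases h1 with rfl | rfl
  · split_ifs
    · exact Set.subset_union_left
    · exact Set.subset_union_right
  · rw [edge_symm]
    split_ifs
    · exact Set.subset_union_right
    · exact Set.subset_union_left

theorem isReflex_iff (i : Fin n) : P.IsReflex i ↔ ∃ ε : ℝ, 0 < ε ∧ ∀ s ∈ Set.Ioo 0 ε,
    ∀ t ∈ Set.Ioo 0 ε, P.vtx i + s • (P.vtx (P.hn i) - P.vtx i)
      + t • (P.vtx (P.vn i) - P.vtx i) ∉ P.inside := by
  unfold hn vn IsReflex
  split_ifs
  · refine exists_congr fun ε => and_congr_right fun _ => ?_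
    constructor <;> intro h s hs t ht <;> rw [add_right_comm] <;> exact h t ht s hs
  · rfl

theorem isHor_swapXY (i : Fin n) : (P.map swapXY isSym_swapXY).IsHor i ↔ ¬ P.IsHor i := by
  rw [← P.alternates.vert_iff]
  rfl

open Classical in
theorem hn_swapXY (i : Fin n) : (P.map swapXY isSym_swapXY).hn i = P.vn i := by
  rw [vn, ← ite_not]
  exact if_congr (P.isHor_swapXY i) rfl rfl

open Classical in
theorem vn_swapXY (i : Fin n) : (P.map swapXY isSym_swapXY).vn i = P.hn i := by
  rw [hn, ← ite_not]
  exact if_congr (P.isHor_swapXY i) rfl rfl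

end RectilinearPolygon

/-! ### Moving inside the polygon along axis-parallel paths. -/

namespace RectilinearPolygon

variable {n : ℕ} (P : RectilinearPolygon n)

theorem mem_inside {z : ℝ × ℝ} : z ∈ P.inside ↔ z ∉ P.boundary ∧ P.par z = 1 :=
  P.alternates.mem_inside

theorem not_mem_boundary {z : ℝ × ℝ} (h : z ∈ P.inside) : z ∉ P.boundary := h.1

theorem vtx_mem_boundary (i : Fin n) : P.vtx i ∈ P.boundary :=
  RectilinearBoundary.vtx_mem_boundary i

theorem isClosed_boundary : IsClosed P.boundary := RectilinearBoundary.isClosed_boundary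

theorem mem_segment_vert {x y y' : ℝ} {z : ℝ × ℝ} :
    z ∈ segment ℝ (x, y) (x, y') ↔ z.1 = x ∧ z.2 ∈ Set.uIcc y y' := by
  rw [← Prod.image_mk_segment_right, segment_eq_uIcc]
  constructor
  · rintro ⟨t, ht, rfl⟩; exact ⟨rfl, ht⟩
  · rintro ⟨h1, h2⟩; exact ⟨z.2, h2, Prod.ext h1.symm rfl⟩

theorem mem_segment_hor {x x' y : ℝ} {z : ℝ × ℝ} :
    z ∈ segment ℝ (x, y) (x', y) ↔ z.2 = y ∧ z.1 ∈ Set.uIcc x x' := by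
  rw [← Prod.image_mk_segment_left, segment_eq_uIcc]
  constructor
  · rintro ⟨t, ht, rfl⟩; exact ⟨rfl, ht⟩
  · rintro ⟨h1, h2⟩; exact ⟨z.1, h2, Prod.ext rfl h1.symm⟩

theorem inside_of_horizontal {x x' y : ℝ} (h : (x, y) ∈ P.inside)
    (hf : ∀ t ∈ Set.uIcc x x', (t, y) ∉ P.boundary) : (x', y) ∈ P.inside := by
  rw [mem_inside] at h ⊢
  refine ⟨hf _ Set.right_mem_uIcc, ?_⟩
  rw [← h.2]
  rcases le_total x x' with h1 | h1
  · exact (P.alternates.par_horizontal h1 fun t ht =>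
      hf t (by rw [Set.uIcc_of_le h1]; exact Set.Ioc_subset_Icc_self ht)).symm
  · exact P.alternates.par_horizontal h1 fun t ht =>
      hf t (by rw [Set.uIcc_of_ge h1]; exact Set.Ioc_subset_Icc_self ht)

theorem inside_of_vertical {x y y' : ℝ} (h : (x, y) ∈ P.inside)
    (hf : ∀ t ∈ Set.uIcc y y', (x, t) ∉ P.boundary) : (x, y') ∈ P.inside := by
  rw [mem_inside] at h ⊢
  refine ⟨hf _ Set.right_mem_uIcc, ?_⟩
  rw [← h.2]
  rcases le_total y y' with h1 | h1
  · exact (P.alternates.par_vertical h1 fun t ht =>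
      hf t (by rw [Set.uIcc_of_le h1]; exact Set.Ioc_subset_Icc_self ht)).symm
  · exact P.alternates.par_vertical h1 fun t ht =>
      hf t (by rw [Set.uIcc_of_ge h1]; exact Set.Ioc_subset_Icc_self ht)

/-- An axis-aligned segment that avoids the boundary lies inside if one end does. -/
theorem inside_of_segment {a b : ℝ × ℝ} (hab : a.1 = b.1 ∨ a.2 = b.2) (h : a ∈ P.inside)
    (hf : ∀ z ∈ segment ℝ a b, z ∉ P.boundary) : b ∈ P.inside := by
  obtain ⟨x, y⟩ := a
  obtain ⟨x', y'⟩ := b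
  rcases hab with h1 | h1 <;> dsimp only at h1 <;> subst h1
  · exact P.inside_of_vertical h fun t ht => hf _ (mem_segment_vert.2 ⟨rfl, ht⟩)
  · exact P.inside_of_horizontal h fun t ht => hf _ (mem_segment_hor.2 ⟨rfl, ht⟩)

/-- A ball of the maximum metric that misses the boundary is reached from its centre by one
horizontal and one vertical move. -/
theorem isOpen_inside : IsOpen P.inside := by
  rw [Metric.isOpen_iff]
  intro z hz
  obtain ⟨ε, hε, hb⟩ := Metric.isOpen_iff.1 P.isClosed_boundary.isOpen_compl z
    (P.not_mem_boundary hz)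
  refine ⟨ε, hε, fun w hw => ?_⟩
  have hb' : ∀ a b : ℝ, |a - z.1| < ε → |b - z.2| < ε → (a, b) ∉ P.boundary := fun a b h1 h2 =>
    hb (by rw [Metric.mem_ball, Prod.dist_eq, max_lt_iff]; exact ⟨h1, h2⟩)
  rw [Metric.mem_ball, Prod.dist_eq, max_lt_iff, Real.dist_eq, Real.dist_eq] at hw
  have h0 : |z.2 - z.2| < ε := by simpa using hε
  have key : ∀ c d : ℝ, |d - c| < ε → ∀ t ∈ Set.uIcc c d, |t - c| < ε := by
    intro c d h t ht
    exact (Set.abs_sub_left_of_mem_uIcc ht).trans_lt h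
  refine P.inside_of_vertical (y := z.2) (P.inside_of_horizontal (x := z.1) hz ?_) ?_
  · exact fun t ht => hb' _ _ (key _ _ hw.1 t ht) h0
  · exact fun t ht => hb' _ _ hw.1 (key _ _ hw.2 t ht)

/-- Beyond all vertices in one of the four directions, the counting quadrant either contains no
vertex or is a half-plane in effect, where the vertices cancel along edges. -/
theorem inside_bounded : ∃ M : ℝ, ∀ z ∈ P.inside, |z.1| ≤ M ∧ |z.2| ≤ M := by
  obtain ⟨M, hM⟩ := (Set.finite_range P.vtx).isBounded.exists_norm_le
  have hM1 : ∀ i, |(P.vtx i).1| ≤ M := fun i =>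
    (norm_fst_le (P.vtx i)).trans (hM _ (Set.mem_range_self i))
  have hM2 : ∀ i, |(P.vtx i).2| ≤ M := fun i =>
    (norm_snd_le (P.vtx i)).trans (hM _ (Set.mem_range_self i))
  refine ⟨M, fun z hz => ?_⟩
  have hp := ((P.mem_inside).1 hz).2
  have hne : P.par z ≠ 0 := by rw [hp]; decide
  constructor
  · by_contra! h
    apply hne
    rcases lt_abs.1 h with h1 | h1
    · refine Finset.sum_eq_zero fun i _ => if_neg fun h2 => ?_
      linarith [le_abs_self (P.vtx i).1, hM1 i, h2.1]
    · refine P.alternates.sum_eq_zero_of_hor _ fun i hi => ?_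
      have h3 : ∀ j, z.1 < (P.vtx j).1 := fun j => by linarith [neg_abs_le (P.vtx j).1, hM1 j]
      simp only [h3, true_and, show (P.vtx i).2 = _ from hi]
  · by_contra! h
    apply hne
    rcases lt_abs.1 h with h1 | h1
    · refine P.alternates.sum_eq_zero_of_vert _ fun i hi => ?_
      have h3 : ∀ j, (P.vtx j).2 ≤ z.2 := fun j => by linarith [le_abs_self (P.vtx j).2, hM2 j]
      simp only [h3, and_true, (P.alternates.vert_iff i).2 hi]
    · refine Finset.sum_eq_zero fun i _ => if_neg fun h2 => ?_
      linarith [neg_abs_le (P.vtx i).2, hM2 i, h2.2]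

/-- A ray that starts inside the polygon hits the boundary. -/
theorem exists_hit {v d : ℝ × ℝ} (hd : d ≠ 0) (hd' : d.1 = 0 ∨ d.2 = 0) {ε : ℝ} (hε : 0 < ε)
    (h : ∀ t ∈ Set.Ioo 0 ε, v + t • d ∈ P.inside) :
    ∃ T : ℝ, 0 < T ∧ v + T • d ∈ P.boundary ∧ ∀ t ∈ Set.Ioo 0 T, v + t • d ∈ P.inside := by
  have hcont : Continuous fun t : ℝ => v + t • d := by fun_prop
  have haxis : ∀ t t' : ℝ, (v + t • d).1 = (v + t' • d).1 ∨ (v + t • d).2 = (v + t' • d).2 := by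
    intro t t'
    rcases hd' with h1 | h1 <;> simp [h1]
  have hseg : ∀ t t' : ℝ, t ≤ t' → ∀ z ∈ segment ℝ (v + t • d) (v + t' • d),
      ∃ r ∈ Set.Icc t t', z = v + r • d := by
    rintro t t' htt z ⟨a, b, ha, hb, hab, rfl⟩
    obtain rfl : a = 1 - b := by linarith
    refine ⟨(1 - b) * t + b * t', ⟨by nlinarith, by nlinarith⟩, ?_⟩
    module
  -- Starting at `ε / 2` keeps `S` closed and excludes `v` itself, which will be a boundary vertex.
  -- The first hit is `sInf S`.
  set S : Set ℝ := {t | ε / 2 ≤ t ∧ v + t • d ∈ P.boundary} with hS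
  have hSc : IsClosed S :=
    isClosed_Ici.inter (P.isClosed_boundary.preimage hcont)
  have hSb : BddBelow S := ⟨ε / 2, fun t ht => ht.1⟩
  have h2 : v + (ε / 2) • d ∈ P.inside := h _ ⟨by linarith, by linarith⟩
  have hSn : S.Nonempty := by
    by_contra hne
    have hall : ∀ t, ε / 2 ≤ t → v + t • d ∈ P.inside := by
      intro t ht
      refine P.inside_of_segment (haxis _ _) h2 fun z hz hzb => hne ?_
      obtain ⟨r, hr, rfl⟩ := hseg _ _ ht z hz
      exact ⟨r, hr.1, hzb⟩
    obtain ⟨M, hM⟩ := P.inside_bounded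
    have hdn : 0 < |d.1| + |d.2| := by
      by_contra h3
      apply hd
      have h4 := abs_nonneg d.1
      have h5 := abs_nonneg d.2
      exact Prod.ext (abs_eq_zero.1 (by linarith)) (abs_eq_zero.1 (by linarith))
    -- So far along the ray, the sum of the absolute coordinates exceeds `2 * |M|`, against the
    -- bound on the interior.
    set t := ε / 2 + (2 * |M| + |v.1| + |v.2| + 1) / (|d.1| + |d.2|) with ht
    have hpos : 0 ≤ (2 * |M| + |v.1| + |v.2| + 1) / (|d.1| + |d.2|) := by positivity
    have h3 := hM _ (hall t (by linarith))
    have h4 : 2 * |M| + |v.1| + |v.2| + 1 ≤ t * (|d.1| + |d.2|) := by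
      rw [ht, add_mul, div_mul_cancel₀ _ hdn.ne']
      have := mul_pos (half_pos hε) hdn
      linarith
    have ht0 : 0 ≤ t := by linarith
    simp only [Prod.fst_add, Prod.snd_add, Prod.smul_fst, Prod.smul_snd, smul_eq_mul] at h3
    have h5 : t * |d.1| ≤ |v.1 + t * d.1| + |v.1| := by
      have := abs_add_le (v.1 + t * d.1) (-v.1)
      rw [abs_neg, show v.1 + t * d.1 + -v.1 = t * d.1 by ring, abs_mul, abs_of_nonneg ht0] at this
      exact this
    have h6 : t * |d.2| ≤ |v.2 + t * d.2| + |v.2| := by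
      have := abs_add_le (v.2 + t * d.2) (-v.2)
      rw [abs_neg, show v.2 + t * d.2 + -v.2 = t * d.2 by ring, abs_mul, abs_of_nonneg ht0] at this
      exact this
    linarith [le_abs_self M]
  have hmem : sInf S ∈ S := hSc.csInf_mem hSn hSb
  have hlt : ∀ t, ε / 2 ≤ t → t < sInf S → v + t • d ∉ P.boundary := fun t ht hts hb =>
    (notMem_of_lt_csInf hts hSb) ⟨ht, hb⟩
  refine ⟨sInf S, by linarith [hmem.1], hmem.2, fun t ht => ?_⟩
  rcases lt_or_ge t ε with h3 | h3
  · exact h t ⟨ht.1, h3⟩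
  · refine P.inside_of_segment (haxis _ _) h2 fun z hz => ?_
    obtain ⟨r, hr, rfl⟩ := hseg _ _ (by linarith) z hz
    exact hlt r hr.1 (hr.2.trans_lt ht.2)

/-! ### The neighbourhood of a vertex -/

/-- Coordinates at vertex `i` with its two edges as axes. -/
noncomputable def frame (i : Fin n) (s t : ℝ) : ℝ × ℝ :=
  ((P.vtx i).1 + s * ((P.vtx (P.hn i)).1 - (P.vtx i).1),
    (P.vtx i).2 + t * ((P.vtx (P.vn i)).2 - (P.vtx i).2))

theorem frame_eq (i : Fin n) (s t : ℝ) : P.frame i s t =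
    P.vtx i + s • (P.vtx (P.hn i) - P.vtx i) + t • (P.vtx (P.vn i) - P.vtx i) := by
  ext <;> simp [frame, P.vtx_hn_snd, P.vtx_vn_fst]

theorem isReflex_iff_frame (i : Fin n) : P.IsReflex i ↔ ∃ ε : ℝ, 0 < ε ∧ ∀ s ∈ Set.Ioo 0 ε,
    ∀ t ∈ Set.Ioo 0 ε, P.frame i s t ∉ P.inside := by
  simp only [P.isReflex_iff, frame_eq]

theorem frame_injective {i : Fin n} {s t s' t' : ℝ} (h : P.frame i s t = P.frame i s' t') :
    s = s' ∧ t = t' := by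
  have h1 := congrArg Prod.fst h
  have h2 := congrArg Prod.snd h
  simp only [frame, add_right_inj] at h1 h2
  exact ⟨mul_right_cancel₀ (sub_ne_zero.2 (P.vtx_hn_fst_ne i)) h1,
    mul_right_cancel₀ (sub_ne_zero.2 (P.vtx_vn_snd_ne i)) h2⟩

theorem frame_segment_left (i : Fin n) {s s' t : ℝ} {z : ℝ × ℝ}
    (hz : z ∈ segment ℝ (P.frame i s t) (P.frame i s' t)) :
    ∃ r ∈ Set.uIcc s s', z = P.frame i r t := by
  obtain ⟨a, b, ha, hb, hab, rfl⟩ := hz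
  refine ⟨a * s + b * s', ?_, ?_⟩
  · rw [← segment_eq_uIcc]
    exact ⟨a, b, ha, hb, hab, rfl⟩
  · obtain rfl : a = 1 - b := by linarith
    ext <;> simp [frame] <;> ring

theorem frame_segment_right (i : Fin n) {s t t' : ℝ} {z : ℝ × ℝ}
    (hz : z ∈ segment ℝ (P.frame i s t) (P.frame i s t')) :
    ∃ r ∈ Set.uIcc t t', z = P.frame i s r := by
  obtain ⟨a, b, ha, hb, hab, rfl⟩ := hz
  refine ⟨a * t + b * t', ?_, ?_⟩
  · rw [← segment_eq_uIcc]
    exact ⟨a, b, ha, hb, hab, rfl⟩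
  · obtain rfl : a = 1 - b := by linarith
    ext <;> simp [frame] <;> ring

/-- The edges that miss the vertex and the other vertices form a closed set that does not contain
it. A small box in frame coordinates avoids this set. -/
theorem isolated (i : Fin n) : ∃ ε > 0,
    (∀ s t : ℝ, |s| < ε → |t| < ε → P.frame i s t ∈ P.boundary →
      (t = 0 ∧ 0 ≤ s) ∨ (s = 0 ∧ 0 ≤ t)) ∧
    ∀ s t : ℝ, |s| < ε → |t| < ε → ∀ j, P.vtx j = P.frame i s t → j = i := by
  set K : Set (ℝ × ℝ) := (⋃ j : {j // P.vtx i ∉ P.edge j}, P.edge j) ∪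
    P.vtx '' {j | j ≠ i} with hK
  have hKc : IsClosed K := by
    refine IsClosed.union (isClosed_iUnion_of_finite fun j =>
      RectilinearBoundary.isClosed_edge _) ?_
    exact ((Set.toFinite _).image _).isClosed
  have hvK : P.vtx i ∉ K := by
    rintro (h | ⟨j, hj, h⟩)
    · obtain ⟨j, hj⟩ := Set.mem_iUnion.1 h
      exact j.2 hj
    · exact hj (P.vtx_injective h)
  have hcont : Continuous fun p : ℝ × ℝ => P.frame i p.1 p.2 := by unfold frame; fun_prop
  obtain ⟨ε, hε, hb⟩ := Metric.isOpen_iff.1 (hKc.isOpen_compl.preimage hcont) (0, 0)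
    (by simpa [frame] using hvK)
  have hb' : ∀ s t : ℝ, |s| < ε → |t| < ε → P.frame i s t ∉ K := fun s t hs ht =>
    hb (show (s, t) ∈ _ by
      rw [Metric.mem_ball, Prod.dist_eq, max_lt_iff]; simpa [Real.dist_eq] using ⟨hs, ht⟩)
  refine ⟨ε, hε, fun s t hs ht hbd => ?_, fun s t hs ht j hj => ?_⟩
  · obtain ⟨j, hj⟩ := Set.mem_iUnion.1 hbd
    have h1 : P.vtx i ∈ P.edge j := by
      by_contra h2
      exact hb' s t hs ht (Or.inl (Set.mem_iUnion.2 ⟨⟨j, h2⟩, hj⟩))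
    have e0 : P.vtx i = P.frame i 0 0 := by simp [frame]
    have e1 : P.vtx (P.hn i) = P.frame i 1 0 := by ext <;> simp [frame, vtx_hn_snd]
    have e2 : P.vtx (P.vn i) = P.frame i 0 1 := by ext <;> simp [frame, vtx_vn_fst]
    rcases P.edge_subset_of_mem h1 hj with h3 | h3
    · rw [e0, e1] at h3
      obtain ⟨r, hr, h4⟩ := P.frame_segment_left i h3
      have := P.frame_injective h4
      rw [Set.uIcc_of_le zero_le_one] at hr
      exact Or.inl ⟨this.2, this.1 ▸ hr.1⟩
    · rw [e0, e2] at h3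
      obtain ⟨r, hr, h4⟩ := P.frame_segment_right i h3
      have := P.frame_injective h4
      rw [Set.uIcc_of_le zero_le_one] at hr
      exact Or.inr ⟨this.1, this.2 ▸ hr.1⟩
  · by_contra hne
    exact hb' s t hs ht (Or.inr ⟨j, hne, hj⟩)

/-- The box contains vertex `i` and no other, so `par_box` evaluates to 1. The four cases at the end
are the possible orientations of the two edges. -/
theorem par_frame (i : Fin n) {ε : ℝ}
    (hε : ∀ s t : ℝ, |s| < ε → |t| < ε → ∀ j, P.vtx j = P.frame i s t → j = i)
    {s s' t t' : ℝ} (hs : s ∈ Set.Ioo 0 ε) (hs' : s' ∈ Set.Ioo 0 ε) (ht : t ∈ Set.Ioo 0 ε)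
    (ht' : t' ∈ Set.Ioo 0 ε) :
    P.par (P.frame i (-s) (-t)) + P.par (P.frame i (-s) t') + P.par (P.frame i s' (-t)) +
      P.par (P.frame i s' t') = 1 := by
  have hx := sub_ne_zero.2 (P.vtx_hn_fst_ne i)
  have hy := sub_ne_zero.2 (P.vtx_vn_snd_ne i)
  have hsurj : ∀ j, P.vtx j = P.frame i
      (((P.vtx j).1 - (P.vtx i).1) / ((P.vtx (P.hn i)).1 - (P.vtx i).1))
      (((P.vtx j).2 - (P.vtx i).2) / ((P.vtx (P.vn i)).2 - (P.vtx i).2)) := by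
    intro j
    simp only [frame, div_mul_cancel₀ _ hx, div_mul_cancel₀ _ hy]
    ext <;> simp
  simp only [frame] at hsurj ⊢
  set X := (P.vtx (P.hn i)).1 - (P.vtx i).1
  set Y := (P.vtx (P.vn i)).2 - (P.vtx i).2
  have key : ∀ a a' b b' : ℝ, a < (P.vtx i).1 → (P.vtx i).1 < a' → b < (P.vtx i).2 →
      (P.vtx i).2 < b' → (∀ c ∈ Set.Ioc a a', |(c - (P.vtx i).1) / X| < ε) →
      (∀ c ∈ Set.Ioc b b', |(c - (P.vtx i).2) / Y| < ε) →
      P.par (a, b) + P.par (a, b') + P.par (a', b) + P.par (a', b') = 1 := by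
    intro a a' b b' h1 h2 h3 h4 h5 h6
    rw [RectilinearBoundary.par_box _ _ _ _ (h1.trans h2).le (h3.trans h4).le,
      Finset.sum_eq_single i, if_pos ⟨⟨h1, h2.le⟩, h3, h4.le⟩]
    · intro j _ hj
      rw [if_neg]
      intro h7
      exact hj (hε _ _ (h5 _ h7.1) (h6 _ h7.2) j (hsurj j))
    · simp
  have bound : ∀ (c r X p q : ℝ), X ≠ 0 → p ∈ Set.Ioo 0 ε → q ∈ Set.Ioo 0 ε →
      c ∈ Set.uIcc (r + -p * X) (r + q * X) → |(c - r) / X| < ε := by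
    rintro c r X p q hX hp hq hc
    rw [← segment_eq_uIcc] at hc
    obtain ⟨a, b, ha, hb, hab, rfl⟩ := hc
    have : (a • (r + -p * X) + b • (r + q * X) - r) / X = -(a * p) + b * q := by
      obtain rfl : a = 1 - b := by linarith
      field_simp
      simp only [smul_eq_mul]
      ring
    rw [this, abs_lt]
    have h1 := hp.1; have h2 := hp.2; have h3 := hq.1; have h4 := hq.2
    constructor <;> nlinarith
  have bx := fun c => bound c (P.vtx i).1 X s s' hx hs hs'
  have bY := fun c => bound c (P.vtx i).2 Y t t' hy ht ht'
  rcases lt_or_gt_of_ne hx with hX | hX <;> rcases lt_or_gt_of_ne hy with hY | hY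
  · have := key ((P.vtx i).1 + s' * X) ((P.vtx i).1 + -s * X) ((P.vtx i).2 + t' * Y)
      ((P.vtx i).2 + -t * Y) (by nlinarith [hs'.1]) (by nlinarith [hs.1]) (by nlinarith [ht'.1])
      (by nlinarith [ht.1]) (fun c hc => bx c (Set.Icc_subset_uIcc' (Set.Ioc_subset_Icc_self hc)))
      (fun c hc => bY c (Set.Icc_subset_uIcc' (Set.Ioc_subset_Icc_self hc)))
    rw [← this]; ring
  · have := key ((P.vtx i).1 + s' * X) ((P.vtx i).1 + -s * X) ((P.vtx i).2 + -t * Y)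
      ((P.vtx i).2 + t' * Y) (by nlinarith [hs'.1]) (by nlinarith [hs.1]) (by nlinarith [ht.1])
      (by nlinarith [ht'.1]) (fun c hc => bx c (Set.Icc_subset_uIcc' (Set.Ioc_subset_Icc_self hc)))
      (fun c hc => bY c (Set.Icc_subset_uIcc (Set.Ioc_subset_Icc_self hc)))
    rw [← this]; ring
  · have := key ((P.vtx i).1 + -s * X) ((P.vtx i).1 + s' * X) ((P.vtx i).2 + t' * Y)
      ((P.vtx i).2 + -t * Y) (by nlinarith [hs.1]) (by nlinarith [hs'.1]) (by nlinarith [ht'.1])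
      (by nlinarith [ht.1]) (fun c hc => bx c (Set.Icc_subset_uIcc (Set.Ioc_subset_Icc_self hc)))
      (fun c hc => bY c (Set.Icc_subset_uIcc' (Set.Ioc_subset_Icc_self hc)))
    rw [← this]; ring
  · have := key ((P.vtx i).1 + -s * X) ((P.vtx i).1 + s' * X) ((P.vtx i).2 + -t * Y)
      ((P.vtx i).2 + t' * Y) (by nlinarith [hs.1]) (by nlinarith [hs'.1]) (by nlinarith [ht.1])
      (by nlinarith [ht'.1]) (fun c hc => bx c (Set.Icc_subset_uIcc (Set.Ioc_subset_Icc_self hc)))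
      (fun c hc => bY c (Set.Icc_subset_uIcc (Set.Ioc_subset_Icc_self hc)))
    rw [← this]

/-- Near vertex `i`, the points outside the closed wedge spanned by the two edges are inside the
polygon if and only if the vertex is reflex; for the points of the open wedge it is the opposite. -/
theorem local_structure (i : Fin n) : ∃ ε > 0,
    (∀ s t : ℝ, |s| < ε → |t| < ε → s < 0 ∨ t < 0 → (P.frame i s t ∈ P.inside ↔ P.IsReflex i)) ∧
    ∀ s ∈ Set.Ioo 0 ε, ∀ t ∈ Set.Ioo 0 ε, (P.frame i s t ∈ P.inside ↔ ¬ P.IsReflex i) := by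
  obtain ⟨ε, hε, hbd, hv⟩ := P.isolated i
  -- The side conditions keep a horizontal move off both edges: on their common line it stays behind
  -- the vertex, and at heights reached by the vertical edge it does not change sides.
  have movex : ∀ s s' t : ℝ, |s| < ε → |s'| < ε → |t| < ε → (t = 0 → s < 0 ∧ s' < 0) →
      (0 ≤ t → 0 < s * s') → P.frame i s t ∈ P.inside → P.frame i s' t ∈ P.inside := by
    intro s s' t hs hs' ht h1 h2 h
    refine P.inside_of_segment (a := P.frame i s t) (Or.inr rfl) h fun z hz hzb => ?_
    obtain ⟨r, hr, rfl⟩ := P.frame_segment_left i hz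
    have hr' : |r| < ε := by
      rw [abs_lt] at hs hs' ⊢
      rcases Set.mem_uIcc.1 hr with h3 | h3 <;> constructor <;> linarith
    rcases hbd r t hr' ht hzb with ⟨h3, h4⟩ | ⟨h3, h4⟩
    · have := h1 h3
      rcases Set.mem_uIcc.1 hr with h3 | h3 <;> linarith
    · have := h2 h4
      rw [h3] at hr
      rcases Set.mem_uIcc.1 hr with h5 | h5 <;> nlinarith
  have movey : ∀ s t t' : ℝ, |s| < ε → |t| < ε → |t'| < ε → (s = 0 → t < 0 ∧ t' < 0) →
      (0 ≤ s → 0 < t * t') → P.frame i s t ∈ P.inside → P.frame i s t' ∈ P.inside := by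
    intro s t t' hs ht ht' h1 h2 h
    refine P.inside_of_segment (a := P.frame i s t) (Or.inl rfl) h fun z hz hzb => ?_
    obtain ⟨r, hr, rfl⟩ := P.frame_segment_right i hz
    have hr' : |r| < ε := by
      rw [abs_lt] at ht ht' ⊢
      rcases Set.mem_uIcc.1 hr with h3 | h3 <;> constructor <;> linarith
    rcases hbd s r hs hr' hzb with ⟨h3, h4⟩ | ⟨h3, h4⟩
    · have := h2 h4
      rw [h3] at hr
      rcases Set.mem_uIcc.1 hr with h5 | h5 <;> nlinarith
    · have := h1 h3
      rcases Set.mem_uIcc.1 hr with h3 | h3 <;> linarith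
  set δ := ε / 2 with hδ
  have hδ0 : 0 < δ := by positivity
  have aδ : |(-δ)| < ε := by rw [abs_neg, abs_of_pos hδ0]; linarith
  have aδ' : |δ| < ε := by rw [abs_of_pos hδ0]; linarith
  have hδI : δ ∈ Set.Ioo 0 ε := ⟨hδ0, by linarith⟩
  set c : Prop := P.frame i (-δ) (-δ) ∈ P.inside with hc
  -- Every point outside the closed wedge is joined to the reference point `(-δ, -δ)` by an L-shaped
  -- path that avoids both edges.
  have hout : ∀ s t : ℝ, |s| < ε → |t| < ε → s < 0 ∨ t < 0 → (P.frame i s t ∈ P.inside ↔ c) := by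
    rintro s t hs ht (h | h)
    · constructor
      · intro h1
        refine movey _ t _ aδ ht aδ (by intro; linarith) (by intro; linarith) ?_
        exact movex s _ t hs aδ ht (fun _ => ⟨h, by linarith⟩) (fun _ => by nlinarith) h1
      · intro h1
        refine movex (-δ) _ t aδ hs ht (fun _ => ⟨by linarith, h⟩) (fun _ => by nlinarith) ?_
        exact movey _ (-δ) _ aδ aδ ht (by intro; linarith) (by intro; linarith) h1
    · constructor
      · intro h1
        refine movex s _ _ hs aδ aδ (by intro; linarith) (by intro; linarith) ?_
        exact movey s t _ hs ht aδ (fun _ => ⟨h, by linarith⟩) (fun _ => by nlinarith) h1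
      · intro h1
        refine movey s (-δ) _ hs aδ ht (fun _ => ⟨by linarith, h⟩) (fun _ => by nlinarith) ?_
        exact movex (-δ) _ _ aδ hs aδ (by intro; linarith) (by intro; linarith) h1
  have hin : ∀ s ∈ Set.Ioo 0 ε, ∀ t ∈ Set.Ioo 0 ε, (P.frame i s t ∈ P.inside ↔ ¬ c) := by
    intro s hs t ht
    have as : |s| < ε := by rw [abs_of_pos hs.1]; exact hs.2
    have at' : |t| < ε := by rw [abs_of_pos ht.1]; exact ht.2
    have hpar := P.par_frame i hv hδI hs hδI ht
    have b1 : P.frame i (-δ) (-δ) ∉ P.boundary := fun h => by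
      rcases hbd _ _ aδ aδ h with h1 | h1 <;> linarith [h1.2]
    have b2 : P.frame i (-δ) t ∉ P.boundary := fun h => by
      rcases hbd _ _ aδ at' h with h1 | h1
      · linarith [h1.2]
      · linarith [h1.1]
    have b3 : P.frame i s (-δ) ∉ P.boundary := fun h => by
      rcases hbd _ _ as aδ h with h1 | h1
      · linarith [h1.1]
      · linarith [h1.2]
    have b4 : P.frame i s t ∉ P.boundary := fun h => by
      rcases hbd _ _ as at' h with h1 | h1
      · linarith [h1.1, ht.1]
      · linarith [h1.1, hs.1]
    have c1 : c ↔ P.par (P.frame i (-δ) (-δ)) = 1 := by rw [hc, P.mem_inside]; tauto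
    have c2 : c ↔ P.par (P.frame i (-δ) t) = 1 := by
      rw [← hout _ _ aδ at' (Or.inl (by linarith)), P.mem_inside]; tauto
    have c3 : c ↔ P.par (P.frame i s (-δ)) = 1 := by
      rw [← hout _ _ as aδ (Or.inr (by linarith)), P.mem_inside]; tauto
    rw [P.mem_inside, c1]
    rw [c1] at c2 c3
    generalize P.par (P.frame i (-δ) (-δ)) = u1 at *
    generalize P.par (P.frame i (-δ) t) = u2 at *
    generalize P.par (P.frame i s (-δ)) = u3 at *
    generalize P.par (P.frame i s t) = u4 at *
    -- Three of the corners agree and all four add up to 1, so the corner in the wedge has the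
    -- opposite parity.
    have : u4 = 1 ↔ ¬ u1 = 1 := by
      clear c1
      revert u1 u2 u3 u4
      decide
    tauto
  have hcr : c ↔ P.IsReflex i := by
    rw [P.isReflex_iff_frame]
    constructor
    · intro h
      exact ⟨ε, hε, fun s hs t ht h1 => (hin s hs t ht).1 h1 h⟩
    · rintro ⟨ε', hε', h⟩
      by_contra h1
      have hm : 0 < min δ (ε' / 2) := by positivity
      have h2 : min δ (ε' / 2) < ε := (min_le_left _ _).trans_lt hδI.2
      have h3 : min δ (ε' / 2) < ε' := (min_le_right _ _).trans_lt (by linarith)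
      exact h _ ⟨hm, h3⟩ _ ⟨hm, h3⟩ ((hin _ ⟨hm, h2⟩ _ ⟨hm, h2⟩).2 h1)
  refine ⟨ε, hε, ?_, ?_⟩
  · simpa only [hcr] using hout
  · simpa only [hcr] using hin

end RectilinearPolygon

/-! ### Rays and cuts at a vertex. -/

namespace RectilinearPolygon

variable {n : ℕ} (P : RectilinearPolygon n)

/-- The ray that extends an edge of vertex `i` beyond the vertex: the horizontal edge if `β` is
true, the vertical edge otherwise. -/
noncomputable def ray (i : Fin n) (β : Bool) (t : ℝ) : ℝ × ℝ :=
  if β then P.frame i (-t) 0 else P.frame i 0 (-t)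

/-- The ray `ray i β` first hits the boundary at parameter `T`. -/
def Hits (i : Fin n) (β : Bool) (T : ℝ) : Prop :=
  0 < T ∧ P.ray i β T ∈ P.boundary ∧ ∀ t ∈ Set.Ioo 0 T, P.ray i β t ∈ P.inside

/-- The direction of `ray i β`. -/
noncomputable def dir (i : Fin n) (β : Bool) : ℝ × ℝ :=
  if β then ((P.vtx i).1 - (P.vtx (P.hn i)).1, 0) else (0, (P.vtx i).2 - (P.vtx (P.vn i)).2)

theorem ray_eq (i : Fin n) (β : Bool) (t : ℝ) : P.ray i β t = P.vtx i + t • P.dir i β := by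
  cases β <;> ext <;> simp [ray, dir, frame] <;> ring

theorem dir_ne (i : Fin n) (β : Bool) : P.dir i β ≠ 0 := by
  cases β
  · intro h
    have := congrArg Prod.snd h
    simp only [dir, Bool.false_eq_true, if_false, Prod.snd_zero, sub_eq_zero] at this
    exact P.vtx_vn_snd_ne i this.symm
  · intro h
    have := congrArg Prod.fst h
    simp only [dir, if_true, Prod.fst_zero, sub_eq_zero] at this
    exact P.vtx_hn_fst_ne i this.symm

theorem dir_axis (i : Fin n) (β : Bool) : (P.dir i β).1 = 0 ∨ (P.dir i β).2 = 0 := by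
  cases β <;> simp [dir]

theorem ray_injective {i : Fin n} {β : Bool} {t t' : ℝ} (h : P.ray i β t = P.ray i β t') :
    t = t' := by
  rw [ray_eq, ray_eq, add_right_inj] at h
  exact smul_left_injective ℝ (P.dir_ne i β) h

theorem ray_zero (i : Fin n) (β : Bool) : P.ray i β 0 = P.vtx i := by simp [ray_eq]

theorem ray_neg_mem_boundary (i : Fin n) (β : Bool) {t : ℝ} (ht : t ∈ Set.Icc 0 1) :
    P.ray i β (-t) ∈ P.boundary := by
  cases β
  · apply P.segment_vn_subset i
    refine ⟨1 - t, t, by linarith [ht.2], ht.1, by ring, ?_⟩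
    ext <;> simp [ray, frame, P.vtx_vn_fst] <;> ring
  · apply P.segment_hn_subset i
    refine ⟨1 - t, t, by linarith [ht.2], ht.1, by ring, ?_⟩
    ext <;> simp [ray, frame, P.vtx_hn_snd] <;> ring

theorem exists_ray_eq_of_axis {i : Fin n} {b : ℝ × ℝ} (hb : (P.vtx i).1 = b.1 ∨ (P.vtx i).2 = b.2) :
    ∃ β t, b = P.ray i β t := by
  rcases hb with h | h
  · refine ⟨false, (b.2 - (P.vtx i).2) / ((P.vtx i).2 - (P.vtx (P.vn i)).2), ?_⟩
    rw [ray_eq]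
    ext
    · simp [dir, h]
    · simp only [dir, Bool.false_eq_true, if_false, Prod.snd_add, Prod.smul_snd, smul_eq_mul]
      rw [div_mul_cancel₀ _ (sub_ne_zero.2 (P.vtx_vn_snd_ne i).symm)]
      ring
  · refine ⟨true, (b.1 - (P.vtx i).1) / ((P.vtx i).1 - (P.vtx (P.hn i)).1), ?_⟩
    rw [ray_eq]
    ext
    · simp only [dir, if_true, Prod.fst_add, Prod.smul_fst, smul_eq_mul]
      rw [div_mul_cancel₀ _ (sub_ne_zero.2 (P.vtx_hn_fst_ne i).symm)]
      ring
    · simp [dir, h]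

theorem mem_openSegment_ray {i : Fin n} {β : Bool} {T : ℝ} (hT : 0 < T) {z : ℝ × ℝ} :
    z ∈ openSegment ℝ (P.vtx i) (P.ray i β T) ↔ ∃ t ∈ Set.Ioo 0 T, z = P.ray i β t := by
  simp only [openSegment_eq_image', ray_eq, add_sub_cancel_left, Set.mem_image]
  constructor
  · rintro ⟨θ, hθ, rfl⟩
    refine ⟨θ * T, ⟨mul_pos hθ.1 hT, by nlinarith [hθ.2]⟩, by rw [smul_smul]⟩
  · rintro ⟨t, ht, rfl⟩
    refine ⟨t / T, ⟨div_pos ht.1 hT, (div_lt_one hT).2 ht.2⟩, ?_⟩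
    rw [smul_smul, div_mul_cancel₀ _ hT.ne']

theorem exists_ray_eq_of_isStab {i : Fin n} {b : ℝ × ℝ} (hb : P.IsStab (P.vtx i) b) :
    ∃ β T, 0 < T ∧ b = P.ray i β T := by
  obtain ⟨hne, hax, hs⟩ := hb
  obtain ⟨β, T, rfl⟩ := P.exists_ray_eq_of_axis hax
  refine ⟨β, T, ?_, rfl⟩
  by_contra hT
  have hT0 : T ≠ 0 := by
    rintro rfl
    exact hne (P.ray_zero i β).symm
  have hT' : T < 0 := lt_of_le_of_ne (not_lt.1 hT) hT0
  have hden : (0 : ℝ) < 1 - T := by linarith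
  -- For negative `T` the segment would run along the edge at the vertex. The parameter `-t = T / (1
  -- - T)` lies strictly between `T` and 0 and above -1, hence on the segment and on the edge.
  set t := (-T) / (1 - T) with ht
  have ht0 : 0 < t := div_pos (by linarith) hden
  have ht1 : t < 1 := (div_lt_one hden).2 (by linarith)
  refine (hs (?_ : P.ray i β (-t) ∈ _)).1 (P.ray_neg_mem_boundary i β ⟨ht0.le, ht1.le⟩)
  simp only [openSegment_eq_image', ray_eq, add_sub_cancel_left]
  refine ⟨1 / (1 - T), ⟨by positivity, (div_lt_one hden).2 (by linarith)⟩, ?_⟩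
  show P.vtx i + (1 / (1 - T)) • T • P.dir i β = _
  rw [smul_smul, ht, neg_div, neg_neg, one_div_mul_eq_div]

theorem isStab_ray {i : Fin n} {β : Bool} {T : ℝ} (hT : 0 < T) :
    P.IsStab (P.vtx i) (P.ray i β T) ↔ ∀ t ∈ Set.Ioo 0 T, P.ray i β t ∈ P.inside := by
  constructor
  · intro h t ht
    exact h.2.2 ((P.mem_openSegment_ray hT).2 ⟨t, ht, rfl⟩)
  · intro h
    refine ⟨?_, ?_, ?_⟩
    · rw [← P.ray_zero i β]
      intro h1
      exact hT.ne (P.ray_injective h1)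
    · rw [ray_eq]
      rcases P.dir_axis i β with h1 | h1 <;> simp [h1]
    · intro z hz
      obtain ⟨t, ht, rfl⟩ := (P.mem_openSegment_ray hT).1 hz
      exact h t ht

variable {P}

theorem Hits.isStab {i : Fin n} {β : Bool} {T : ℝ} (h : P.Hits i β T) :
    P.IsStab (P.vtx i) (P.ray i β T) := (P.isStab_ray h.1).2 h.2.2

theorem exists_hits_of_ray {i : Fin n} {β : Bool} {ε : ℝ} (hε : 0 < ε)
    (h : ∀ t ∈ Set.Ioo 0 ε, P.ray i β t ∈ P.inside) : ∃ T, P.Hits i β T := by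
  obtain ⟨T, hT, h1, h2⟩ := P.exists_hit (P.dir_ne i β) (P.dir_axis i β) hε
    (v := P.vtx i) (by simpa only [ray_eq] using h)
  exact ⟨T, hT, by simpa only [ray_eq] using h1, by simpa only [ray_eq] using h2⟩

theorem IsReflex.exists_hits {i : Fin n} (h : P.IsReflex i) (β : Bool) : ∃ T, P.Hits i β T := by
  obtain ⟨ε, hε, h1, -⟩ := P.local_structure i
  refine exists_hits_of_ray hε fun t ht => ?_
  have a1 : |(-t)| < ε := by rw [abs_neg, abs_of_pos ht.1]; exact ht.2
  have a2 : |(0 : ℝ)| < ε := by rwa [abs_zero]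
  have a3 : -t < 0 := by linarith [ht.1]
  cases β
  · exact (h1 _ _ a2 a1 (Or.inr a3)).2 h
  · exact (h1 _ _ a1 a2 (Or.inl a3)).2 h

/-- The extension of an edge leaves the closed wedge at once, and there `local_structure` equates
being inside with reflexivity. -/
theorem isReflex_of_ray {i : Fin n} {β : Bool} {ε : ℝ} (hε : 0 < ε)
    (h : ∀ t ∈ Set.Ioo 0 ε, P.ray i β t ∈ P.inside) : P.IsReflex i := by
  obtain ⟨δ, hδ, h1, -⟩ := P.local_structure i
  have hm : 0 < min ε δ / 2 := by positivity
  have m1 : min ε δ / 2 < ε := by linarith [min_le_left ε δ]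
  have m2 : min ε δ / 2 < δ := by linarith [min_le_right ε δ]
  have a1 : |(-(min ε δ / 2))| < δ := by rwa [abs_neg, abs_of_pos hm]
  have a2 : |(0 : ℝ)| < δ := by rwa [abs_zero]
  have h2 := h _ ⟨hm, m1⟩
  cases β
  · exact (h1 _ _ a2 a1 (Or.inr (by linarith))).1 h2
  · exact (h1 _ _ a1 a2 (Or.inl (by linarith))).1 h2

variable (P)

/-- The maximal stabbing segment that extends an edge of vertex `i`. -/
def cut (i : Fin n) (β : Bool) : Set (ℝ × ℝ) :=
  {z | ∃ t > 0, z = P.ray i β t ∧ ∀ r ∈ Set.Ioc 0 t, P.ray i β r ∈ P.inside}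

variable {P}

theorem Hits.mem_cut {i : Fin n} {β : Bool} {T : ℝ} (h : P.Hits i β T) {z : ℝ × ℝ} :
    z ∈ P.cut i β ↔ ∃ t ∈ Set.Ioo 0 T, z = P.ray i β t := by
  constructor
  · rintro ⟨t, ht, rfl, h1⟩
    refine ⟨t, ⟨ht, ?_⟩, rfl⟩
    by_contra h2
    exact (h1 T ⟨h.1, not_lt.1 h2⟩).1 h.2.1
  · rintro ⟨t, ht, rfl⟩
    exact ⟨t, ht.1, rfl, fun r hr => h.2.2 r ⟨hr.1, hr.2.trans_lt ht.2⟩⟩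

theorem Hits.cut_eq {i : Fin n} {β : Bool} {T : ℝ} (h : P.Hits i β T) :
    P.cut i β = openSegment ℝ (P.vtx i) (P.ray i β T) := by
  ext z
  rw [h.mem_cut, P.mem_openSegment_ray h.1]

theorem cut_subset_inside (i : Fin n) (β : Bool) : P.cut i β ⊆ P.inside := by
  rintro z ⟨t, ht, rfl, h⟩
  exact h t ⟨ht, le_rfl⟩

/-- Replaces the geometric definition by an indexing with pairs of a reflex vertex and a direction.
No other direction is possible, since the remaining two axis directions run along the edges. -/
theorem mem_reflexSegments {ρ : Set (ℝ × ℝ)} :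
    ρ ∈ P.reflexSegments ↔ ∃ i β, P.IsReflex i ∧ ρ = P.cut i β := by
  constructor
  · rintro ⟨i, b, h1, h2, h3, rfl⟩
    obtain ⟨β, T, hT, rfl⟩ := P.exists_ray_eq_of_isStab h2
    have h4 : P.Hits i β T := ⟨hT, h3, (P.isStab_ray hT).1 h2⟩
    exact ⟨i, β, h1, h4.cut_eq.symm⟩
  · rintro ⟨i, β, h1, rfl⟩
    obtain ⟨T, hT⟩ := h1.exists_hits β
    exact ⟨i, _, h1, hT.isStab, hT.2.1, hT.cut_eq⟩

theorem cut_mem_reflexSegments {i : Fin n} (h : P.IsReflex i) (β : Bool) :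
    P.cut i β ∈ P.reflexSegments := mem_reflexSegments.2 ⟨i, β, h, rfl⟩

/-- If a nondegenerate axis-aligned segment ends in vertex `i` and is inside otherwise, then the
vertex is reflex and the segment is part of a cut. -/
theorem mem_cut_of_segment {i : Fin n} {a : ℝ × ℝ} (ha : a ≠ P.vtx i)
    (hax : (P.vtx i).1 = a.1 ∨ (P.vtx i).2 = a.2)
    (h : ∀ z ∈ segment ℝ (P.vtx i) a, z ≠ P.vtx i → z ∈ P.inside) :
    P.IsReflex i ∧ ((P.vtx i).1 = a.1 → a ∈ P.cut i false) ∧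
      ((P.vtx i).2 = a.2 → a ∈ P.cut i true) := by
  have hst : P.IsStab (P.vtx i) a := ⟨ha.symm, hax, fun z hz => h z
    (openSegment_subset_segment ℝ _ _ hz) fun h1 => by
      rw [h1, left_mem_openSegment_iff] at hz
      exact ha hz.symm⟩
  obtain ⟨β, T, hT, rfl⟩ := P.exists_ray_eq_of_isStab hst
  have h1 := (P.isStab_ray hT).1 hst
  have h2 : P.ray i β T ∈ P.cut i β := by
    refine ⟨T, hT, rfl, fun r hr => ?_⟩
    rcases hr.2.lt_or_eq with h3 | rfl
    · exact h1 r ⟨hr.1, h3⟩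
    · exact h _ (right_mem_segment ℝ _ _) ha
  refine ⟨isReflex_of_ray hT h1, ?_, ?_⟩
  · intro h3
    cases β
    · exact h2
    · exfalso
      rw [ray_eq] at h3
      have hd := P.vtx_hn_fst_ne i
      simp only [dir, if_true, Prod.fst_add, Prod.smul_fst, smul_eq_mul, left_eq_add,
        mul_eq_zero, hT.ne', false_or, sub_eq_zero] at h3
      exact hd h3.symm
  · intro h3
    cases β
    · exfalso
      rw [ray_eq] at h3
      have hd := P.vtx_vn_snd_ne i
      simp only [dir, Bool.false_eq_true, if_false, Prod.snd_add, Prod.smul_snd, smul_eq_mul,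
        left_eq_add, mul_eq_zero, hT.ne', false_or, sub_eq_zero] at h3
      exact hd h3.symm
    · exact h2

/-! ### The corner lemma -/

theorem exists_reflex_corner_of_le {q z : ℝ × ℝ} (hz : z ∈ P.boundary) (hx : q.1 ≤ z.1)
    (hy : q.2 ≤ z.2) (hh : ∀ x ∈ Set.Icc q.1 z.1, (x, q.2) ∈ P.inside)
    (hv : ∀ y ∈ Set.Icc q.2 z.2, (q.1, y) ∈ P.inside) :
    ∃ i, (P.vtx i).1 ∈ Set.Ioc q.1 z.1 ∧ (P.vtx i).2 ∈ Set.Ioc q.2 z.2 ∧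
      (∀ x ∈ Set.Ico q.1 (P.vtx i).1, (x, (P.vtx i).2) ∈ P.inside) ∧
      ∀ y ∈ Set.Ico q.2 (P.vtx i).2, ((P.vtx i).1, y) ∈ P.inside := by
  classical
  have pos : ∀ p ∈ P.boundary, q.1 ≤ p.1 → p.1 ≤ z.1 → q.2 ≤ p.2 → p.2 ≤ z.2 →
      q.1 < p.1 ∧ q.2 < p.2 := by
    intro p hp h1 h2 h3 h4
    constructor
    · refine lt_of_le_of_ne h1 fun h => (hv p.2 ⟨h3, h4⟩).1 ?_
      rwa [h]
    · refine lt_of_le_of_ne h3 fun h => (hh p.1 ⟨h1, h2⟩).1 ?_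
      rwa [h]
  -- The edge through `p` cannot reach the arm that it points to, because the arm is inside. So its
  -- end towards that arm lies in the box spanned by `q` and `p`.
  have key : ∀ p ∈ P.boundary, q.1 ≤ p.1 → p.1 ≤ z.1 → q.2 ≤ p.2 → p.2 ≤ z.2 →
      ∃ j, q.1 ≤ (P.vtx j).1 ∧ (P.vtx j).1 ≤ p.1 ∧ q.2 ≤ (P.vtx j).2 ∧ (P.vtx j).2 ≤ p.2 := by
    intro p hp h1 h2 h3 h4
    have h5 := pos p hp h1 h2 h3 h4
    obtain ⟨j, hj⟩ := Set.mem_iUnion.1 hp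
    by_cases hor : P.IsHor j
    · have hor' : (P.vtx j).2 = (P.vtx (P.next j)).2 := hor
      have hm := (RectilinearBoundary.mem_edge_hor hor).1 hj
      have hq : q.1 ∉ Set.uIcc (P.vtx j).1 (P.vtx (P.next j)).1 := fun h6 =>
        (hv p.2 ⟨h3, h4⟩).1 (RectilinearBoundary.edge_subset_boundary j
          ((RectilinearBoundary.mem_edge_hor hor).2 ⟨hm.1, h6⟩))
      rw [Set.mem_uIcc] at hq hm
      by_contra! hcon
      have c1 := hcon j
      have c2 := hcon (P.next j)
      rw [← hor'] at c2
      rw [← hm.1] at c1 c2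
      grind
    · have ver := (P.alternates.vert_iff j).2 hor
      have hm := (P.alternates.mem_edge_vert hor).1 hj
      have hq : q.2 ∉ Set.uIcc (P.vtx j).2 (P.vtx (P.next j)).2 := fun h6 =>
        (hh p.1 ⟨h1, h2⟩).1 (RectilinearBoundary.edge_subset_boundary j
          ((P.alternates.mem_edge_vert hor).2 ⟨hm.1, h6⟩))
      rw [Set.mem_uIcc] at hq hm
      by_contra! hcon
      have c1 := hcon j
      have c2 := hcon (P.next j)
      rw [← ver] at c2
      rw [← hm.1] at c1 c2
      grind
  obtain ⟨j, hj⟩ := key z hz hx le_rfl hy le_rfl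
  -- A vertex with minimal coordinate sum is the only boundary point of the box between `q` and
  -- itself, as any other would yield a smaller vertex by `key`.
  obtain ⟨i, hi, hmin⟩ := Finset.exists_min_image
    (Finset.univ.filter fun j => q.1 ≤ (P.vtx j).1 ∧ (P.vtx j).1 ≤ z.1 ∧ q.2 ≤ (P.vtx j).2 ∧
      (P.vtx j).2 ≤ z.2) (fun j => (P.vtx j).1 + (P.vtx j).2) ⟨j, by simpa using hj⟩
  simp only [Finset.mem_filter, Finset.mem_univ, true_and] at hi hmin
  obtain ⟨i1, i2, i3, i4⟩ := hi
  have hpos := pos _ (P.vtx_mem_boundary i) i1 i2 i3 i4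
  have free : ∀ p ∈ P.boundary, q.1 ≤ p.1 → p.1 ≤ (P.vtx i).1 → q.2 ≤ p.2 → p.2 ≤ (P.vtx i).2 →
      p = P.vtx i := by
    intro p hp h1 h2 h3 h4
    obtain ⟨j, j1, j2, j3, j4⟩ := key p hp h1 (h2.trans i2) h3 (h4.trans i4)
    have := hmin j ⟨j1, j2.trans (h2.trans i2), j3, j4.trans (h4.trans i4)⟩
    exact Prod.ext (by linarith) (by linarith)
  refine ⟨i, ⟨hpos.1, i2⟩, ⟨hpos.2, i4⟩, fun x hx => ?_, fun y hy => ?_⟩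
  · refine P.inside_of_horizontal (hv _ ⟨i3, i4⟩) fun t ht hb => ?_
    rw [Set.uIcc_of_le hx.1] at ht
    have := congrArg Prod.fst (free _ hb ht.1 (ht.2.trans hx.2.le) i3 le_rfl)
    simp only at this
    linarith [ht.2, hx.2]
  · refine P.inside_of_vertical (hh _ ⟨i1, i2⟩) fun t ht hb => ?_
    rw [Set.uIcc_of_le hy.1] at ht
    have := congrArg Prod.snd (free _ hb i1 le_rfl ht.1 (ht.2.trans hy.2.le))
    simp only at this
    linarith [ht.2, hy.2]

/-- If two sides of a box that meet in the corner `q` are inside, but the opposite corner `z` is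
on the boundary, then the box has a reflex vertex whose two cuts cross these sides. -/
theorem exists_reflex_corner {q z : ℝ × ℝ} (hz : z ∈ P.boundary)
    (hh : ∀ x ∈ Set.uIcc q.1 z.1, (x, q.2) ∈ P.inside)
    (hv : ∀ y ∈ Set.uIcc q.2 z.2, (q.1, y) ∈ P.inside) :
    ∃ i, P.IsReflex i ∧ (P.vtx i).1 ∈ Set.uIcc q.1 z.1 ∧ (P.vtx i).2 ∈ Set.uIcc q.2 z.2 ∧
      (q.1, (P.vtx i).2) ∈ P.cut i true ∧ ((P.vtx i).1, q.2) ∈ P.cut i false := by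
  suffices H : ∃ i, (P.vtx i).1 ∈ Set.uIcc q.1 z.1 ∧ (P.vtx i).2 ∈ Set.uIcc q.2 z.2 ∧
      (∀ x ∈ Set.uIcc q.1 (P.vtx i).1, x ≠ (P.vtx i).1 → (x, (P.vtx i).2) ∈ P.inside) ∧
      ∀ y ∈ Set.uIcc q.2 (P.vtx i).2, y ≠ (P.vtx i).2 → ((P.vtx i).1, y) ∈ P.inside by
    obtain ⟨i, h1, h2, h3, h4⟩ := H
    have n1 : q.1 ≠ (P.vtx i).1 := fun h => (hv _ h2).1 (by rw [h]; exact P.vtx_mem_boundary i)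
    have n2 : q.2 ≠ (P.vtx i).2 := fun h => (hh _ h1).1 (by rw [h]; exact P.vtx_mem_boundary i)
    have m1 := mem_cut_of_segment (P := P) (i := i) (a := (q.1, (P.vtx i).2))
      (fun h => n1 (Prod.ext_iff.1 h).1) (Or.inr rfl) (fun z hz hne => by
        have hz' : z ∈ segment ℝ ((P.vtx i).1, (P.vtx i).2) (q.1, (P.vtx i).2) := hz
        rw [mem_segment_hor] at hz'
        obtain ⟨x, y⟩ := z
        obtain ⟨hy, hx⟩ := hz'
        dsimp only at hy hx
        subst hy
        exact h3 x (Set.uIcc_comm q.1 _ ▸ hx) fun h => hne (Prod.ext h rfl))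
    have m2 := mem_cut_of_segment (P := P) (i := i) (a := ((P.vtx i).1, q.2))
      (fun h => n2 (Prod.ext_iff.1 h).2) (Or.inl rfl) (fun z hz hne => by
        have hz' : z ∈ segment ℝ ((P.vtx i).1, (P.vtx i).2) ((P.vtx i).1, q.2) := hz
        rw [mem_segment_vert] at hz'
        obtain ⟨x, y⟩ := z
        obtain ⟨hx, hy⟩ := hz'
        dsimp only at hy hx
        subst hx
        exact h4 y (Set.uIcc_comm q.2 _ ▸ hy) fun h => hne (Prod.ext rfl h))
    exact ⟨i, m1.1, h1, h2, m1.2.2 rfl, m2.2.1 rfl⟩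
  have neg_mem : ∀ {a b c : ℝ}, c ∈ Set.uIcc (-a) (-b) ↔ -c ∈ Set.uIcc a b := by
    intro a b c
    rw [Set.mem_uIcc, Set.mem_uIcc]
    constructor <;> rintro (h | h)
    · right; constructor <;> linarith
    · left; constructor <;> linarith
    · right; constructor <;> linarith
    · left; constructor <;> linarith
  -- Two reflections make `q` the lower left corner of the box.
  wlog h1 : q.1 ≤ z.1 generalizing P q z
  · obtain ⟨i, a1, a2, a3, a4⟩ := this (P := P.map flipX isSym_flipX) (q := (-q.1, q.2))
      (z := (-z.1, z.2)) ((mem_boundary_map _).2 (by simpa using hz))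
      (fun x hx => (mem_inside_map _).2 (hh (-x) (neg_mem.1 hx)))
      (fun y hy => (mem_inside_map _).2 (by simpa using hv y hy)) (by simp; linarith)
    refine ⟨i, ?_, a2, fun x hx hne => ?_, fun y hy hne => ?_⟩
    · have := neg_mem.1 a1
      simpa [vtx_map] using this
    · have := (mem_inside_map _).1 (a3 (-x) (neg_mem.2 (by simpa [vtx_map] using hx))
        (by simpa [vtx_map] using hne))
      simpa [vtx_map] using this
    · have := (mem_inside_map _).1 (a4 y hy hne)
      simpa [vtx_map] using this
  wlog h2 : q.2 ≤ z.2 generalizing P q z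
  · obtain ⟨i, a1, a2, a3, a4⟩ := this (P := P.map flipY isSym_flipY) (q := (q.1, -q.2))
      (z := (z.1, -z.2)) ((mem_boundary_map _).2 (by simpa using hz))
      (fun x hx => (mem_inside_map _).2 (by simpa using hh x hx))
      (fun y hy => (mem_inside_map _).2 (hv (-y) (neg_mem.1 hy))) h1 (by simp; linarith)
    refine ⟨i, a1, ?_, fun x hx hne => ?_, fun y hy hne => ?_⟩
    · have := neg_mem.1 a2
      simpa [vtx_map] using this
    · have := (mem_inside_map _).1 (a3 x hx hne)
      simpa [vtx_map] using this
    · have := (mem_inside_map _).1 (a4 (-y) (neg_mem.2 (by simpa [vtx_map] using hy))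
        (by simpa [vtx_map] using hne))
      simpa [vtx_map] using this
  rw [Set.uIcc_of_le h1] at hh
  rw [Set.uIcc_of_le h2] at hv
  obtain ⟨i, b1, b2, b3, b4⟩ := exists_reflex_corner_of_le hz h1 h2 hh hv
  rw [Set.uIcc_of_le h1, Set.uIcc_of_le h2]
  refine ⟨i, Set.Ioc_subset_Icc_self b1, Set.Ioc_subset_Icc_self b2, fun x hx hne => ?_,
    fun y hy hne => ?_⟩
  · rw [Set.uIcc_of_le b1.1.le] at hx
    exact b3 x ⟨hx.1, lt_of_le_of_ne hx.2 hne⟩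
  · rw [Set.uIcc_of_le b2.1.le] at hy
    exact b4 y ⟨hy.1, lt_of_le_of_ne hy.2 hne⟩

end RectilinearPolygon

namespace RectilinearPolygon

variable {n : ℕ} {P : RectilinearPolygon n}

/-! ### Cuts and stabbing segments -/

theorem ray_false_fst (i : Fin n) (t : ℝ) : (P.ray i false t).1 = (P.vtx i).1 := by
  simp [ray, frame]

theorem ray_true_snd (i : Fin n) (t : ℝ) : (P.ray i true t).2 = (P.vtx i).2 := by
  simp [ray, frame]

theorem fst_of_mem_cut {i : Fin n} {z : ℝ × ℝ} (h : z ∈ P.cut i false) : z.1 = (P.vtx i).1 := by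
  obtain ⟨t, -, rfl, -⟩ := h
  exact ray_false_fst i t

theorem snd_of_mem_cut {i : Fin n} {z : ℝ × ℝ} (h : z ∈ P.cut i true) : z.2 = (P.vtx i).2 := by
  obtain ⟨t, -, rfl, -⟩ := h
  exact ray_true_snd i t

theorem ray_mem_segment {i : Fin n} {β : Bool} {r t t' : ℝ} (h : r ∈ Set.uIcc t t') :
    P.ray i β r ∈ segment ℝ (P.ray i β t) (P.ray i β t') := by
  rw [← segment_eq_uIcc] at h
  obtain ⟨a, b, ha, hb, hab, rfl⟩ := h
  refine ⟨a, b, ha, hb, hab, ?_⟩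
  simp only [ray_eq]
  obtain rfl : a = 1 - b := by linarith
  module

theorem exists_of_mem_segment_ray {i : Fin n} {β : Bool} {t t' : ℝ} {z : ℝ × ℝ}
    (h : z ∈ segment ℝ (P.ray i β t) (P.ray i β t')) : ∃ r ∈ Set.uIcc t t', z = P.ray i β r := by
  obtain ⟨a, b, ha, hb, hab, rfl⟩ := h
  refine ⟨a * t + b * t', ?_, ?_⟩
  · rw [← segment_eq_uIcc]
    exact ⟨a, b, ha, hb, hab, rfl⟩
  · simp only [ray_eq]
    obtain rfl : a = 1 - b := by linarith
    module

theorem convex_cut (i : Fin n) (β : Bool) : Convex ℝ (P.cut i β) := by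
  rw [convex_iff_segment_subset]
  rintro a ⟨t, ht, rfl, h⟩ b ⟨t', ht', rfl, h'⟩ z hz
  obtain ⟨r, hr, rfl⟩ := exists_of_mem_segment_ray hz
  refine ⟨r, ?_, rfl, fun u hu => ?_⟩
  · rcases Set.mem_uIcc.1 hr with h1 | h1 <;> linarith [h1.1]
  · rcases Set.mem_uIcc.1 hr with h1 | h1
    · exact h' u ⟨hu.1, hu.2.trans h1.2⟩
    · exact h u ⟨hu.1, hu.2.trans h1.2⟩

/-- Cuts are maximal. -/
theorem mem_cut_of_free {i : Fin n} {β : Bool} {z w : ℝ × ℝ} (hz : z ∈ P.cut i β)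
    (hw : if β then z.2 = w.2 else z.1 = w.1) (h : ∀ p ∈ segment ℝ z w, p ∉ P.boundary) :
    w ∈ P.cut i β := by
  obtain ⟨t, ht, rfl, ht'⟩ := hz
  obtain ⟨t', rfl⟩ : ∃ t', w = P.ray i β t' := by
    cases β
    · refine ⟨(w.2 - (P.vtx i).2) / ((P.vtx i).2 - (P.vtx (P.vn i)).2), ?_⟩
      simp only [Bool.false_eq_true, if_false, ray_false_fst] at hw
      ext
      · rw [ray_false_fst, hw]
      · simp only [ray_eq, dir, Bool.false_eq_true, if_false, Prod.snd_add, Prod.smul_snd,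
          smul_eq_mul]
        rw [div_mul_cancel₀ _ (sub_ne_zero.2 (P.vtx_vn_snd_ne i).symm)]
        ring
    · refine ⟨(w.1 - (P.vtx i).1) / ((P.vtx i).1 - (P.vtx (P.hn i)).1), ?_⟩
      simp only [if_true, ray_true_snd] at hw
      ext
      · simp only [ray_eq, dir, if_true, Prod.fst_add, Prod.smul_fst, smul_eq_mul]
        rw [div_mul_cancel₀ _ (sub_ne_zero.2 (P.vtx_hn_fst_ne i).symm)]
        ring
      · rw [ray_true_snd, hw]
  have hpos : 0 < t' := by
    by_contra h1
    refine h _ (ray_mem_segment (r := 0) (Set.mem_uIcc.2 (Or.inr ⟨not_lt.1 h1, ht.le⟩))) ?_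
    rw [ray_zero]
    exact P.vtx_mem_boundary i
  refine ⟨t', hpos, rfl, fun r hr => ?_⟩
  rcases le_total r t with h1 | h1
  · exact ht' r ⟨hr.1, h1⟩
  · refine P.inside_of_segment ?_ (ht' t ⟨ht, le_rfl⟩) (b := P.ray i β r) fun p hp => ?_
    · simp only [ray_eq]
      rcases P.dir_axis i β with h2 | h2 <;> simp [h2]
    · obtain ⟨u, hu, rfl⟩ := exists_of_mem_segment_ray hp
      rw [Set.uIcc_of_le h1] at hu
      exact h _ (ray_mem_segment (Set.mem_uIcc.2 (Or.inl ⟨hu.1, hu.2.trans hr.2⟩)))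

theorem convex_of_mem_stabbingSegments {s : Set (ℝ × ℝ)} (hs : s ∈ P.stabbingSegments) :
    Convex ℝ s := by
  obtain ⟨a, b, -, rfl⟩ := hs
  exact convex_openSegment a b

theorem subset_inside_of_mem_stabbingSegments {s : Set (ℝ × ℝ)} (hs : s ∈ P.stabbingSegments) :
    s ⊆ P.inside := by
  obtain ⟨a, b, h, rfl⟩ := hs
  exact h.2.2

theorem axis_of_mem_stabbingSegments {s : Set (ℝ × ℝ)} (hs : s ∈ P.stabbingSegments) :
    (∀ z ∈ s, ∀ w ∈ s, z.1 = w.1) ∨ ∀ z ∈ s, ∀ w ∈ s, z.2 = w.2 := by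
  obtain ⟨a, b, h, rfl⟩ := hs
  have key : ∀ z ∈ openSegment ℝ a b, (a.1 = b.1 → z.1 = a.1) ∧ (a.2 = b.2 → z.2 = a.2) := by
    rintro z ⟨u, v, -, -, huv, rfl⟩
    constructor <;> intro h1 <;> simp only [Prod.fst_add, Prod.snd_add, Prod.smul_fst,
      Prod.smul_snd, smul_eq_mul, ← h1, ← add_mul, huv, one_mul]
  rcases h.2.1 with h1 | h1
  · exact Or.inl fun z hz w hw => ((key z hz).1 h1).trans ((key w hw).1 h1).symm
  · exact Or.inr fun z hz w hw => ((key z hz).2 h1).trans ((key w hw).2 h1).symm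

/-- Only the boundary can stop a cut, and a stabbing segment contains no boundary point. -/
theorem subset_cut_of_parallel {i : Fin n} {β : Bool} {s : Set (ℝ × ℝ)}
    (hs : s ∈ P.stabbingSegments) {z : ℝ × ℝ} (hz : z ∈ s) (hzc : z ∈ P.cut i β)
    (h : if β then ∀ z ∈ s, ∀ w ∈ s, z.2 = w.2 else ∀ z ∈ s, ∀ w ∈ s, z.1 = w.1) :
    s ⊆ P.cut i β := by
  intro w hw
  refine mem_cut_of_free hzc ?_ fun p hp => ?_
  · cases β <;> exact h z hz w hw
  · exact (subset_inside_of_mem_stabbingSegments hs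
      ((convex_of_mem_stabbingSegments hs).segment_subset hz hw hp)).1

theorem Thin.cut_eq (h : P.Thin) {i j : Fin n} {β γ : Bool} (hi : P.IsReflex i)
    (hj : P.IsReflex j) {z : ℝ × ℝ} (h1 : z ∈ P.cut i β) (h2 : z ∈ P.cut j γ) :
    P.cut i β = P.cut j γ := by
  by_contra hne
  exact Set.disjoint_left.1 (h (cut_mem_reflexSegments hi β) (cut_mem_reflexSegments hj γ) hne)
    h1 h2

theorem IsReflex.exists_two_mem_cut {i : Fin n} (h : P.IsReflex i) (β : Bool) :
    ∃ z ∈ P.cut i β, ∃ w ∈ P.cut i β, z ≠ w := by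
  obtain ⟨T, hT⟩ := h.exists_hits β
  have hT0 := hT.1
  refine ⟨P.ray i β (T / 2), hT.mem_cut.2 ⟨_, ⟨by linarith, by linarith⟩, rfl⟩,
    P.ray i β (T / 3), hT.mem_cut.2 ⟨_, ⟨by linarith, by linarith⟩, rfl⟩, fun h1 => ?_⟩
  have := P.ray_injective h1
  linarith

theorem IsReflex.cut_ne {i j : Fin n} (h : P.IsReflex i) : P.cut i true ≠ P.cut j false := by
  intro heq
  obtain ⟨z, hz, w, hw, hne⟩ := h.exists_two_mem_cut true
  refine hne (Prod.ext ?_ ?_)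
  · exact (fst_of_mem_cut (heq.subset hz)).trans (fst_of_mem_cut (heq.subset hw)).symm
  · rw [snd_of_mem_cut hz, snd_of_mem_cut hw]

theorem Thin.not_mem_cut (h : P.Thin) {i j : Fin n} (hi : P.IsReflex i)
    (hj : P.IsReflex j) {z : ℝ × ℝ} (h1 : z ∈ P.cut i true) (h2 : z ∈ P.cut j false) : False :=
  hi.cut_ne (h.cut_eq hi hj h1 h2)

/-! ### Cuts in thin polygons -/

theorem mem_cut_false {i : Fin n} {a b : ℝ × ℝ} (ha : a ∈ P.cut i false) (hb : b ∈ P.cut i false)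
    {y : ℝ} (hy : y ∈ Set.uIcc a.2 b.2) : (a.1, y) ∈ P.cut i false := by
  refine (convex_cut i false).segment_subset ha hb ?_
  have h1 : b = (a.1, b.2) := Prod.ext ((fst_of_mem_cut hb).trans (fst_of_mem_cut ha).symm) rfl
  rw [h1, show segment ℝ a (a.1, b.2) = segment ℝ (a.1, a.2) (a.1, b.2) from rfl, mem_segment_vert]
  exact ⟨rfl, hy⟩

theorem mem_cut_false_of_vtx {i : Fin n} {a : ℝ × ℝ} (ha : a ∈ P.cut i false)
    {y : ℝ} (hy : y ∈ Set.uIcc a.2 (P.vtx i).2) (hne : y ≠ (P.vtx i).2) :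
    (a.1, y) ∈ P.cut i false := by
  have hax := fst_of_mem_cut ha
  obtain ⟨t, ht, rfl, h⟩ := ha
  have h1 : ((P.ray i false t).1, y) ∈ segment ℝ (P.ray i false t) (P.ray i false 0) := by
    rw [ray_zero, show P.ray i false t = ((P.vtx i).1, (P.ray i false t).2) from Prod.ext hax rfl,
      show P.vtx i = ((P.vtx i).1, (P.vtx i).2) from rfl, mem_segment_vert]
    exact ⟨rfl, hy⟩
  obtain ⟨r, hr, h2⟩ := exists_of_mem_segment_ray h1
  rw [Set.uIcc_of_ge ht.le] at hr
  rw [h2]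
  refine ⟨r, lt_of_le_of_ne hr.1 ?_, rfl, fun u hu => h u ⟨hu.1, hu.2.trans hr.2⟩⟩
  rintro rfl
  rw [ray_zero] at h2
  exact hne (congrArg Prod.snd h2)

/-- Next to a vertical cut, a horizontal segment that crosses the cut can be shifted along the
cut without hitting the boundary. -/
theorem Thin.shift_not_mem_boundary (h : P.Thin) {i : Fin n} (hi : P.IsReflex i) {a b : ℝ × ℝ}
    (ha : a ∈ P.cut i false) (hb : b ∈ P.cut i false) {x : ℝ}
    (hx : ∀ u ∈ Set.uIcc a.1 x, (u, a.2) ∈ P.inside) : (x, b.2) ∉ P.boundary := by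
  intro hbd
  -- The corner lemma produces a vertex whose horizontal cut crosses the given vertical cut, which
  -- thinness forbids.
  obtain ⟨j, hj, -, h2, h3, -⟩ := exists_reflex_corner (q := a) (z := (x, b.2)) hbd hx
    fun y hy => cut_subset_inside i false (mem_cut_false ha hb hy)
  exact h.not_mem_cut hj hi h3 (mem_cut_false ha hb h2)

theorem mem_of_mem_stabbingSegments_hor {s : Set (ℝ × ℝ)} (hs : s ∈ P.stabbingSegments)
    {z w : ℝ × ℝ} (hz : z ∈ s) (hw : w ∈ s) (hzw : z.2 = w.2) {x : ℝ}
    (hx : x ∈ Set.uIcc z.1 w.1) : (x, z.2) ∈ s := by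
  refine (convex_of_mem_stabbingSegments hs).segment_subset hz hw ?_
  rw [show w = (w.1, z.2) from Prod.ext rfl hzw.symm,
    show segment ℝ z (w.1, z.2) = segment ℝ (z.1, z.2) (w.1, z.2) from rfl, mem_segment_hor]
  exact ⟨rfl, hx⟩

/-- The horizontal line through `i` already carries the vertices `i` and `hn i`, so by general
position the cut ends in the relative interior of a vertical edge. This edge continues to both
sides. -/
theorem GeneralPosition.exists_boundary_beside (h : P.GeneralPosition) {i : Fin n} {T : ℝ}
    (hT : P.Hits i true T) {y : ℝ} (hy : y ≠ (P.vtx i).2) :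
    ∃ y' ∈ Set.uIcc y (P.vtx i).2, y' ≠ (P.vtx i).2 ∧
      ((P.ray i true T).1, y') ∈ P.boundary := by
  set b := P.ray i true T with hb
  have hb2 : b.2 = (P.vtx i).2 := ray_true_snd i T
  have hb1 : b.1 = (P.vtx i).1 + T * ((P.vtx i).1 - (P.vtx (P.hn i)).1) := by
    simp [hb, ray_eq, dir]
  have hX := sub_ne_zero.2 (P.vtx_hn_fst_ne i).symm
  have hT0 := hT.1
  have hline : ∀ k, (P.vtx k).2 = (P.vtx i).2 → k = i ∨ k = P.hn i := by
    intro k hk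
    by_contra! hne
    exact (h i (P.hn i) k (P.hn_ne i).symm hne.2.symm hne.1.symm).2
      ⟨(P.vtx_hn_snd i).symm, (P.vtx_hn_snd i).trans hk.symm⟩
  have hbi : b.1 ≠ (P.vtx i).1 := by
    rw [hb1]
    intro h1
    rcases mul_eq_zero.1 (left_eq_add.1 h1.symm) with h2 | h2
    · exact hT0.ne' h2
    · exact hX h2
  have hbh : b.1 ≠ (P.vtx (P.hn i)).1 := by
    rw [hb1]
    intro h1
    have : (T + 1) * ((P.vtx i).1 - (P.vtx (P.hn i)).1) = 0 := by linarith
    rcases mul_eq_zero.1 this with h2 | h2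
    · linarith
    · exact hX h2
  obtain ⟨k, hk⟩ := Set.mem_iUnion.1 hT.2.1
  by_cases hor : P.IsHor k
  · exfalso
    have hm := (RectilinearBoundary.mem_edge_hor hor).1 hk
    rw [← hb] at hm
    have hor' : (P.vtx k).2 = (P.vtx (P.next k)).2 := hor
    have e1 := hline k (hm.1.symm.trans hb2)
    have e2 := hline (P.next k) (hor'.symm.trans (hm.1.symm.trans hb2))
    -- A horizontal edge at the end of the cut could only be the edge at `i`, but that edge lies on
    -- the other side of `i`.
    have hmem : b.1 ∈ Set.uIcc (P.vtx i).1 (P.vtx (P.hn i)).1 := by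
      have h3 := P.next_ne k
      rcases e1 with e1 | e1 <;> rcases e2 with e2 | e2
      · exact absurd (e2.trans e1.symm) h3
      · rw [e2, e1] at hm; exact hm.2
      · rw [e2, e1, Set.uIcc_comm] at hm; exact hm.2
      · exact absurd (e2.trans e1.symm) h3
    rw [hb1, Set.mem_uIcc] at hmem
    rcases lt_or_gt_of_ne hX with h1 | h1 <;> rcases hmem with h2 | h2 <;> nlinarith
  · have hm := (P.alternates.mem_edge_vert hor).1 hk
    rw [← hb] at hm
    have ver := (P.alternates.vert_iff k).2 hor
    have key : ∀ m, (P.vtx m).1 = b.1 → (P.vtx m).2 ≠ (P.vtx i).2 := by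
      intro m h1 h2
      rcases hline m h2 with rfl | rfl
      · exact hbi h1.symm
      · exact hbh h1.symm
    have k1 := key k hm.1.symm
    have k2 := key (P.next k) (ver.symm.trans hm.1.symm)
    have hedge : ∀ y', y' ∈ Set.uIcc (P.vtx k).2 (P.vtx (P.next k)).2 → (b.1, y') ∈ P.boundary :=
      fun y' hy' => RectilinearBoundary.edge_subset_boundary k
        ((P.alternates.mem_edge_vert hor).2 ⟨hm.1, hy'⟩)
    have hm2 := hm.2
    rw [hb2] at hm2
    by_cases hyk : y ∈ Set.uIcc (P.vtx k).2 (P.vtx (P.next k)).2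
    · exact ⟨y, Set.left_mem_uIcc, hy, hedge y hyk⟩
    · rw [Set.mem_uIcc] at hm2 hyk
      by_cases hk' : (P.vtx k).2 ∈ Set.uIcc y (P.vtx i).2
      · exact ⟨_, hk', k1, hedge _ Set.left_mem_uIcc⟩
      · refine ⟨_, ?_, k2, hedge _ Set.right_mem_uIcc⟩
        rw [Set.mem_uIcc] at hk' ⊢
        grind

/-- A stabbing segment that crosses a vertical cut meets other cuts only on the side of the
horizontal edge at the reflex vertex. -/
theorem Thin.turn_false (h : P.Thin) (hg : P.GeneralPosition) {i j : Fin n} {γ : Bool}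
    (hi : P.IsReflex i) (hj : P.IsReflex j) {s : Set (ℝ × ℝ)} (hs : s ∈ P.stabbingSegments)
    {z w : ℝ × ℝ} (hz : z ∈ s) (hzi : z ∈ P.cut i false) (hw : w ∈ s) (hwj : w ∈ P.cut j γ)
    (hne : P.cut j γ ≠ P.cut i false) :
    γ = false ∧ ∃ c : ℝ, c < 0 ∧ w = z + c • P.dir i true := by
  have hs2 : ∀ z ∈ s, ∀ w ∈ s, z.2 = w.2 := by
    rcases axis_of_mem_stabbingSegments hs with h1 | h1
    · exact absurd (h.cut_eq hj hi hwj (subset_cut_of_parallel hs hz hzi h1 hw)) hne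
    · exact h1
  have hγ : γ = false := by
    cases γ
    · rfl
    · exact (h.not_mem_cut hj hi (subset_cut_of_parallel hs hw hwj hs2 hz) hzi).elim
  subst hγ
  refine ⟨rfl, ?_⟩
  have hzw := hs2 z hz w hw
  have hz1 := fst_of_mem_cut hzi
  set X := (P.vtx i).1 - (P.vtx (P.hn i)).1 with hX
  have hX0 : X ≠ 0 := sub_ne_zero.2 (P.vtx_hn_fst_ne i).symm
  set c := (w.1 - z.1) / X with hc
  have hcX : w.1 = z.1 + c * X := by rw [hc, div_mul_cancel₀ _ hX0]; ring
  have hw' : w = z + c • P.dir i true := by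
    ext
    · simp only [dir, if_true, Prod.fst_add, Prod.smul_fst, smul_eq_mul]
      exact hcX
    · simp [dir, hzw]
  refine ⟨c, ?_, hw'⟩
  by_contra hc0
  -- Suppose that `w` lies on the side of the horizontal cut of `i`. Either way, a boundary point
  -- then appears beside the vertical cut, against `shift_not_mem_boundary`.
  have hc1 : 0 < c := by
    refine lt_of_le_of_ne (not_lt.1 hc0) fun h1 => hne ?_
    have h2 : w = z := by rw [hw', ← h1, zero_smul, add_zero]
    exact h.cut_eq hj hi hwj (h2 ▸ hzi)
  have hzv : z.2 ≠ (P.vtx i).2 := fun h1 =>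
    (cut_subset_inside i false hzi).1 (by
      rw [show z = P.vtx i from Prod.ext hz1 h1]; exact P.vtx_mem_boundary i)
  obtain ⟨T, hT⟩ := hi.exists_hits true
  have hray : ∀ t, (P.ray i true t).1 = z.1 + t * X := fun t => by
    simp [ray_eq, dir, hz1, hX]
  have hmem : ∀ t ∈ Set.Icc 0 c, (z.1 + t * X) ∈ Set.uIcc z.1 w.1 := by
    intro t ht
    rw [hcX, ← segment_eq_uIcc]
    refine ⟨1 - t / c, t / c, ?_, div_nonneg ht.1 hc1.le, by ring, ?_⟩
    · rw [sub_nonneg]; exact (div_le_one hc1).2 ht.2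
    · simp only [smul_eq_mul]
      field_simp
      ring
  have hin : ∀ t ∈ Set.Icc 0 c, ∀ u ∈ Set.uIcc z.1 (z.1 + t * X), (u, z.2) ∈ P.inside := by
    intro t ht u hu
    refine subset_inside_of_mem_stabbingSegments hs
      (mem_of_mem_stabbingSegments_hor hs hz hw hzw ?_)
    exact Set.uIcc_subset_uIcc Set.left_mem_uIcc (hmem t ht) hu
  -- If the horizontal cut of `i` extends past the abscissa of `w`, the cut of `j` must stop before
  -- crossing it, at a boundary point. Otherwise the horizontal cut itself ends earlier, at a
  -- vertical edge.
  rcases lt_or_ge c T with hcT | hcT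
  · have h1 : P.ray i true c ∈ P.cut i true := hT.mem_cut.2 ⟨c, ⟨hc1, hcT⟩, rfl⟩
    have h2 : P.ray i true c ∉ P.cut j false := fun h3 => h.not_mem_cut hi hj h1 h3
    have hre : P.ray i true c = (w.1, (P.vtx i).2) :=
      Prod.ext ((hray c).trans hcX.symm) (ray_true_snd i c)
    have h3 : ∃ p ∈ segment ℝ w (P.ray i true c), p ∈ P.boundary := by
      by_contra! h4
      exact h2 (mem_cut_of_free hwj (by simp [hre]) h4)
    obtain ⟨p, hp, hpb⟩ := h3
    rw [hre, show segment ℝ w (w.1, (P.vtx i).2) = segment ℝ (w.1, w.2) (w.1, (P.vtx i).2) from rfl,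
      mem_segment_vert] at hp
    have hpv : p.2 ≠ (P.vtx i).2 := fun h4 => (cut_subset_inside _ _ h1).1 (by
      rw [hre, ← h4, ← hp.1]; exact hpb)
    refine h.shift_not_mem_boundary hi hzi
      (mem_cut_false_of_vtx hzi (y := p.2) (by rw [hzw]; exact hp.2) hpv)
      (hin c ⟨hc1.le, le_rfl⟩) ?_
    rw [← hcX, ← hp.1]
    exact hpb
  · obtain ⟨y, hy, hyv, hyb⟩ := hg.exists_boundary_beside hT hzv
    rw [hray] at hyb
    exact h.shift_not_mem_boundary hi hzi (mem_cut_false_of_vtx hzi hy hyv)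
      (hin T ⟨hT.1.le, hcT⟩) hyb

theorem dir_swapXY (i : Fin n) (β : Bool) :
    (P.map swapXY isSym_swapXY).dir i β = swapXY (P.dir i (!β)) := by
  cases β <;> simp [dir, vtx_map, hn_swapXY, vn_swapXY]

theorem ray_swapXY (i : Fin n) (β : Bool) (t : ℝ) :
    (P.map swapXY isSym_swapXY).ray i β t = swapXY (P.ray i (!β) t) := by
  rw [ray_eq, ray_eq, dir_swapXY, vtx_map, map_add, map_smul]

theorem cut_swapXY (i : Fin n) (β : Bool) :
    (P.map swapXY isSym_swapXY).cut i β = swapXY '' P.cut i (!β) := by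
  ext z
  rw [isSym_swapXY.mem_image]
  constructor
  · rintro ⟨t, ht, rfl, h⟩
    refine ⟨t, ht, by rw [ray_swapXY, isSym_swapXY.invol], fun r hr => ?_⟩
    have := (mem_inside_map _).1 (h r hr)
    rwa [ray_swapXY, isSym_swapXY.invol] at this
  · rintro ⟨t, ht, h1, h⟩
    refine ⟨t, ht, by rw [ray_swapXY, ← h1, isSym_swapXY.invol], fun r hr => ?_⟩
    rw [mem_inside_map, ray_swapXY, isSym_swapXY.invol]
    exact h r hr

theorem Thin.turn (h : P.Thin) (hg : P.GeneralPosition) {i j : Fin n} {β γ : Bool}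
    (hi : P.IsReflex i) (hj : P.IsReflex j) {s : Set (ℝ × ℝ)} (hs : s ∈ P.stabbingSegments)
    {z w : ℝ × ℝ} (hz : z ∈ s) (hzi : z ∈ P.cut i β) (hw : w ∈ s) (hwj : w ∈ P.cut j γ)
    (hne : P.cut j γ ≠ P.cut i β) :
    γ = β ∧ ∃ c : ℝ, c < 0 ∧ w = z + c • P.dir i !β := by
  cases β
  · exact h.turn_false hg hi hj hs hz hzi hw hwj hne
  · have hσ := isSym_swapXY
    obtain ⟨h1, c, hc, h2⟩ := (h.map hσ).turn_false (hg.map hσ) (i := i) (j := j) (γ := !γ)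
      ((isReflex_map hσ).2 hi) ((isReflex_map hσ).2 hj) (image_mem_stabbingSegments hσ hs)
      (Set.mem_image_of_mem _ hz) (by rw [cut_swapXY]; exact Set.mem_image_of_mem _ hzi)
      (Set.mem_image_of_mem _ hw)
      (by rw [cut_swapXY, Bool.not_not]; exact Set.mem_image_of_mem _ hwj)
      (by
        rw [cut_swapXY, cut_swapXY, Bool.not_not]
        exact fun h3 => hne (swapXY.injective.image_injective h3))
    refine ⟨by simpa using h1, c, hc, swapXY.injective ?_⟩
    rw [h2, map_add, map_smul, dir_swapXY]

theorem Thin.conflict_unique_false (h : P.Thin) (hg : P.GeneralPosition) {i j k : Fin n}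
    {γ δ : Bool} (hi : P.IsReflex i) (hj : P.IsReflex j) (hk : P.IsReflex k)
    {s s' : Set (ℝ × ℝ)} (hs : s ∈ P.stabbingSegments) (hs' : s' ∈ P.stabbingSegments)
    (hsi : (P.cut i false ∩ s).Nonempty) (hsj : (P.cut j γ ∩ s).Nonempty)
    (hsi' : (P.cut i false ∩ s').Nonempty) (hsk : (P.cut k δ ∩ s').Nonempty)
    (hji : P.cut j γ ≠ P.cut i false) (hki : P.cut k δ ≠ P.cut i false) :
    P.cut j γ = P.cut k δ := by
  obtain ⟨z, hzi, hz⟩ := hsi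
  obtain ⟨w, hwj, hw⟩ := hsj
  obtain ⟨z', hzi', hz'⟩ := hsi'
  obtain ⟨w', hwk, hw'⟩ := hsk
  obtain ⟨rfl, c, hc, hwc⟩ := h.turn hg hi hj hs hz hzi hw hwj hji
  obtain ⟨rfl, c', hc', hwc'⟩ := h.turn hg hi hk hs' hz' hzi' hw' hwk hki
  -- Both partners lie on the same side; let the cut of `j` be the one at most as far away. Then
  -- `s'` passes the abscissa of `w` between `z'` and `w'`.
  wlog hcc : c' ≤ c generalizing j k s s' z w z' w' c c'
  · exact (this hk hj hs' hs z' hzi' hz' w' hw' z hzi hz w hw hki hwk c' hc' hwc' hji hwj c hc hwc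
      (not_le.1 hcc).le).symm
  by_contra hjk
  set X := (P.vtx i).1 - (P.vtx (P.hn i)).1 with hX
  have hX0 : X ≠ 0 := sub_ne_zero.2 (P.vtx_hn_fst_ne i).symm
  have e1 : w.1 = z.1 + c * X := by rw [hwc]; simp [dir, hX]
  have e2 : w.2 = z.2 := by rw [hwc]; simp [dir]
  have e3 : w'.1 = z.1 + c' * X := by
    rw [hwc', fst_of_mem_cut hzi, ← fst_of_mem_cut hzi']; simp [dir, hX]
  have e4 : w'.2 = z'.2 := by rw [hwc']; simp [dir]
  have e5 : z'.1 = z.1 := (fst_of_mem_cut hzi').trans (fst_of_mem_cut hzi).symm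
  have hsub : Set.uIcc z'.1 w.1 ⊆ Set.uIcc z'.1 w'.1 := by
    refine Set.uIcc_subset_uIcc Set.left_mem_uIcc ?_
    rw [e1, e3, e5, Set.mem_uIcc]
    rcases lt_or_gt_of_ne hX0 with h1 | h1
    · left; constructor <;> nlinarith
    · right; constructor <;> nlinarith
  have hps : (w.1, z'.2) ∈ s' :=
    mem_of_mem_stabbingSegments_hor hs' hz' hw' e4.symm (hsub Set.right_mem_uIcc)
  -- If `s'` crosses the cut of `j`, it has conflicts on opposite sides of it, while `Thin.turn`
  -- puts them on the same side. If not, the cut of `j` is stopped by a boundary point beside the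
  -- cut of `i`.
  by_cases hp : (w.1, z'.2) ∈ P.cut j false
  · obtain ⟨-, d, hd, h1⟩ := h.turn hg hj hi hs' hps hp hz' hzi' hji.symm
    obtain ⟨-, d', hd', h2⟩ := h.turn hg hj hk hs' hps hp hw' hwk (Ne.symm hjk)
    have f1 := congrArg Prod.fst h1
    have f2 := congrArg Prod.fst h2
    simp only [Prod.fst_add, Prod.smul_fst, smul_eq_mul] at f1 f2
    set Y := (P.dir j !false).1
    have g1 : d * Y = -c * X := by linarith
    have g2 : d' * Y = (c' - c) * X := by linarith
    have hpos : 0 < d * d' := mul_pos_of_neg_of_neg hd hd'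
    have hY : 0 < Y * Y := by
      refine mul_self_pos.2 fun h3 => ?_
      rw [h3, mul_zero] at g1
      rcases mul_eq_zero.1 g1.symm with h4 | h4
      · linarith
      · exact hX0 h4
    have : 0 < (-c * X) * ((c' - c) * X) := by
      rw [← g1, ← g2]
      nlinarith [mul_pos hpos hY]
    have h5 : (-c * X) * ((c' - c) * X) = (-c * (c' - c)) * (X * X) := by ring
    have h6 : -c * (c' - c) ≤ 0 := mul_nonpos_of_nonneg_of_nonpos (by linarith) (by linarith)
    have h7 : 0 ≤ X * X := mul_self_nonneg X
    nlinarith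
  · have h3 : ∃ p ∈ segment ℝ w (w.1, z'.2), p ∈ P.boundary := by
      by_contra! h4
      exact hp (mem_cut_of_free hwj (by simp) h4)
    obtain ⟨p, hp, hpb⟩ := h3
    rw [show segment ℝ w (w.1, z'.2) = segment ℝ (w.1, w.2) (w.1, z'.2) from rfl,
      mem_segment_vert, e2] at hp
    refine h.shift_not_mem_boundary hi hzi' (b := (z.1, p.2)) (mem_cut_false hzi hzi' hp.2)
      (x := w.1) (fun u hu => ?_) ?_
    · exact subset_inside_of_mem_stabbingSegments hs'
        (mem_of_mem_stabbingSegments_hor hs' hz' hw' e4.symm (hsub hu))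
    · rw [← hp.1]
      exact hpb

/-- Every cut shares stabbing segments with at most one other cut. -/
theorem Thin.conflict_unique (h : P.Thin) (hg : P.GeneralPosition) {ρ ρ₁ ρ₂ : Set (ℝ × ℝ)}
    (hρ : ρ ∈ P.reflexSegments) (hρ₁ : ρ₁ ∈ P.reflexSegments) (hρ₂ : ρ₂ ∈ P.reflexSegments)
    {s s' : Set (ℝ × ℝ)} (hs : s ∈ P.stabbingSegments) (hs' : s' ∈ P.stabbingSegments)
    (h1 : (ρ ∩ s).Nonempty) (h2 : (ρ₁ ∩ s).Nonempty) (h3 : (ρ ∩ s').Nonempty)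
    (h4 : (ρ₂ ∩ s').Nonempty) (h5 : ρ₁ ≠ ρ) (h6 : ρ₂ ≠ ρ) : ρ₁ = ρ₂ := by
  obtain ⟨i, β, hi, rfl⟩ := mem_reflexSegments.1 hρ
  obtain ⟨j, γ, hj, rfl⟩ := mem_reflexSegments.1 hρ₁
  obtain ⟨k, δ, hk, rfl⟩ := mem_reflexSegments.1 hρ₂
  cases β
  · exact h.conflict_unique_false hg hi hj hk hs hs' h1 h2 h3 h4 h5 h6
  · have hσ := isSym_swapXY
    have im : ∀ {i β} {s : Set (ℝ × ℝ)}, (P.cut i β ∩ s).Nonempty →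
        ((P.map swapXY hσ).cut i (!β) ∩ swapXY '' s).Nonempty := by
      intro i β s h7
      rw [cut_swapXY, Bool.not_not, ← Set.image_inter swapXY.injective]
      exact h7.image _
    have ne : ∀ {i β j γ}, P.cut i β ≠ P.cut j γ →
        (P.map swapXY hσ).cut i (!β) ≠ (P.map swapXY hσ).cut j (!γ) := by
      intro i β j γ h7 h8
      rw [cut_swapXY, cut_swapXY, Bool.not_not, Bool.not_not] at h8
      exact h7 (swapXY.injective.image_injective h8)
    by_contra hne
    exact ne hne ((h.map hσ).conflict_unique_false (hg.map hσ) ((isReflex_map hσ).2 hi)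
      ((isReflex_map hσ).2 hj) ((isReflex_map hσ).2 hk) (image_mem_stabbingSegments hσ hs)
      (image_mem_stabbingSegments hσ hs') (im h1) (im h2) (im h3) (im h4) (ne h5) (ne h6))

/-- A stabbing segment of a thin polygon meets at most two reflex segments. -/
theorem Thin.encard_le_two (h : P.Thin) (hg : P.GeneralPosition) {s : Set (ℝ × ℝ)}
    (hs : s ∈ P.stabbingSegments) :
    {r ∈ P.reflexSegments | (r ∩ s).Nonempty}.encard ≤ 2 := by
  by_contra! hlt
  have h3 : (3 : ℕ∞) ≤ {r ∈ P.reflexSegments | (r ∩ s).Nonempty}.encard := by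
    have := Order.add_one_le_of_lt hlt
    simpa [show (2 : ℕ∞) + 1 = 3 by norm_num] using this
  obtain ⟨t, ht, htc⟩ := Set.exists_subset_encard_eq h3
  obtain ⟨x, y, z, hxy, hxz, hyz, rfl⟩ := Set.encard_eq_three.1 htc
  have hx := ht (show x ∈ _ by simp)
  have hy := ht (show y ∈ _ by simp)
  have hz := ht (show z ∈ _ by simp)
  -- Of three reflex segments met by `s`, the first would have the other two as partners.
  exact hyz (h.conflict_unique hg hx.1 hy.1 hz.1 hs hs hx.2 hy.2 hx.2 hz.2 hxy.symm hxz.symm)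

end RectilinearPolygon

/-! ### Generic coordinates, gaps and rectangles. -/

theorem exists_mem_Ioo_notMem {S : Set ℝ} (hS : S.Finite) {a b : ℝ} (h : a < b) :
    ∃ c ∈ Set.Ioo a b, c ∉ S :=
  ((Set.Ioo_infinite h).sdiff hS).nonempty

theorem exists_gap {W : Set ℝ} (hW : IsClosed W) {t a b : ℝ} (ht : t ∉ W) (ha : a ∈ W) (hat : a < t)
    (hb : b ∈ W) (htb : t < b) :
    ∃ l ∈ W, ∃ r ∈ W, l < t ∧ t < r ∧ ∀ x ∈ Set.Ioo l r, x ∉ W := by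
  have n1 : (W ∩ Set.Iic t).Nonempty := ⟨a, ha, hat.le⟩
  have n2 : (W ∩ Set.Ici t).Nonempty := ⟨b, hb, htb.le⟩
  have b1 : BddAbove (W ∩ Set.Iic t) := ⟨t, fun x hx => hx.2⟩
  have b2 : BddBelow (W ∩ Set.Ici t) := ⟨t, fun x hx => hx.2⟩
  have m1 := (hW.inter isClosed_Iic).csSup_mem n1 b1
  have m2 := (hW.inter isClosed_Ici).csInf_mem n2 b2
  refine ⟨_, m1.1, _, m2.1, lt_of_le_of_ne m1.2 fun h => ht (h ▸ m1.1),
    lt_of_le_of_ne m2.2 fun h => ht (h ▸ m2.1), fun x hx hxW => ?_⟩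
  rcases le_total x t with h | h
  · exact (le_csSup b1 ⟨hxW, h⟩).not_gt hx.1
  · exact (csInf_le b2 ⟨hxW, h⟩).not_gt hx.2

namespace AxisRect

theorem isOpen_inner (R : AxisRect) : IsOpen R.inner := isOpen_Ioo.prod isOpen_Ioo

theorem isClosed_carrier (R : AxisRect) : IsClosed R.carrier := isClosed_Icc.prod isClosed_Icc

theorem inner_subset_carrier (R : AxisRect) : R.inner ⊆ R.carrier :=
  Set.prod_mono Set.Ioo_subset_Icc_self Set.Ioo_subset_Icc_self

theorem isPreconnected_inner (R : AxisRect) : IsPreconnected R.inner :=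
  isPreconnected_Ioo.prod isPreconnected_Ioo

theorem closure_inner (R : AxisRect) : closure R.inner = R.carrier := by
  rw [inner, carrier, closure_prod_eq, closure_Ioo R.fst_lt.ne, closure_Ioo R.snd_lt.ne]

theorem lo_hi_injective : Function.Injective fun R : AxisRect => (R.lo, R.hi) := by
  rintro ⟨l, h, _, _⟩ ⟨l', h', _, _⟩ heq
  simpa using heq

theorem inner_injective : Function.Injective inner := by
  intro R R' h
  have h1 : R.carrier = R'.carrier := by rw [← closure_inner, h, closure_inner]
  have e1 := R.fst_lt.le
  have e2 := R.snd_lt.le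
  have e3 := R'.fst_lt.le
  have e4 := R'.snd_lt.le
  rw [carrier, carrier, Set.Icc_prod_Icc, Set.Icc_prod_Icc] at h1
  have h2 := (Set.Icc_eq_Icc_iff (show (R.lo.1, R.lo.2) ≤ (R.hi.1, R.hi.2) from ⟨e1, e2⟩)).1 h1
  exact lo_hi_injective (Prod.ext h2.1 h2.2)

end AxisRect

namespace RectilinearPolygon

variable {n : ℕ} {P : RectilinearPolygon n}

/-! ### The boundary bounds the interior -/

theorem finite_fst (P : RectilinearPolygon n) : (Set.range fun i => (P.vtx i).1).Finite :=
  Set.finite_range _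

theorem finite_snd (P : RectilinearPolygon n) : (Set.range fun i => (P.vtx i).2).Finite :=
  Set.finite_range _

theorem edge_or {z : ℝ × ℝ} (h : z ∈ P.boundary) :
    (∃ i, ¬ P.IsHor i ∧ z ∈ P.edge i ∧ z.1 = (P.vtx i).1) ∨
      ∃ i, P.IsHor i ∧ z ∈ P.edge i ∧ z.2 = (P.vtx i).2 := by
  obtain ⟨i, hi⟩ := Set.mem_iUnion.1 h
  by_cases hor : P.IsHor i
  · exact Or.inr ⟨i, hor, hi, ((RectilinearBoundary.mem_edge_hor hor).1 hi).1⟩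
  · exact Or.inl ⟨i, hor, hi, ((P.alternates.mem_edge_vert hor).1 hi).1⟩

theorem not_mem_boundary_of_generic {z : ℝ × ℝ} (h1 : z.1 ∉ Set.range fun i => (P.vtx i).1)
    (h2 : z.2 ∉ Set.range fun i => (P.vtx i).2) : z ∉ P.boundary := by
  intro h
  rcases edge_or h with ⟨i, -, -, hi⟩ | ⟨i, -, -, hi⟩
  · exact h1 ⟨i, hi.symm⟩
  · exact h2 ⟨i, hi.symm⟩

/-- Crossing the edge at a height that is no vertex ordinate changes the parity, so close to any of
its points one side is inside. -/
theorem vertical_edge_subset_closure {k : Fin n} (hk : ¬ P.IsHor k) :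
    P.edge k ⊆ closure P.inside := by
  intro z hz
  rw [Metric.mem_closure_iff]
  intro ε hε
  have hz' := (P.alternates.mem_edge_vert hk).1 hz
  have ver := (P.alternates.vert_iff k).2 hk
  have hne : (P.vtx k).2 ≠ (P.vtx (P.next k)).2 := fun h => hk h
  obtain ⟨y, hy, hyg, hyε⟩ : ∃ y ∈ Set.Ioo (min (P.vtx k).2 (P.vtx (P.next k)).2)
      (max (P.vtx k).2 (P.vtx (P.next k)).2), (y ∉ Set.range fun i => (P.vtx i).2) ∧
      |z.2 - y| < ε := by
    set l := min (P.vtx k).2 (P.vtx (P.next k)).2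
    set u := max (P.vtx k).2 (P.vtx (P.next k)).2
    have hlu : l < u := min_lt_max.2 hne
    have hzl : l ≤ z.2 := hz'.2.1
    have hzu : z.2 ≤ u := hz'.2.2
    have hlt : max l (z.2 - ε) < min u (z.2 + ε) := by
      rw [max_lt_iff, lt_min_iff, lt_min_iff]
      refine ⟨⟨hlu, ?_⟩, ?_, ?_⟩ <;> linarith
    obtain ⟨y, hy, hyS⟩ := exists_mem_Ioo_notMem P.finite_snd hlt
    rw [Set.mem_Ioo, max_lt_iff, lt_min_iff] at hy
    refine ⟨y, ⟨hy.1.1, hy.2.1⟩, hyS, ?_⟩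
    rw [abs_lt]
    constructor <;> linarith [hy.1.2, hy.2.2]
  -- Within distance `δ` there is no vertex abscissa except that of the edge itself.
  obtain ⟨δ, hδ, hδε, hgap⟩ : ∃ δ : ℝ, 0 < δ ∧ δ < ε ∧
      ∀ i, |(P.vtx i).1 - (P.vtx k).1| ≤ δ → (P.vtx i).1 = (P.vtx k).1 := by
    have hfin : ((Set.range fun i => (P.vtx i).1) \ {(P.vtx k).1}).Finite := P.finite_fst.sdiff
    obtain ⟨δ, hδ, hb⟩ := Metric.isOpen_iff.1 hfin.isClosed.isOpen_compl (P.vtx k).1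
      (fun h => h.2 rfl)
    refine ⟨min δ ε / 2, by positivity, by linarith [min_le_right δ ε], fun i hi => ?_⟩
    by_contra h
    refine hb (?_ : (P.vtx i).1 ∈ _) ⟨⟨i, rfl⟩, h⟩
    rw [Metric.mem_ball, Real.dist_eq]
    refine hi.trans_lt ?_
    have : 0 < min δ ε := by positivity
    linarith [min_le_left δ ε]
  have hsum : P.par ((P.vtx k).1 - δ, y) - P.par ((P.vtx k).1 + δ, y) = 1 := by
    classical
    rw [RectilinearBoundary.par, RectilinearBoundary.par, ← Finset.sum_sub_distrib,
      ← P.alternates.sum_vert, Finset.sum_eq_single k]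
    · rw [if_neg hk, ← ver]
      have h1 : (P.vtx k).1 - δ < (P.vtx k).1 := by linarith
      have h2 : ¬ (P.vtx k).1 + δ < (P.vtx k).1 := by linarith
      rcases lt_or_gt_of_ne hne with h | h
      · rw [min_eq_left h.le, max_eq_right h.le] at hy
        simp [hδ, h2, hy.1.le, hy.2]
      · rw [min_eq_right h.le, max_eq_left h.le] at hy
        simp [hδ, h2, hy.1.le, hy.2]
    · intro j _ hj
      by_cases hor : P.IsHor j
      · simp [hor]
      · have ver' := (P.alternates.vert_iff j).2 hor
        rw [if_neg hor, ← ver']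
        by_cases hx : (P.vtx j).1 = (P.vtx k).1
        · have h3 : ((P.vtx k).1, y) ∉ P.edge j := by
            intro h4
            have h5 : ((P.vtx k).1, y) ∈ P.edge k :=
              (P.alternates.mem_edge_vert hk).2 ⟨rfl, Set.Ioo_subset_Icc_self hy⟩
            rcases P.simple j k hj _ ⟨h4, h5⟩ with h6 | h6
            · exact hyg ⟨k, (congrArg Prod.snd h6.2).symm⟩
            · exact hyg ⟨j, (congrArg Prod.snd h6.2).symm⟩
          rw [P.alternates.mem_edge_vert hor, Set.mem_uIcc] at h3
          have : (P.vtx j).2 ≤ y ↔ (P.vtx (P.next j)).2 ≤ y := by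
            constructor
            · intro h4
              by_contra h5
              exact h3 ⟨hx.symm, Or.inl ⟨h4, (not_le.1 h5).le⟩⟩
            · intro h4
              by_contra h5
              exact h3 ⟨hx.symm, Or.inr ⟨h4, (not_le.1 h5).le⟩⟩
          simp only [this]
          exact CharTwo.add_self_eq_zero _
        · have hx' : ¬ |(P.vtx j).1 - (P.vtx k).1| ≤ δ := fun h => hx (hgap j h)
          have : (P.vtx k).1 - δ < (P.vtx j).1 ↔ (P.vtx k).1 + δ < (P.vtx j).1 := by
            rw [abs_le] at hx'
            constructor
            · intro h
              by_contra h1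
              exact hx' ⟨by linarith, by linarith⟩
            · intro h
              linarith
          simp [this]
    · simp
  have hoff : ∀ x, |x - (P.vtx k).1| = δ → (x, y) ∉ P.boundary := by
    intro x hx
    refine not_mem_boundary_of_generic ?_ hyg
    rintro ⟨i, hi⟩
    dsimp only at hi
    have := hgap i (by rw [hi, hx])
    rw [← hi, this, sub_self, abs_zero] at hx
    exact hδ.ne hx
  have hor : P.par ((P.vtx k).1 - δ, y) = 1 ∨ P.par ((P.vtx k).1 + δ, y) = 1 := by
    revert hsum
    generalize P.par ((P.vtx k).1 - δ, y) = u
    generalize P.par ((P.vtx k).1 + δ, y) = v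
    revert u v
    decide
  have a1 : |(P.vtx k).1 - δ - (P.vtx k).1| = δ := by
    rw [show (P.vtx k).1 - δ - (P.vtx k).1 = -δ by ring, abs_neg, abs_of_pos hδ]
  have a2 : |(P.vtx k).1 + δ - (P.vtx k).1| = δ := by
    rw [show (P.vtx k).1 + δ - (P.vtx k).1 = δ by ring, abs_of_pos hδ]
  rcases hor with h | h
  · refine ⟨_, P.mem_inside.2 ⟨hoff _ a1, h⟩, ?_⟩
    rw [Prod.dist_eq, max_lt_iff, Real.dist_eq, Real.dist_eq]
    exact ⟨by rw [hz'.1, abs_sub_comm, a1]; exact hδε, hyε⟩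
  · refine ⟨_, P.mem_inside.2 ⟨hoff _ a2, h⟩, ?_⟩
    rw [Prod.dist_eq, max_lt_iff, Real.dist_eq, Real.dist_eq]
    exact ⟨by rw [hz'.1, abs_sub_comm, a2]; exact hδε, hyε⟩

theorem boundary_subset_closure_inside : P.boundary ⊆ closure P.inside := by
  intro z hz
  rcases edge_or hz with ⟨i, hi, hiz, -⟩ | ⟨i, hi, hiz, -⟩
  · exact vertical_edge_subset_closure hi hiz
  · have h1 : swapXY z ∈ (P.map swapXY isSym_swapXY).edge i :=
      (RectilinearBoundary.mem_edge_map isSym_swapXY).2 (by rwa [isSym_swapXY.invol])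
    have h2 := vertical_edge_subset_closure (P := P.map swapXY isSym_swapXY)
      (by rw [isHor_swapXY]; exact not_not.2 hi) h1
    have hc : Continuous swapXY :=
      LinearMap.continuous_of_finiteDimensional swapXY.toLinearMap
    have h3 := map_mem_closure hc h2 (t := P.inside) fun w hw => (mem_inside_map _).1 hw
    rwa [isSym_swapXY.invol] at h3

/-! ### Faces -/

/-- The union of the selected cuts, one for each reflex vertex. -/
def cuts (P : RectilinearPolygon n) (f : Fin n → Bool) : Set (ℝ × ℝ) :=
  ⋃ i : {i // P.IsReflex i}, P.cut i (f i)

/-- The interior without the selected cuts. -/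
def openPart (P : RectilinearPolygon n) (f : Fin n → Bool) : Set (ℝ × ℝ) := P.inside \ P.cuts f

/-- The boundary with the selected cuts. -/
def walls (P : RectilinearPolygon n) (f : Fin n → Bool) : Set (ℝ × ℝ) := P.boundary ∪ P.cuts f

variable {f : Fin n → Bool}

theorem mem_cuts {z : ℝ × ℝ} : z ∈ P.cuts f ↔ ∃ i, P.IsReflex i ∧ z ∈ P.cut i (f i) := by
  simp [cuts]

theorem cuts_subset_inside : P.cuts f ⊆ P.inside :=
  Set.iUnion_subset fun _ => cut_subset_inside _ _

/-- A cut lacks only its two end points, and these lie on the boundary. -/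
theorem isClosed_walls : IsClosed (P.walls f) := by
  have h : P.walls f = P.boundary ∪ ⋃ i : {i // P.IsReflex i}, closure (P.cut i (f i)) := by
    refine subset_antisymm (Set.union_subset_union_right _
      (Set.iUnion_mono fun i => subset_closure)) (Set.union_subset Set.subset_union_left ?_)
    refine Set.iUnion_subset fun i => ?_
    obtain ⟨T, hT⟩ := i.2.exists_hits (f i)
    rw [hT.cut_eq, closure_openSegment, ← insert_endpoints_openSegment, ← hT.cut_eq]
    refine Set.insert_subset (Or.inl (P.vtx_mem_boundary _)) (Set.insert_subset (Or.inl hT.2.1) ?_)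
    exact fun z hz => Or.inr (Set.mem_iUnion.2 ⟨i, hz⟩)
  rw [h]
  exact P.isClosed_boundary.union (isClosed_iUnion_of_finite fun i => isClosed_closure)

theorem not_mem_walls {z : ℝ × ℝ} (h : z ∈ P.openPart f) : z ∉ P.walls f := by
  rintro (h1 | h1)
  · exact h.1.1 h1
  · exact h.2 h1

theorem mem_openPart_of_horizontal {x x' y : ℝ} (h : (x, y) ∈ P.openPart f)
    (hf : ∀ t ∈ Set.uIcc x x', (t, y) ∉ P.walls f) : (x', y) ∈ P.openPart f :=
  ⟨P.inside_of_horizontal h.1 fun t ht hb => hf t ht (Or.inl hb),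
    fun hc => hf x' Set.right_mem_uIcc (Or.inr hc)⟩

theorem mem_openPart_of_vertical {x y y' : ℝ} (h : (x, y) ∈ P.openPart f)
    (hf : ∀ t ∈ Set.uIcc y y', (x, t) ∉ P.walls f) : (x, y') ∈ P.openPart f :=
  ⟨P.inside_of_vertical h.1 fun t ht hb => hf t ht (Or.inl hb),
    fun hc => hf y' Set.right_mem_uIcc (Or.inr hc)⟩

/-- If two sides of a box avoid the walls, so does the opposite corner. -/
theorem not_mem_walls_of_corner {q z : ℝ × ℝ}
    (hh : ∀ x ∈ Set.uIcc q.1 z.1, (x, q.2) ∈ P.openPart f)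
    (hv : ∀ y ∈ Set.uIcc q.2 z.2, (q.1, y) ∈ P.openPart f) : z ∉ P.walls f := by
  -- This is why one cut per reflex vertex suffices: both cuts from the corner lemma cross an arm,
  -- so whichever is selected puts a wall there.
  have key : ∀ w ∈ P.boundary, w.1 ∈ Set.uIcc q.1 z.1 → w.2 ∈ Set.uIcc q.2 z.2 → False := by
    intro w hw h1 h2
    have s1 : Set.uIcc q.1 w.1 ⊆ Set.uIcc q.1 z.1 := Set.uIcc_subset_uIcc Set.left_mem_uIcc h1
    have s2 : Set.uIcc q.2 w.2 ⊆ Set.uIcc q.2 z.2 := Set.uIcc_subset_uIcc Set.left_mem_uIcc h2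
    obtain ⟨i, hi, i1, i2, i3, i4⟩ := exists_reflex_corner hw (fun x hx => (hh x (s1 hx)).1)
      (fun y hy => (hv y (s2 hy)).1)
    cases hf : f i
    · exact (hh _ (s1 i1)).2 (mem_cuts.2 ⟨i, hi, by rwa [hf]⟩)
    · exact (hv _ (s2 i2)).2 (mem_cuts.2 ⟨i, hi, by rwa [hf]⟩)
  rintro (h | h)
  · exact key z h Set.right_mem_uIcc Set.right_mem_uIcc
  -- A selected cut through `z` either reaches an arm, which is excluded, or is stopped by a
  -- boundary point of the box, which `key` excludes.
  · obtain ⟨i, hi, hc⟩ := mem_cuts.1 h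
    cases hf : f i
    · rw [hf] at hc
      have h1 : (z.1, q.2) ∉ P.cut i false := fun h2 =>
        (hh _ Set.right_mem_uIcc).2 (mem_cuts.2 ⟨i, hi, by rwa [hf]⟩)
      have h3 : ∃ p ∈ segment ℝ z (z.1, q.2), p ∈ P.boundary := by
        by_contra! h4
        exact h1 (mem_cut_of_free hc (by simp) h4)
      obtain ⟨p, hp, hpb⟩ := h3
      rw [show segment ℝ z (z.1, q.2) = segment ℝ (z.1, z.2) (z.1, q.2) from rfl,
        mem_segment_vert, Set.uIcc_comm] at hp
      exact key p hpb (hp.1 ▸ Set.right_mem_uIcc) hp.2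
    · rw [hf] at hc
      have h1 : (q.1, z.2) ∉ P.cut i true := fun h2 =>
        (hv _ Set.right_mem_uIcc).2 (mem_cuts.2 ⟨i, hi, by rwa [hf]⟩)
      have h3 : ∃ p ∈ segment ℝ z (q.1, z.2), p ∈ P.boundary := by
        by_contra! h4
        exact h1 (mem_cut_of_free hc (by simp) h4)
      obtain ⟨p, hp, hpb⟩ := h3
      rw [show segment ℝ z (q.1, z.2) = segment ℝ (z.1, z.2) (q.1, z.2) from rfl,
        mem_segment_hor, Set.uIcc_comm] at hp
      exact key p hpb hp.2 (hp.1 ▸ Set.right_mem_uIcc)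

theorem mem_openPart_of_corner {q z : ℝ × ℝ}
    (hh : ∀ x ∈ Set.uIcc q.1 z.1, (x, q.2) ∈ P.openPart f)
    (hv : ∀ y ∈ Set.uIcc q.2 z.2, (q.1, y) ∈ P.openPart f) : z ∈ P.openPart f :=
  mem_openPart_of_vertical (hh z.1 Set.right_mem_uIcc) fun t ht =>
    not_mem_walls_of_corner (z := (z.1, t)) hh fun y hy =>
      hv y (Set.uIcc_subset_uIcc Set.left_mem_uIcc ht hy)

theorem exists_boundary_hor {z : ℝ × ℝ} (hz : z ∈ P.inside) :
    (∃ a < z.1, (a, z.2) ∈ P.boundary) ∧ ∃ b > z.1, (b, z.2) ∈ P.boundary := by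
  obtain ⟨M, hM⟩ := P.inside_bounded
  have h1 := abs_le.1 (hM z hz).1
  have key : ∀ x, M < |x| → ∃ t ∈ Set.uIcc z.1 x, (t, z.2) ∈ P.boundary := by
    intro x hx
    by_contra! h
    exact (hM _ (P.inside_of_horizontal hz h)).1.not_gt hx
  have hne : ∀ t, (t, z.2) ∈ P.boundary → t ≠ z.1 := by
    rintro t ht rfl
    exact hz.1 ht
  constructor
  · obtain ⟨t, ht, hb⟩ := key (-(M + 1)) (by rw [abs_neg]; exact (lt_add_one M).trans_le (le_abs_self _))
    rw [Set.uIcc_of_ge (by linarith)] at ht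
    exact ⟨t, lt_of_le_of_ne ht.2 (hne t hb), hb⟩
  · obtain ⟨t, ht, hb⟩ := key (M + 1) ((lt_add_one M).trans_le (le_abs_self _))
    rw [Set.uIcc_of_le (by linarith)] at ht
    exact ⟨t, lt_of_le_of_ne ht.1 (hne t hb).symm, hb⟩

theorem exists_boundary_vert {z : ℝ × ℝ} (hz : z ∈ P.inside) :
    (∃ a < z.2, (z.1, a) ∈ P.boundary) ∧ ∃ b > z.2, (z.1, b) ∈ P.boundary := by
  have h := exists_boundary_hor (P := P.map swapXY isSym_swapXY) (z := swapXY z)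
    ((mem_inside_map _).2 (by rwa [isSym_swapXY.invol]))
  simpa only [mem_boundary_map, swapXY_apply] using h

/-- A face: an open rectangle without walls, framed by walls. -/
def IsFace (P : RectilinearPolygon n) (f : Fin n → Bool) (R : AxisRect) : Prop :=
  R.inner ⊆ P.openPart f ∧ R.carrier \ R.inner ⊆ P.walls f

/-- The wall-free intervals around `z` in its row and its column span the rectangle. The corner
argument for walls shows that its interior is free, and also that each side consists of walls, since
a gap in a side would free the wall in the row or column of `z`. -/
theorem exists_isFace {z : ℝ × ℝ} (hz : z ∈ P.openPart f) : ∃ R, P.IsFace f R ∧ z ∈ R.inner := by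
  obtain ⟨⟨a, ha, hab⟩, b, hb, hbb⟩ := exists_boundary_hor hz.1
  obtain ⟨⟨c, hc, hcb⟩, d, hd, hdb⟩ := exists_boundary_vert hz.1
  have hzw := not_mem_walls hz
  obtain ⟨xl, hxl, xr, hxr, hxlz, hxrz, hxf⟩ := exists_gap
    (W := {x | (x, z.2) ∈ P.walls f}) (isClosed_walls.preimage (by fun_prop)) hzw
    (Or.inl hab) ha (Or.inl hbb) hb
  obtain ⟨yl, hyl, yr, hyr, hylz, hyrz, hyf⟩ := exists_gap
    (W := {y | (z.1, y) ∈ P.walls f}) (isClosed_walls.preimage (by fun_prop)) hzw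
    (Or.inl hcb) hc (Or.inl hdb) hd
  have sub : ∀ {l r t u : ℝ}, t ∈ Set.Ioo l r → u ∈ Set.Ioo l r → Set.uIcc t u ⊆ Set.Ioo l r := by
    intro l r t u ht hu v hv
    rcases Set.mem_uIcc.1 hv with h | h
    · exact ⟨ht.1.trans_le h.1, h.2.trans_lt hu.2⟩
    · exact ⟨hu.1.trans_le h.1, h.2.trans_lt ht.2⟩
  have hx0 : z.1 ∈ Set.Ioo xl xr := ⟨hxlz, hxrz⟩
  have hy0 : z.2 ∈ Set.Ioo yl yr := ⟨hylz, hyrz⟩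
  have hxo : ∀ x ∈ Set.Ioo xl xr, (x, z.2) ∈ P.openPart f := fun x hx =>
    mem_openPart_of_horizontal (x := z.1) hz fun t ht => hxf t (sub hx0 hx ht)
  have hyo : ∀ y ∈ Set.Ioo yl yr, (z.1, y) ∈ P.openPart f := fun y hy =>
    mem_openPart_of_vertical (y := z.2) hz fun t ht => hyf t (sub hy0 hy ht)
  have hin : ∀ x ∈ Set.Ioo xl xr, ∀ y ∈ Set.Ioo yl yr, (x, y) ∈ P.openPart f := fun x hx y hy =>
    mem_openPart_of_corner (q := z) (z := (x, y)) (fun t ht => hxo t (sub hx0 hx ht))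
      (fun t ht => hyo t (sub hy0 hy ht))
  -- The negative product says that `x` is strictly between `e` and `z.1`, which treats the left and
  -- the right side together.
  have sidex : ∀ e, (e, z.2) ∈ P.walls f → (∀ x, (x - e) * (x - z.1) < 0 → x ∈ Set.Ioo xl xr) →
      e ≠ z.1 → ∀ y ∈ Set.Ioo yl yr, (e, y) ∈ P.walls f := by
    intro e he hbt hne y hy
    by_contra hcon
    have hbtw : ∀ t ∈ Set.uIcc z.1 e, t ≠ e → t ∈ Set.Ioo xl xr := by
      intro t ht hte
      by_cases htz : t = z.1
      · rwa [htz]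
      · refine hbt t ?_
        rcases Set.mem_uIcc.1 ht with h | h
        · have h1 : t < e := lt_of_le_of_ne h.2 hte
          have h2 : z.1 < t := lt_of_le_of_ne h.1 (Ne.symm htz)
          nlinarith
        · have h1 : e < t := lt_of_le_of_ne h.1 (Ne.symm hte)
          have h2 : t < z.1 := lt_of_le_of_ne h.2 htz
          nlinarith
    have hrow : ∀ t ∈ Set.uIcc z.1 e, (t, y) ∉ P.walls f := by
      intro t ht
      by_cases hte : t = e
      · rwa [hte]
      · exact not_mem_walls (hin t (hbtw t ht hte) y hy)
    refine not_mem_walls_of_corner (q := (z.1, y)) (z := (e, z.2)) (f := f) ?_ ?_ he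
    · intro x hx
      exact mem_openPart_of_horizontal (hin _ hx0 y hy) fun t ht =>
        hrow t (Set.uIcc_subset_uIcc Set.left_mem_uIcc hx ht)
    · intro t ht
      exact hyo t (sub hy hy0 ht)
  have sidey : ∀ e, (z.1, e) ∈ P.walls f → (∀ y, (y - e) * (y - z.2) < 0 → y ∈ Set.Ioo yl yr) →
      e ≠ z.2 → ∀ x ∈ Set.Ioo xl xr, (x, e) ∈ P.walls f := by
    intro e he hbt hne x hx
    by_contra hcon
    have hbtw : ∀ t ∈ Set.uIcc z.2 e, t ≠ e → t ∈ Set.Ioo yl yr := by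
      intro t ht hte
      by_cases htz : t = z.2
      · rwa [htz]
      · refine hbt t ?_
        rcases Set.mem_uIcc.1 ht with h | h
        · have h1 : t < e := lt_of_le_of_ne h.2 hte
          have h2 : z.2 < t := lt_of_le_of_ne h.1 (Ne.symm htz)
          nlinarith
        · have h1 : e < t := lt_of_le_of_ne h.1 (Ne.symm hte)
          have h2 : t < z.2 := lt_of_le_of_ne h.2 htz
          nlinarith
    have hcol : ∀ t ∈ Set.uIcc z.2 e, (x, t) ∉ P.walls f := by
      intro t ht
      by_cases hte : t = e
      · rwa [hte]
      · exact not_mem_walls (hin x hx t (hbtw t ht hte))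
    refine not_mem_walls_of_corner (q := (x, z.2)) (z := (z.1, e)) (f := f) ?_ ?_ he
    · intro t ht
      exact hxo t (sub hx hx0 ht)
    · intro y hy
      exact mem_openPart_of_vertical (hin x hx _ hy0) fun t ht =>
        hcol t (Set.uIcc_subset_uIcc Set.left_mem_uIcc hy ht)
  have clx : ∀ e, (∀ y ∈ Set.Ioo yl yr, (e, y) ∈ P.walls f) →
      ∀ y ∈ Set.Icc yl yr, (e, y) ∈ P.walls f := by
    intro e he y hy
    rw [← closure_Ioo (hylz.trans hyrz).ne] at hy
    exact (isClosed_walls.preimage (f := fun y : ℝ => (e, y)) (by fun_prop)).closure_subset_iff.2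
      he hy
  have cly : ∀ e, (∀ x ∈ Set.Ioo xl xr, (x, e) ∈ P.walls f) →
      ∀ x ∈ Set.Icc xl xr, (x, e) ∈ P.walls f := by
    intro e he x hx
    rw [← closure_Ioo (hxlz.trans hxrz).ne] at hx
    exact (isClosed_walls.preimage (f := fun x : ℝ => (x, e)) (by fun_prop)).closure_subset_iff.2
      he hx
  have L := clx xl (sidex xl hxl (fun x hx => by constructor <;> nlinarith) hxlz.ne)
  have Rt := clx xr (sidex xr hxr (fun x hx => by constructor <;> nlinarith) hxrz.ne')
  have B := cly yl (sidey yl hyl (fun x hx => by constructor <;> nlinarith) hylz.ne)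
  have Tp := cly yr (sidey yr hyr (fun x hx => by constructor <;> nlinarith) hyrz.ne')
  refine ⟨⟨(xl, yl), (xr, yr), hxlz.trans hxrz, hylz.trans hyrz⟩, ⟨?_, ?_⟩, hx0, hy0⟩
  · rintro ⟨x, y⟩ ⟨hx, hy⟩
    exact hin x hx y hy
  · rintro ⟨x, y⟩ ⟨⟨hx, hy⟩, hn⟩
    dsimp only at hx hy
    rcases hx.1.eq_or_lt with h1 | h1
    · rw [← h1]; exact L y hy
    rcases hx.2.eq_or_lt with h2 | h2
    · rw [h2]; exact Rt y hy
    rcases hy.1.eq_or_lt with h3 | h3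
    · rw [← h3]; exact B x hx
    rcases hy.2.eq_or_lt with h4 | h4
    · rw [h4]; exact Tp x hx
    exact absurd ⟨⟨h1, h2⟩, h3, h4⟩ hn

/-- The frame of a face consists of walls and separates its interior from the complement, so a
connected set without walls cannot leave. -/
theorem IsFace.subset {R : AxisRect} (hR : P.IsFace f R) {S : Set (ℝ × ℝ)} (hS : IsPreconnected S)
    (hSo : S ⊆ P.openPart f) (h : (S ∩ R.inner).Nonempty) : S ⊆ R.inner := by
  refine hS.subset_left_of_subset_union R.isOpen_inner R.isClosed_carrier.isOpen_compl ?_ ?_ h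
  · exact Set.disjoint_left.2 fun z hz hz' => hz' (R.inner_subset_carrier hz)
  · intro z hz
    by_contra hcon
    rw [Set.mem_union, not_or, Set.mem_compl_iff, not_not] at hcon
    exact not_mem_walls (hSo hz) (hR.2 ⟨hcon.2, hcon.1⟩)

theorem IsFace.eq {R R' : AxisRect} (hR : P.IsFace f R) (hR' : P.IsFace f R') {z : ℝ × ℝ}
    (h : z ∈ R.inner) (h' : z ∈ R'.inner) : R = R' := by
  apply AxisRect.inner_injective
  exact subset_antisymm (hR'.subset R.isPreconnected_inner hR.1 ⟨z, h, h'⟩)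
    (hR.subset R'.isPreconnected_inner hR'.1 ⟨z, h', h⟩)

theorem walls_generic {z : ℝ × ℝ} (h : z ∈ P.walls f) :
    z.1 ∈ (Set.range fun i => (P.vtx i).1) ∨ z.2 ∈ Set.range fun i => (P.vtx i).2 := by
  rcases h with h | h
  · by_contra! hcon
    exact not_mem_boundary_of_generic hcon.1 hcon.2 h
  · obtain ⟨i, hi, hc⟩ := mem_cuts.1 h
    cases hf : f i <;> rw [hf] at hc
    · exact Or.inl ⟨i, (fst_of_mem_cut hc).symm⟩
    · exact Or.inr ⟨i, (snd_of_mem_cut hc).symm⟩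

/-- Testing each side of a face at a generic point shows that it lies on the line of a vertex
coordinate, and there are finitely many such lines. -/
theorem finite_isFace : {R | P.IsFace f R}.Finite := by
  set X := Set.range fun i => (P.vtx i).1 with hX
  set Y := Set.range fun i => (P.vtx i).2 with hY
  have hXf : X.Finite := P.finite_fst
  have hYf : Y.Finite := P.finite_snd
  have hfin : ((X ×ˢ Y) ×ˢ (X ×ˢ Y)).Finite := (hXf.prod hYf).prod (hXf.prod hYf)
  refine (hfin.preimage (AxisRect.lo_hi_injective.injOn)).subset fun R hR => ?_
  obtain ⟨y, hy, hyY⟩ := exists_mem_Ioo_notMem hYf R.snd_lt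
  obtain ⟨x, hx, hxX⟩ := exists_mem_Ioo_notMem hXf R.fst_lt
  have w1 : (R.lo.1, y) ∈ P.walls f := hR.2 ⟨⟨⟨le_rfl, R.fst_lt.le⟩, hy.1.le, hy.2.le⟩,
    fun h => lt_irrefl _ h.1.1⟩
  have w2 : (R.hi.1, y) ∈ P.walls f := hR.2 ⟨⟨⟨R.fst_lt.le, le_rfl⟩, hy.1.le, hy.2.le⟩,
    fun h => lt_irrefl _ h.1.2⟩
  have w3 : (x, R.lo.2) ∈ P.walls f := hR.2 ⟨⟨⟨hx.1.le, hx.2.le⟩, le_rfl, R.snd_lt.le⟩,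
    fun h => lt_irrefl _ h.2.1⟩
  have w4 : (x, R.hi.2) ∈ P.walls f := hR.2 ⟨⟨⟨hx.1.le, hx.2.le⟩, R.snd_lt.le, le_rfl⟩,
    fun h => lt_irrefl _ h.2.2⟩
  exact ⟨⟨(walls_generic w1).resolve_right hyY, (walls_generic w3).resolve_left hxX⟩,
    (walls_generic w2).resolve_right hyY, (walls_generic w4).resolve_left hxX⟩

theorem region_subset_closure : P.region ⊆ closure (P.openPart f) := by
  have h : P.inside ⊆ closure (P.openPart f) := by
    intro z hz
    rw [Metric.mem_closure_iff]
    intro ε hε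
    obtain ⟨δ, hδ, hb⟩ := Metric.isOpen_iff.1 P.isOpen_inside z hz
    have hm : 0 < min δ ε := lt_min hδ hε
    obtain ⟨x, hx, hxX⟩ := exists_mem_Ioo_notMem P.finite_fst (show z.1 < z.1 + min δ ε by linarith)
    obtain ⟨y, hy, hyY⟩ := exists_mem_Ioo_notMem P.finite_snd (show z.2 < z.2 + min δ ε by linarith)
    have hd : dist z (x, y) < min δ ε := by
      rw [Prod.dist_eq, max_lt_iff, Real.dist_eq, Real.dist_eq, abs_lt, abs_lt]
      refine ⟨⟨?_, ?_⟩, ?_, ?_⟩ <;> linarith [hx.1, hx.2, hy.1, hy.2]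
    refine ⟨(x, y), ⟨hb ?_, fun hc => ?_⟩, hd.trans_le (min_le_right _ _)⟩
    · rw [Metric.mem_ball, dist_comm]
      exact hd.trans_le (min_le_left _ _)
    · rcases walls_generic (Or.inr hc : _ ∈ P.walls f) with h1 | h1
      · exact hxX h1
      · exact hyY h1
  refine Set.union_subset h fun z hz => ?_
  exact closure_minimal h isClosed_closure (boundary_subset_closure_inside hz)

/-- The partition of the polygon into its faces. -/
noncomputable def faces (P : RectilinearPolygon n) (f : Fin n → Bool) : Finset AxisRect :=
  (finite_isFace (P := P) (f := f)).toFinset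

theorem mem_faces {R : AxisRect} : R ∈ P.faces f ↔ P.IsFace f R := by
  simp [faces]

theorem isRectPartition_faces : P.IsRectPartition (P.faces f) := by
  constructor
  · apply subset_antisymm
    · intro z hz
      simp only [Set.mem_iUnion, mem_faces] at hz
      obtain ⟨R, hR, hz⟩ := hz
      by_cases h : z ∈ R.inner
      · exact Or.inl (hR.1 h).1
      · rcases hR.2 ⟨hz, h⟩ with h1 | h1
        · exact Or.inr h1
        · exact Or.inl (cuts_subset_inside h1)
    · refine region_subset_closure.trans (closure_minimal (t := ⋃ R ∈ P.faces f, R.carrier)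
        (s := P.openPart f) (fun z hz => ?_) ?_)
      · obtain ⟨R, hR, hzR⟩ := exists_isFace hz
        exact Set.mem_biUnion (mem_faces.2 hR) (R.inner_subset_carrier hzR)
      · exact (P.faces f).finite_toSet.isClosed_biUnion fun R _ => R.isClosed_carrier
  · intro R hR R' hR' hne
    refine Set.disjoint_left.2 fun z hz hz' => hne ?_
    exact (mem_faces.1 hR).eq (mem_faces.1 hR') hz hz'

theorem subsingleton_faces {S : Set (ℝ × ℝ)} (hS : IsPreconnected S) (hSo : S ⊆ P.openPart f) :
    {R | R ∈ P.faces f ∧ (R.inner ∩ S).Nonempty}.Subsingleton := by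
  rintro R ⟨hR, z, hz, hzS⟩ R' ⟨hR', z', hz', hzS'⟩
  rw [mem_faces] at hR hR'
  exact hR.eq hR' hz (hR'.subset hS hSo ⟨z', hzS', hz'⟩ hzS)

theorem stabCount_faces_le_one {s : Set (ℝ × ℝ)} (hs : s ∈ P.stabbingSegments)
    (h : ∀ z ∈ s, z ∉ P.cuts f) : stabCount (P.faces f) s ≤ 1 := by
  have h1 := subsingleton_faces (f := f) (convex_of_mem_stabbingSegments hs).isPreconnected
    fun z hz => ⟨subset_inside_of_mem_stabbingSegments hs hz, h z hz⟩
  exact (Set.ncard_le_one h1.finite).2 fun _ ha _ hb => h1 ha hb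

/-- A segment inside the cuts meets no open face. Otherwise removing the single crossing point
leaves at most two connected pieces, each within one face. -/
theorem stabCount_faces_le_two {s : Set (ℝ × ℝ)} (hs : s ∈ P.stabbingSegments)
    (h : s ⊆ P.cuts f ∨ (s ∩ P.cuts f).Subsingleton) : stabCount (P.faces f) s ≤ 2 := by
  rcases h with h | h
  · have : {R | R ∈ P.faces f ∧ (R.inner ∩ s).Nonempty} = ∅ := by
      rw [Set.eq_empty_iff_forall_notMem]
      rintro R ⟨hR, z, hz, hzs⟩
      exact ((mem_faces.1 hR).1 hz).2 (h hzs)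
    rw [stabCount, this, Set.ncard_empty]
    exact Nat.zero_le _
  by_cases hp : ∃ p ∈ s, p ∈ P.cuts f
  swap
  · push Not at hp
    exact (stabCount_faces_le_one hs hp).trans one_le_two
  obtain ⟨p, hps, hpc⟩ := hp
  have hsin := subset_inside_of_mem_stabbingSegments hs
  obtain ⟨a, b, hab, rfl⟩ := hs
  rw [openSegment_eq_image_lineMap] at *
  obtain ⟨t, ht, rfl⟩ := hps
  set L := AffineMap.lineMap (k := ℝ) a b with hL
  have hLi : Function.Injective L := AffineMap.lineMap_injective ℝ hab.1
  have hLc : Continuous L := AffineMap.lineMap_continuous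
  have hopen : ∀ u ∈ Set.Ioo (0 : ℝ) 1, u ≠ t → L u ∈ P.openPart f := fun u hu hut =>
    ⟨hsin ⟨u, hu, rfl⟩, fun hc => hut (hLi (h ⟨⟨u, hu, rfl⟩, hc⟩ ⟨⟨t, ht, rfl⟩, hpc⟩))⟩
  have s1 := subsingleton_faces (P := P) (f := f) (isPreconnected_Ioo.image L hLc.continuousOn)
    (S := L '' Set.Ioo 0 t) (by
      rintro _ ⟨u, hu, rfl⟩
      exact hopen u ⟨hu.1, hu.2.trans ht.2⟩ hu.2.ne)
  have s2 := subsingleton_faces (P := P) (f := f) (isPreconnected_Ioo.image L hLc.continuousOn)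
    (S := L '' Set.Ioo t 1) (by
      rintro _ ⟨u, hu, rfl⟩
      exact hopen u ⟨ht.1.trans hu.1, hu.2⟩ hu.1.ne')
  have hsub : {R | R ∈ P.faces f ∧ (R.inner ∩ L '' Set.Ioo 0 1).Nonempty} ⊆
      {R | R ∈ P.faces f ∧ (R.inner ∩ L '' Set.Ioo 0 t).Nonempty} ∪
        {R | R ∈ P.faces f ∧ (R.inner ∩ L '' Set.Ioo t 1).Nonempty} := by
    rintro R ⟨hR, _, hz, u, hu, rfl⟩
    rcases lt_trichotomy u t with h1 | h1 | h1
    · exact Or.inl ⟨hR, _, hz, u, ⟨hu.1, h1⟩, rfl⟩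
    · subst h1
      exact absurd hpc ((mem_faces.1 hR).1 hz).2
    · exact Or.inr ⟨hR, _, hz, u, ⟨h1, hu.2⟩, rfl⟩
  calc _ ≤ _ := Set.ncard_le_ncard hsub (s1.finite.union s2.finite)
    _ ≤ _ := Set.ncard_union_le _ _
    _ ≤ 1 + 1 := Nat.add_le_add ((Set.ncard_le_one s1.finite).2 fun _ ha _ hb => s1 ha hb)
        ((Set.ncard_le_one s2.finite).2 fun _ ha _ hb => s2 ha hb)

end RectilinearPolygon

/-! ### Selection by Hall's theorem. -/

/-- A relation on `ι × Bool` in which every element is related to at most one other element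
admits a selection of one pair over each index without related pairs. -/
theorem exists_unrelated_choice {ι : Type*} [Fintype ι] [DecidableEq ι]
    (r : ι × Bool → ι × Bool → Prop) (hsymm : ∀ e e', r e e' → r e' e)
    (huniq : ∀ e e₁ e₂, r e e₁ → r e e₂ → e₁ ≠ e → e₂ ≠ e → e₁ = e₂) :
    ∃ f : ι → Bool, ∀ i j, i ≠ j → ¬ r (i, f i) (j, f j) := by
  classical
  set cl : ι × Bool → Finset (ι × Bool) := fun e => Finset.univ.filter fun e' => e' = e ∨ r e e'
  have mem_cl : ∀ {e e'}, e' ∈ cl e ↔ e' = e ∨ r e e' := by intro e e'; simp [cl]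
  have card_cl : ∀ e, (cl e).card ≤ 2 := by
    intro e
    have h1 : ((cl e).erase e).card ≤ 1 := by
      refine Finset.card_le_one.2 fun a ha b hb => ?_
      rw [Finset.mem_erase, mem_cl] at ha hb
      exact huniq e a b (ha.2.resolve_left ha.1) (hb.2.resolve_left hb.1) ha.1 hb.1
    have h2 := Finset.card_erase_add_one (s := cl e) (a := e) (mem_cl.2 (Or.inl rfl))
    omega
  -- Hall's condition: the pairs over `S` number twice the size of `S`, and each class arises from
  -- at most two pairs because it contains every pair that gives rise to it.
  obtain ⟨g, hg, hgm⟩ := (Finset.all_card_le_biUnion_card_iff_exists_injective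
    (fun i => Finset.univ.image fun β : Bool => cl (i, β))).1 (by
      intro S
      have himg : (S ×ˢ (Finset.univ : Finset Bool)).image cl =
          S.biUnion fun i => Finset.univ.image fun β : Bool => cl (i, β) := by
        ext x
        simp only [Finset.mem_image, Finset.mem_product, Finset.mem_univ, and_true,
          Finset.mem_biUnion, true_and, Prod.exists]
        constructor
        · rintro ⟨i, β, hi, h⟩; exact ⟨i, hi, β, h⟩
        · rintro ⟨i, hi, β, h⟩; exact ⟨i, β, hi, h⟩
      have h := Finset.card_le_mul_card_image (f := cl) (S ×ˢ (Finset.univ : Finset Bool)) 2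
        (fun x hx => by
          obtain ⟨e, -, rfl⟩ := Finset.mem_image.1 hx
          refine (Finset.card_le_card fun a ha => ?_).trans (card_cl e)
          rw [← (Finset.mem_filter.1 ha).2]
          exact mem_cl.2 (Or.inl rfl))
      rw [himg, Finset.card_product, Finset.card_univ, Fintype.card_bool] at h
      omega)
  have hf : ∀ i, ∃ β, cl (i, β) = g i := fun i => by simpa [eq_comm, or_comm] using hgm i
  choose f hf using hf
  refine ⟨f, fun i j hij hr => hij (hg ?_)⟩
  have hne : (i, f i) ≠ (j, f j) := fun h => hij (congrArg Prod.fst h)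
  -- Related pairs have the same class, which injectivity of `g` rules out for distinct indices.
  rw [← hf, ← hf]
  ext e
  rw [mem_cl, mem_cl]
  constructor
  · rintro (rfl | h)
    · exact Or.inr (hsymm _ _ hr)
    · by_cases he : e = (i, f i)
      · exact Or.inr (he ▸ hsymm _ _ hr)
      · exact Or.inl (huniq _ _ _ h hr he hne.symm)
  · rintro (rfl | h)
    · exact Or.inr hr
    · by_cases he : e = (j, f j)
      · exact Or.inr (he ▸ hr)
      · exact Or.inl (huniq _ _ _ h (hsymm _ _ hr) he hne)

namespace RectilinearPolygon

variable {n : ℕ} {P : RectilinearPolygon n}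

theorem IsStab.mem_stabbingSegments {a b : ℝ × ℝ} (h : P.IsStab a b) :
    openSegment ℝ a b ∈ P.stabbingSegments := ⟨a, b, h, rfl⟩

/-! ### Upper bounds -/

/-- A cut shared by two vertices would put both of them and the neighbour of `i` on one line.
Distinct pairs thus have distinct cuts, as the selection requires. -/
theorem GeneralPosition.cut_injective (h : P.GeneralPosition) {i j : Fin n} {β γ : Bool}
    (hi : P.IsReflex i) (hj : P.IsReflex j) (heq : P.cut i β = P.cut j γ) : i = j ∧ β = γ := by
  have hβ : β = γ := by
    cases β <;> cases γ
    · rfl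
    · exact absurd heq.symm hj.cut_ne
    · exact absurd heq hi.cut_ne
    · rfl
  subst hβ
  refine ⟨?_, rfl⟩
  by_contra hij
  obtain ⟨T, hT⟩ := hi.exists_hits β
  obtain ⟨T', hT'⟩ := hj.exists_hits β
  have hmem : P.vtx j ∈ segment ℝ (P.ray i β 0) (P.ray i β T) := by
    rw [ray_zero, ← closure_openSegment, ← hT.cut_eq, heq, hT'.cut_eq, closure_openSegment]
    exact left_mem_segment ℝ _ _
  obtain ⟨r, hr, hjr⟩ := exists_of_mem_segment_ray hmem
  rw [Set.uIcc_of_le hT.1.le] at hr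
  have hr0 : 0 < r := by
    refine lt_of_le_of_ne hr.1 ?_
    rintro rfl
    rw [ray_zero] at hjr
    exact hij (P.vtx_injective hjr.symm)
  cases β
  · have hjv : P.vn i ≠ j := by
      intro h1
      rw [← h1] at hjr
      have h2 : P.vtx (P.vn i) = P.ray i false (-1) := by
        ext <;> simp [ray, frame, P.vtx_vn_fst]
      have := ray_injective P (h2.symm.trans hjr)
      linarith
    exact (h i (P.vn i) j (P.vn_ne i).symm hjv hij).1
      ⟨(P.vtx_vn_fst i).symm, by rw [P.vtx_vn_fst, hjr, ray_false_fst]⟩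
  · have hjv : P.hn i ≠ j := by
      intro h1
      rw [← h1] at hjr
      have h2 : P.vtx (P.hn i) = P.ray i true (-1) := by
        ext <;> simp [ray, frame, P.vtx_hn_snd]
      have := ray_injective P (h2.symm.trans hjr)
      linarith
    exact (h i (P.hn i) j (P.hn_ne i).symm hjv hij).2
      ⟨(P.vtx_hn_snd i).symm, by rw [P.vtx_hn_snd, hjr, ray_true_snd]⟩

/-- In a thin polygon one can select one cut for each reflex vertex such that no stabbing segment
meets two of them. -/
theorem Thin.exists_selection (h : P.Thin) (hg : P.GeneralPosition) :
    ∃ f : Fin n → Bool, ∀ i j, P.IsReflex i → P.IsReflex j → i ≠ j → ∀ s ∈ P.stabbingSegments,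
      (P.cut i (f i) ∩ s).Nonempty → (P.cut j (f j) ∩ s).Nonempty → False := by
  classical
  obtain ⟨f, hf⟩ := exists_unrelated_choice (ι := {i // P.IsReflex i})
    (fun e e' => ∃ s ∈ P.stabbingSegments, (P.cut e.1 e.2 ∩ s).Nonempty ∧
      (P.cut e'.1 e'.2 ∩ s).Nonempty)
    (fun e e' ⟨s, hs, h1, h2⟩ => ⟨s, hs, h2, h1⟩)
    (by
      rintro e e₁ e₂ ⟨s, hs, h1, h2⟩ ⟨s', hs', h3, h4⟩ h5 h6
      have inj : ∀ {a b : {i // P.IsReflex i} × Bool}, P.cut a.1 a.2 = P.cut b.1 b.2 → a = b :=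
        fun {a b} hab => Prod.ext (Subtype.ext (hg.cut_injective a.1.2 b.1.2 hab).1)
          (hg.cut_injective a.1.2 b.1.2 hab).2
      exact inj (h.conflict_unique hg (cut_mem_reflexSegments e.1.2 _)
        (cut_mem_reflexSegments e₁.1.2 _) (cut_mem_reflexSegments e₂.1.2 _) hs hs' h1 h2 h3 h4
        (fun hc => h5 (inj hc)) fun hc => h6 (inj hc)))
  refine ⟨fun i => if hi : P.IsReflex i then f ⟨i, hi⟩ else true, ?_⟩
  intro i j hi hj hij s hs h1 h2
  simp only [hi, hj, dif_pos] at h1 h2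
  exact hf ⟨i, hi⟩ ⟨j, hj⟩ (fun hc => hij (congrArg Subtype.val hc)) ⟨s, hs, h1, h2⟩

theorem Thin.exists_partition_le_two (h : P.Thin) (hg : P.GeneralPosition) :
    ∃ 𝓡, P.IsRectPartition 𝓡 ∧ ∀ s ∈ P.stabbingSegments, stabCount 𝓡 s ≤ 2 := by
  obtain ⟨f, hf⟩ := h.exists_selection hg
  refine ⟨P.faces f, isRectPartition_faces, fun s hs => stabCount_faces_le_two hs ?_⟩
  by_contra! hcon
  apply hcon.1
  obtain ⟨p, hp, q, hq, hpq⟩ := hcon.2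
  obtain ⟨i, hi, hpi⟩ := mem_cuts.1 hp.2
  obtain ⟨j, hj, hqj⟩ := mem_cuts.1 hq.2
  obtain rfl : i = j := by
    by_contra hij
    exact hf i j hi hj hij s hs ⟨p, hpi, hp.1⟩ ⟨q, hqj, hq.1⟩
  -- Two distinct points in the same cut make `s` parallel to it.
  have hsub : s ⊆ P.cut i (f i) := by
    refine subset_cut_of_parallel hs hp.1 hpi ?_
    cases hfi : f i <;> rw [hfi] at hpi hqj
    · refine (axis_of_mem_stabbingSegments hs).resolve_right fun hc => hpq ?_
      exact Prod.ext ((fst_of_mem_cut hpi).trans (fst_of_mem_cut hqj).symm)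
        (hc p hp.1 q hq.1)
    · refine (axis_of_mem_stabbingSegments hs).resolve_left fun hc => hpq ?_
      exact Prod.ext (hc p hp.1 q hq.1) ((snd_of_mem_cut hpi).trans (snd_of_mem_cut hqj).symm)
  exact fun z hz => mem_cuts.2 ⟨i, hi, hsub hz⟩

theorem exists_partition_le_one (h : ∀ i, ¬ P.IsReflex i) :
    ∃ 𝓡, P.IsRectPartition 𝓡 ∧ ∀ s ∈ P.stabbingSegments, stabCount 𝓡 s ≤ 1 := by
  refine ⟨P.faces fun _ => true, isRectPartition_faces, fun s hs =>
    stabCount_faces_le_one hs fun z _ hz => ?_⟩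
  obtain ⟨i, hi, -⟩ := mem_cuts.1 hz
  exact h i hi

/-! ### Lower bounds -/

/-- The coordinates of the vertices and of the rectangles. -/
def gridX (P : RectilinearPolygon n) (𝓡 : Finset AxisRect) : Set ℝ :=
  (Set.range fun i => (P.vtx i).1) ∪ ((fun R : AxisRect => R.lo.1) '' 𝓡 ∪
    (fun R : AxisRect => R.hi.1) '' 𝓡)

/-- The ordinates of the vertices and of the rectangles. -/
def gridY (P : RectilinearPolygon n) (𝓡 : Finset AxisRect) : Set ℝ :=
  (Set.range fun i => (P.vtx i).2) ∪ ((fun R : AxisRect => R.lo.2) '' 𝓡 ∪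
    (fun R : AxisRect => R.hi.2) '' 𝓡)

theorem finite_gridX (𝓡 : Finset AxisRect) : (P.gridX 𝓡).Finite :=
  P.finite_fst.union ((𝓡.finite_toSet.image _).union (𝓡.finite_toSet.image _))

theorem finite_gridY (𝓡 : Finset AxisRect) : (P.gridY 𝓡).Finite :=
  P.finite_snd.union ((𝓡.finite_toSet.image _).union (𝓡.finite_toSet.image _))

theorem IsRectPartition.exists_mem_inner {𝓡 : Finset AxisRect} (h𝓡 : P.IsRectPartition 𝓡)
    {z : ℝ × ℝ} (hz : z ∈ P.inside) (hx : z.1 ∉ P.gridX 𝓡) (hy : z.2 ∉ P.gridY 𝓡) :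
    ∃ R ∈ 𝓡, z ∈ R.inner := by
  have h1 : z ∈ ⋃ R ∈ 𝓡, R.carrier := by rw [h𝓡.1]; exact Or.inl hz
  simp only [Set.mem_iUnion] at h1
  obtain ⟨R, hR, hc⟩ := h1
  refine ⟨R, hR, ⟨lt_of_le_of_ne hc.1.1 fun h => hx ?_, lt_of_le_of_ne hc.1.2 fun h => hx ?_⟩,
    lt_of_le_of_ne hc.2.1 fun h => hy ?_, lt_of_le_of_ne hc.2.2 fun h => hy ?_⟩
  · rw [← h]; exact Or.inr (Or.inl ⟨R, hR, rfl⟩)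
  · rw [h]; exact Or.inr (Or.inr ⟨R, hR, rfl⟩)
  · rw [← h]; exact Or.inr (Or.inl ⟨R, hR, rfl⟩)
  · rw [h]; exact Or.inr (Or.inr ⟨R, hR, rfl⟩)

theorem finite_stabbed (𝓡 : Finset AxisRect) (s : Set (ℝ × ℝ)) :
    {R | R ∈ 𝓡 ∧ (R.inner ∩ s).Nonempty}.Finite :=
  𝓡.finite_toSet.subset fun _ h => h.1

theorem IsRectPartition.exists_one_le {𝓡 : Finset AxisRect} (h𝓡 : P.IsRectPartition 𝓡) :
    ∃ s ∈ P.stabbingSegments, 1 ≤ stabCount 𝓡 s := by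
  obtain ⟨z, hz⟩ := P.connected.nonempty
  obtain ⟨ε, hε, hb⟩ := Metric.isOpen_iff.1 P.isOpen_inside z hz
  have hin : ∀ x ∈ Set.Ioo z.1 (z.1 + ε), ∀ y ∈ Set.Ioo z.2 (z.2 + ε), (x, y) ∈ P.inside := by
    intro x hx y hy
    refine hb ?_
    rw [Metric.mem_ball, Prod.dist_eq, max_lt_iff, Real.dist_eq, Real.dist_eq, abs_lt, abs_lt]
    refine ⟨⟨?_, ?_⟩, ?_, ?_⟩ <;> linarith [hx.1, hx.2, hy.1, hy.2]
  obtain ⟨x, hx, hxg⟩ := exists_mem_Ioo_notMem (P.finite_gridX 𝓡)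
    (show z.1 < z.1 + ε by linarith)
  obtain ⟨y, hy, hyg⟩ := exists_mem_Ioo_notMem (P.finite_gridY 𝓡)
    (show z.2 < z.2 + ε by linarith)
  obtain ⟨R, hR, hzR⟩ := h𝓡.exists_mem_inner (hin x hx y hy) hxg hyg
  refine ⟨openSegment ℝ (z.1, y) (z.1 + ε, y),
    IsStab.mem_stabbingSegments ⟨fun h => ?_, Or.inr rfl, ?_⟩, ?_⟩
  · have := (Prod.ext_iff.1 h).1
    dsimp only at this
    linarith
  · rw [← Prod.image_mk_openSegment_left, openSegment_eq_Ioo (by linarith)]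
    rintro _ ⟨t, ht, rfl⟩
    exact hin t ht y hy
  · refine (Set.ncard_pos (finite_stabbed _ _)).2 ⟨R, hR, (x, y), hzR, ?_⟩
    rw [← Prod.image_mk_openSegment_left, openSegment_eq_Ioo (by linarith)]
    exact ⟨x, hx, rfl⟩

/-- Take a generic point in each of the four quadrants at the vertex, at the corners of a box.
Stabbing segments join the three inner ones; if each met only one rectangle, one rectangle would
contain all three and hence the fourth, which is outside. -/
theorem IsReflex.exists_two_le {i : Fin n} (hi : P.IsReflex i) {𝓡 : Finset AxisRect}
    (h𝓡 : P.IsRectPartition 𝓡) : ∃ s ∈ P.stabbingSegments, 2 ≤ stabCount 𝓡 s := by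
  by_contra! hcon
  obtain ⟨ε, hε, hout, hin⟩ := P.local_structure i
  have heq : ∀ s ∈ P.stabbingSegments, ∀ z ∈ s, ∀ w ∈ s, ∀ R ∈ 𝓡, ∀ R' ∈ 𝓡, z ∈ R.inner →
      w ∈ R'.inner → R = R' := by
    intro s hs z hz w hw R hR R' hR' hzR hwR
    exact (Set.ncard_le_one (finite_stabbed 𝓡 s)).1 (Nat.lt_succ_iff.1 (hcon s hs)) R
      ⟨hR, z, hzR, hz⟩ R' ⟨hR', w, hwR, hw⟩
  have generic : ∀ {G : Set ℝ}, G.Finite → ∀ c d : ℝ, d ≠ 0 → ∃ s ∈ Set.Ioo 0 ε,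
      c + s * d ∉ G ∧ c + -s * d ∉ G := by
    intro G hG c d hd
    have f1 : Function.Injective fun s : ℝ => c + s * d := fun a b h =>
      mul_right_cancel₀ hd (add_left_cancel h)
    have f2 : Function.Injective fun s : ℝ => c + -s * d := fun a b h =>
      neg_injective (mul_right_cancel₀ hd (add_left_cancel h))
    obtain ⟨s, hs, hsG⟩ := exists_mem_Ioo_notMem
      ((hG.preimage f1.injOn).union (hG.preimage f2.injOn)) hε
    exact ⟨s, hs, fun h => hsG (Or.inl h), fun h => hsG (Or.inr h)⟩
  obtain ⟨s, hs, hs1, hs2⟩ := generic (P.finite_gridX 𝓡) (P.vtx i).1 _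
    (sub_ne_zero.2 (P.vtx_hn_fst_ne i))
  obtain ⟨t, ht, ht1, ht2⟩ := generic (P.finite_gridY 𝓡) (P.vtx i).2 _
    (sub_ne_zero.2 (P.vtx_vn_snd_ne i))
  have habs : ∀ {u}, u ∈ Set.Ioo 0 ε → |u| < ε ∧ |(-u)| < ε := by
    intro u hu
    rw [abs_neg, abs_of_pos hu.1]
    exact ⟨hu.2, hu.2⟩
  have i00 : P.frame i (-s) (-t) ∈ P.inside :=
    (hout _ _ (habs hs).2 (habs ht).2 (Or.inl (by linarith [hs.1]))).2 hi
  have i10 : P.frame i s (-t) ∈ P.inside :=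
    (hout _ _ (habs hs).1 (habs ht).2 (Or.inr (by linarith [ht.1]))).2 hi
  have i01 : P.frame i (-s) t ∈ P.inside :=
    (hout _ _ (habs hs).2 (habs ht).1 (Or.inl (by linarith [hs.1]))).2 hi
  obtain ⟨R, hR, hzR⟩ := h𝓡.exists_mem_inner i00 hs2 ht2
  obtain ⟨R₁, hR₁, hzR₁⟩ := h𝓡.exists_mem_inner i10 hs1 ht2
  obtain ⟨R₂, hR₂, hzR₂⟩ := h𝓡.exists_mem_inner i01 hs2 ht1
  have hmid : ∀ {u}, u ∈ Set.Ioo 0 ε → ∃ v ∈ Set.Ioo 0 ε, u < v := fun {u} hu =>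
    ⟨(u + ε) / 2, ⟨by linarith [hu.1], by linarith [hu.2]⟩, by linarith [hu.2]⟩
  have hopen : ∀ {u v : ℝ}, 0 < v → |u| < v → ∃ a b : ℝ, 0 < a ∧ 0 < b ∧ a + b = 1 ∧
      a * -v + b * v = u := by
    intro u v hv hu
    rw [abs_lt] at hu
    refine ⟨(v - u) / (2 * v), (v + u) / (2 * v), div_pos (by linarith) (by linarith),
      div_pos (by linarith) (by linarith), by field_simp; ring, by field_simp; ring⟩
  have hA : ∀ v ∈ Set.Ioo 0 ε, openSegment ℝ (P.frame i (-v) (-t)) (P.frame i v (-t)) ∈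
      P.stabbingSegments := by
    intro v hv
    refine IsStab.mem_stabbingSegments ⟨fun h => ?_, Or.inr rfl, fun z hz => ?_⟩
    · linarith [(P.frame_injective h).1, hv.1]
    · obtain ⟨r, hr, rfl⟩ := P.frame_segment_left i (openSegment_subset_segment ℝ _ _ hz)
      rw [Set.uIcc_of_le (by linarith [hv.1])] at hr
      refine (hout _ _ (abs_lt.2 ⟨?_, ?_⟩) (habs ht).2 (Or.inr (by linarith [ht.1]))).2 hi <;>
        linarith [hr.1, hr.2, hv.2]
  have hB : ∀ v ∈ Set.Ioo 0 ε, openSegment ℝ (P.frame i (-s) (-v)) (P.frame i (-s) v) ∈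
      P.stabbingSegments := by
    intro v hv
    refine IsStab.mem_stabbingSegments ⟨fun h => ?_, Or.inl rfl, fun z hz => ?_⟩
    · linarith [(P.frame_injective h).2, hv.1]
    · obtain ⟨r, hr, rfl⟩ := P.frame_segment_right i (openSegment_subset_segment ℝ _ _ hz)
      rw [Set.uIcc_of_le (by linarith [hv.1])] at hr
      refine (hout _ _ (habs hs).2 (abs_lt.2 ⟨?_, ?_⟩) (Or.inl (by linarith [hs.1]))).2 hi <;>
        linarith [hr.1, hr.2, hv.2]
  have hAm : ∀ {u v : ℝ}, 0 < v → |u| < v →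
      P.frame i u (-t) ∈ openSegment ℝ (P.frame i (-v) (-t)) (P.frame i v (-t)) := by
    intro u v hv hu
    obtain ⟨a, b, ha, hb, hab, rfl⟩ := hopen hv hu
    refine ⟨a, b, ha, hb, hab, ?_⟩
    obtain rfl : a = 1 - b := by linarith
    ext <;> simp [frame] <;> ring
  have hBm : ∀ {u v : ℝ}, 0 < v → |u| < v →
      P.frame i (-s) u ∈ openSegment ℝ (P.frame i (-s) (-v)) (P.frame i (-s) v) := by
    intro u v hv hu
    obtain ⟨a, b, ha, hb, hab, rfl⟩ := hopen hv hu
    refine ⟨a, b, ha, hb, hab, ?_⟩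
    obtain rfl : a = 1 - b := by linarith
    ext <;> simp [frame] <;> ring
  obtain ⟨s', hs', hss⟩ := hmid hs
  obtain ⟨t', ht', htt⟩ := hmid ht
  have e1 : R = R₁ := heq _ (hA s' hs') _
    (hAm (u := -s) hs'.1 (by rw [abs_neg, abs_of_pos hs.1]; exact hss)) _
    (hAm (u := s) hs'.1 (by rw [abs_of_pos hs.1]; exact hss)) R hR R₁ hR₁ hzR hzR₁
  have e2 : R = R₂ := heq _ (hB t' ht') _
    (hBm (u := -t) ht'.1 (by rw [abs_neg, abs_of_pos ht.1]; exact htt)) _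
    (hBm (u := t) ht'.1 (by rw [abs_of_pos ht.1]; exact htt)) R hR R₂ hR₂ hzR hzR₂
  subst e1 e2
  have h11 : P.frame i s t ∈ R.inner := ⟨hzR₁.1, hzR₂.2⟩
  have hreg : P.frame i s t ∈ P.region := by
    rw [← h𝓡.1]
    exact Set.mem_biUnion hR (R.inner_subset_carrier h11)
  rcases hreg with h1 | h1
  · exact (hin s hs t ht).1 h1 hi
  · exact not_mem_boundary_of_generic (fun h => hs1 (Or.inl h)) (fun h => ht1 (Or.inl h)) h1

/-! ### The stabbing number -/

theorem isStabbingNumber_of {m : ℕ}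
    (hlow : ∀ 𝓡, P.IsRectPartition 𝓡 → ∃ s ∈ P.stabbingSegments, m ≤ stabCount 𝓡 s)
    (hup : ∃ 𝓡, P.IsRectPartition 𝓡 ∧ ∀ s ∈ P.stabbingSegments, stabCount 𝓡 s ≤ m) :
    P.IsStabbingNumber m := by
  constructor
  · obtain ⟨𝓡, h1, h2⟩ := hup
    obtain ⟨s, hs, hm⟩ := hlow 𝓡 h1
    refine ⟨𝓡, h1, ⟨s, hs, le_antisymm (h2 s hs) hm⟩, ?_⟩
    rintro _ ⟨s, hs, rfl⟩
    exact h2 s hs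
  · rintro k ⟨𝓡, h1, h2⟩
    obtain ⟨s, hs, hm⟩ := hlow 𝓡 h1
    exact hm.trans (h2.2 ⟨s, hs, rfl⟩)

theorem isStabbingNumber_one (h : ∀ i, ¬ P.IsReflex i) : P.IsStabbingNumber 1 :=
  isStabbingNumber_of (fun _ h𝓡 => h𝓡.exists_one_le) (exists_partition_le_one h)

theorem Thin.isStabbingNumber_two (h : P.Thin) (hg : P.GeneralPosition)
    (hr : ∃ i, P.IsReflex i) : P.IsStabbingNumber 2 := by
  obtain ⟨i, hi⟩ := hr
  exact isStabbingNumber_of (fun _ h𝓡 => hi.exists_two_le h𝓡) (h.exists_partition_le_two hg)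

/-- The reflex vertex and its two neighbours are three vertices. Its horizontal cut ends on a
vertical edge with a new abscissa, whose ends are two more. -/
theorem GeneralPosition.five_le (hg : P.GeneralPosition) (hr : ∃ i, P.IsReflex i) : 5 ≤ n := by
  obtain ⟨i, hi⟩ := hr
  obtain ⟨T, hT⟩ := hi.exists_hits true
  have hray : (P.ray i true T).1 = (P.vtx i).1 + T * ((P.vtx i).1 - (P.vtx (P.hn i)).1) := by
    simp [ray_eq, dir]
  have hX := sub_ne_zero.2 (P.vtx_hn_fst_ne i).symm
  have hb2 : (P.ray i true T).2 = (P.vtx i).2 := ray_true_snd i T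
  have hT0 := hT.1
  have hbi : (P.ray i true T).1 ≠ (P.vtx i).1 := by
    rw [hray]
    intro h1
    rcases mul_eq_zero.1 (left_eq_add.1 h1.symm) with h2 | h2
    · exact hT0.ne' h2
    · exact hX h2
  have hbh : (P.ray i true T).1 ≠ (P.vtx (P.hn i)).1 := by
    rw [hray]
    intro h1
    have : (T + 1) * ((P.vtx i).1 - (P.vtx (P.hn i)).1) = 0 := by linarith
    rcases mul_eq_zero.1 this with h2 | h2
    · linarith
    · exact hX h2
  obtain ⟨y, -, hy, hyb⟩ := hg.exists_boundary_beside hT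
    (y := (P.vtx (P.vn i)).2) (P.vtx_vn_snd_ne i)
  obtain ⟨k, hk, hkx⟩ : ∃ k, ¬ P.IsHor k ∧ (P.vtx k).1 = (P.ray i true T).1 := by
    rcases edge_or hT.2.1 with ⟨k, h1, -, h2⟩ | ⟨k, h1, h3, h2⟩
    · exact ⟨k, h1, h2.symm⟩
    · exfalso
      have hline : ∀ k, (P.vtx k).2 = (P.vtx i).2 → k = i ∨ k = P.hn i := by
        intro k hk
        by_contra! hne
        exact (hg i (P.hn i) k (P.hn_ne i).symm hne.2.symm hne.1.symm).2
          ⟨(P.vtx_hn_snd i).symm, (P.vtx_hn_snd i).trans hk.symm⟩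
      have hm := (RectilinearBoundary.mem_edge_hor h1).1 h3
      have e1 := hline k (h2.symm.trans hb2)
      have e2 := hline (P.next k) (Eq.trans (Eq.symm h1) (h2.symm.trans hb2))
      have hmem : (P.ray i true T).1 ∈ Set.uIcc (P.vtx i).1 (P.vtx (P.hn i)).1 := by
        have h4 := P.next_ne k
        rcases e1 with e1 | e1 <;> rcases e2 with e2 | e2
        · exact absurd (e2.trans e1.symm) h4
        · rw [e2, e1] at hm; exact hm.2
        · rw [e2, e1, Set.uIcc_comm] at hm; exact hm.2
        · exact absurd (e2.trans e1.symm) h4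
      rw [hray, Set.mem_uIcc] at hmem
      rcases lt_or_gt_of_ne hX with h1 | h1 <;> rcases hmem with h2 | h2 <;> nlinarith
  have hkn : (P.vtx (P.next k)).1 = (P.ray i true T).1 :=
    ((P.alternates.vert_iff k).2 hk).symm.trans hkx
  have hcard : ({i, P.hn i, P.vn i, k, P.next k} : Finset (Fin n)).card = 5 := by
    have n1 : i ≠ P.hn i := (P.hn_ne i).symm
    have n2 : i ≠ P.vn i := (P.vn_ne i).symm
    have n3 : i ≠ k := by rintro rfl; exact hbi hkx.symm
    have n4 : i ≠ P.next k := fun h => hbi (by rw [← hkn, ← h])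
    have n5 : P.hn i ≠ P.vn i := fun h =>
      P.vtx_hn_fst_ne i (by rw [h, P.vtx_vn_fst])
    have n6 : P.hn i ≠ k := fun h => hbh (by rw [h, hkx])
    have n7 : P.hn i ≠ P.next k := fun h => hbh (by rw [h, hkn])
    have n8 : P.vn i ≠ k := fun h => hbi (by rw [← hkx, ← h, P.vtx_vn_fst])
    have n9 : P.vn i ≠ P.next k := fun h => hbi (by rw [← hkn, ← h, P.vtx_vn_fst])
    have n10 : k ≠ P.next k := (P.next_ne k).symm
    rw [Finset.card_insert_of_notMem, Finset.card_insert_of_notMem, Finset.card_insert_of_notMem,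
      Finset.card_insert_of_notMem, Finset.card_singleton] <;> simp [*]
  have := Finset.card_le_univ ({i, P.hn i, P.vn i, k, P.next k} : Finset (Fin n))
  rwa [hcard, Fintype.card_fin] at this

/-- A polygon without reflex vertices is a rectangle. -/
theorem le_four (h : ∀ i, ¬ P.IsReflex i) : n ≤ 4 := by
  have hcuts : P.cuts (fun _ => true) = ∅ := by
    rw [Set.eq_empty_iff_forall_notMem]
    intro z hz
    obtain ⟨i, hi, -⟩ := mem_cuts.1 hz
    exact h i hi
  have hopen : P.openPart (fun _ => true) = P.inside := by rw [openPart, hcuts, Set.sdiff_empty]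
  obtain ⟨z, hz⟩ := P.connected.nonempty
  obtain ⟨R, hR, hzR⟩ := exists_isFace (f := fun _ => true) (hopen.symm ▸ hz)
  -- Without cuts the whole connected interior is a single face.
  have hin : P.inside = R.inner := subset_antisymm
    (hR.subset P.connected.isPreconnected hopen.symm.subset ⟨z, hz, hzR⟩)
    (hR.1.trans hopen.subset)
  have hbd : ∀ w ∈ P.boundary, w ∈ R.carrier ∧ w ∉ R.inner := by
    intro w hw
    refine ⟨?_, fun h1 => (hin.symm.subset h1).1 hw⟩
    rw [← R.closure_inner, ← hin]
    exact boundary_subset_closure_inside hw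
  have mid : ∀ {a b l u : ℝ}, a ≠ b → a ∈ Set.Icc l u → b ∈ Set.Icc l u →
      (a + b) / 2 ∈ Set.Ioo l u := by
    intro a b l u hab ha hb
    rcases lt_or_gt_of_ne hab with h1 | h1 <;> constructor <;> linarith [ha.1, ha.2, hb.1, hb.2]
  -- Otherwise the midpoint of the vertical edge at the vertex would lie in the open rectangle. With
  -- the same argument for ordinates, all vertices are corners of `R`.
  have hx : ∀ i, (P.vtx i).1 = R.lo.1 ∨ (P.vtx i).1 = R.hi.1 := by
    intro i
    by_contra! hne
    have h1 := (hbd _ (P.vtx_mem_boundary i)).1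
    have h2 := (hbd _ (P.vtx_mem_boundary (P.vn i))).1
    have h3 : ((P.vtx i).1, ((P.vtx i).2 + (P.vtx (P.vn i)).2) / 2) ∈ P.boundary := by
      apply P.segment_vn_subset i
      refine ⟨1 / 2, 1 / 2, by norm_num, by norm_num, by norm_num, ?_⟩
      ext <;> simp [P.vtx_vn_fst] <;> ring
    exact (hbd _ h3).2 ⟨⟨lt_of_le_of_ne h1.1.1 hne.1.symm, lt_of_le_of_ne h1.1.2 hne.2⟩,
      mid (P.vtx_vn_snd_ne i).symm h1.2 h2.2⟩
  have hy : ∀ i, (P.vtx i).2 = R.lo.2 ∨ (P.vtx i).2 = R.hi.2 := by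
    intro i
    by_contra! hne
    have h1 := (hbd _ (P.vtx_mem_boundary i)).1
    have h2 := (hbd _ (P.vtx_mem_boundary (P.hn i))).1
    have h3 : (((P.vtx i).1 + (P.vtx (P.hn i)).1) / 2, (P.vtx i).2) ∈ P.boundary := by
      apply P.segment_hn_subset i
      refine ⟨1 / 2, 1 / 2, by norm_num, by norm_num, by norm_num, ?_⟩
      ext <;> simp [P.vtx_hn_snd] <;> ring
    exact (hbd _ h3).2 ⟨mid (P.vtx_hn_fst_ne i).symm h1.1 h2.1,
      lt_of_le_of_ne h1.2.1 hne.1.symm, lt_of_le_of_ne h1.2.2 hne.2⟩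
  classical
  have hcard := Finset.card_le_card_of_injOn (s := (Finset.univ : Finset (Fin n)))
    (t := ({R.lo.1, R.hi.1} : Finset ℝ) ×ˢ ({R.lo.2, R.hi.2} : Finset ℝ)) P.vtx
    (fun i _ => by simpa using ⟨hx i, hy i⟩) P.vtx_injective.injOn
  rw [Finset.card_univ, Fintype.card_fin, Finset.card_product] at hcard
  exact hcard.trans (Nat.mul_le_mul Finset.card_le_two Finset.card_le_two)

/-- Lets a bound linear in `n` absorb the constant running time. -/
theorem pos (P : RectilinearPolygon n) : 1 ≤ n := by
  rw [Nat.one_le_iff_ne_zero]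
  rintro rfl
  obtain ⟨z, hz⟩ := P.connected.nonempty
  have := (P.mem_inside.1 hz).2
  simp [RectilinearBoundary.par] at this

/-- A thin polygon in general position has stabbing number 1 if it is a rectangle, and stabbing
number 2 otherwise. -/
theorem Thin.isStabbingNumber (h : P.Thin) (hg : P.GeneralPosition) :
    P.IsStabbingNumber (if n < 5 then 1 else 2) := by
  by_cases hr : ∃ i, P.IsReflex i
  · rw [if_neg (hg.five_le hr).not_gt]
    exact h.isStabbingNumber_two hg hr
  · push Not at hr
    rw [if_pos (Nat.lt_succ_iff.2 (le_four hr))]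
    exact isStabbingNumber_one hr

end RectilinearPolygon

/-! ### The algorithm. -/

namespace RealRAM

/-- The program that returns 1 for inputs with fewer than five vertices, and 2 otherwise. -/
def stabbingProgram : Program :=
  [.const 1 5, .jumpLT 0 1 4, .const 0 2, .halt, .const 0 1, .halt]

theorem haltsWithin_stabbingProgram {s : State} (h : s.pc = 0) :
    HaltsWithin stabbingProgram s 3 (if s.Z 0 < 5 then 1 else 2) := by
  by_cases hn : s.Z 0 < 5
  · rw [if_pos hn]
    -- Three instructions are executed: load the constant 5, compare, load the answer. The machine
    -- then stands at a `halt`.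
    refine ⟨3, le_rfl, ⟨5, Function.update (Function.update s.Z 1 5) 0 1, s.R, s.mem, s.rmem⟩,
      .tail (u := ⟨4, Function.update s.Z 1 5, s.R, s.mem, s.rmem⟩)
        (.tail (u := ⟨1, Function.update s.Z 1 5, s.R, s.mem, s.rmem⟩)
          (.tail (.refl s) ?_) ?_) ?_, ?_, ?_⟩ <;>
      simp [step, stabbingProgram, Instr.exec, h, hn]
  · rw [if_neg hn]
    refine ⟨3, le_rfl, ⟨3, Function.update (Function.update s.Z 1 5) 0 2, s.R, s.mem, s.rmem⟩,
      .tail (u := ⟨2, Function.update s.Z 1 5, s.R, s.mem, s.rmem⟩)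
        (.tail (u := ⟨1, Function.update s.Z 1 5, s.R, s.mem, s.rmem⟩)
          (.tail (.refl s) ?_) ?_) ?_, ?_, ?_⟩ <;>
      simp [step, stabbingProgram, Instr.exec, h, hn]

end RealRAM

theorem mainTheorem3 :
    (∃ (p : RealRAM.Program) (c : ℕ), ∀ (n : ℕ) (P : RectilinearPolygon n),
      P.Thin → P.GeneralPosition →
        ∃ k, P.IsStabbingNumber k ∧ RealRAM.HaltsWithin p (RealRAM.start P) (c * n) k) ∧
    (∀ (n : ℕ) (P : RectilinearPolygon n), P.Thin → P.GeneralPosition →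
      (∀ s ∈ P.stabbingSegments, {r ∈ P.reflexSegments | (r ∩ s).Nonempty}.encard ≤ 2) ∧
      (P.IsStabbingNumber 1 ∨ P.IsStabbingNumber 2 ∨ P.IsStabbingNumber 3)) := by
  refine ⟨⟨RealRAM.stabbingProgram, 3, fun n P h hg => ⟨_, h.isStabbingNumber hg, ?_⟩⟩,
    fun n P h hg => ⟨fun s hs => h.encard_le_two hg hs, ?_⟩⟩
  · obtain ⟨t, ht, hu⟩ := RealRAM.haltsWithin_stabbingProgram (s := RealRAM.start P) rfl
    exact ⟨t, ht.trans (by have := P.pos; omega), hu⟩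
  · have := h.isStabbingNumber hg
    split_ifs at this
    · exact Or.inl this
    · exact Or.inr (Or.inl this)
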